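/- Let $J^1=\mathbb{R}^5$ be the space of $1$-jets of smooth functions on the plane, with coordinates $(x,y,z,p,q)$ and contact form $U=dz-p\,dx-q\,dy$. Let $X$ be a Cartan field on an open set $M\subseteq J^1$, i.e. a $C^\infty$ vector field on $M$ with $U(X)=0$. Write $X^k(U)$ for the $k$-th iterated Lie derivative of $U$ along $X$. The type of $X$ at a point is the rank there of the system $U,X(U),X^2(U),X^3(U)$. Let $X^\perp=\{U=0,\ X(U)=0\}$. For a distribution $\mathcal P$ let $\mathcal P'=\mathcal P+[\mathcal P,\mathcal P]$ be the derived distribution, spanned pointwise by $\mathcal P$ and the Lie brackets of its smooth local sections, and let $\mathcal P''=(\mathcal P')'$. A contact chart is a smooth chart with coordinates $(x',y',z',p',q')$ for which $dz'-p'dx'-q'dy'$ is a nowhere vanishing multiple of $U$. Say that $X$ has a normal form at $m\in M$ if, in some contact chart $(x',y',z',p',q')$ around $m$ with domain contained in $M$, $X$ is a nowhere vanishing smooth multiple of one of $$\partial_{p'}\qquad\text{or}\qquad \partial_{p'}+z'\,\partial_{q'} .$$ Theorem. (1) For every $m\in M$: $X$ has a normal form at $m$ if and only if $X$ is of type $2$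 at all points of a neighbourhood of $m$ and the dimension of $(X^\perp)''$ is constant near $m$. (2) If $X$ vanishes nowhere on $M$, then $X$ is of type $2$ at every point of $M$ if and only if $X$ has a normal form at every point of some open dense subset of $M$. -/

import Mathlib

open scoped ContDiff Topology

noncomputable section

namespace CartanField

/-- The bundle of 1-jets of smooth functions on the plane, in its standard coordinates
`(x, y, z, p, q)`, which are numbered `0, 1, 2, 3, 4`. -/
abbrev J1 : Type := Fin 5 → ℝ

/-- The contact form `U = dz - p dx - q dy`. -/
def contactForm (m : J1) : J1 →L[ℝ] ℝ :=
  ContinuousLinearMap.proj (R := ℝ) (φ := fun _ : Fin 5 => ℝ) 2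
    - m 3 • ContinuousLinearMap.proj (R := ℝ) (φ := fun _ : Fin 5 => ℝ) 0
    - m 4 • ContinuousLinearMap.proj (R := ℝ) (φ := fun _ : Fin 5 => ℝ) 1

/-- The Lie derivative `X(α)` of a 1-form `α` along a vector field `X`:
`X(α)_i = X^j ∂_j α_i + α_j ∂_i X^j`. -/
def lieDerivForm (X : J1 → J1) (α : J1 → J1 →L[ℝ] ℝ) : J1 → J1 →L[ℝ] ℝ :=
  fun m => fderiv ℝ α m (X m) + (α m).comp (fderiv ℝ X m)

/-- `X` is a Cartan field on `M`: a smooth vector field on `M` with values in the contact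
distribution `{U = 0}`. -/
def IsCartanField (M : Set J1) (X : J1 → J1) : Prop :=
  ContDiffOn ℝ ∞ X M ∧ ∀ m ∈ M, contactForm m (X m) = 0

/-- The type of `X` at `m`: the rank at `m` of the system `U, X(U), X²(U), X³(U)`. -/
def typeAt (X : J1 → J1) (m : J1) : ℕ :=
  Module.finrank ℝ
    (Submodule.span ℝ (Set.range fun k : Fin 4 => (lieDerivForm X)^[(k : ℕ)] contactForm m))

/-- The orthogonal complement `X^⊥ = {U = 0, X(U) = 0}`. -/
def orthDist (X : J1 → J1) (m : J1) : Submodule ℝ J1 :=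
  LinearMap.ker (contactForm m).toLinearMap ⊓
    LinearMap.ker (lieDerivForm X contactForm m).toLinearMap

/-- `Y` is a smooth section on `V` of the distribution `P`. -/
def IsSection (P : J1 → Submodule ℝ J1) (V : Set J1) (Y : J1 → J1) : Prop :=
  ContDiffOn ℝ ∞ Y V ∧ ∀ m ∈ V, Y m ∈ P m

/-- The derived distribution `P' = P + [P, P]`: at `m` it is spanned by `P m` and the values at
`m` of the Lie brackets of smooth sections of `P` defined near `m`. -/
def derivedDist (P : J1 → Submodule ℝ J1) (m : J1) : Submodule ℝ J1 :=
  P m ⊔ Submodule.span ℝ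
    {v | ∃ (V : Set J1) (Y Z : J1 → J1), IsOpen V ∧ m ∈ V ∧ IsSection P V Y ∧ IsSection P V Z ∧
      v = VectorField.lieBracket ℝ Y Z m}

/-- A contact chart: a smooth chart whose coordinates `(x', y', z', p', q')` are such that
`dz' - p' dx' - q' dy'` is a nowhere vanishing multiple of `U`. -/
structure IsContactChart (φ : OpenPartialHomeomorph J1 J1) : Prop where
  smooth : ContDiffOn ℝ ∞ φ φ.source
  smooth_symm : ContDiffOn ℝ ∞ φ.symm φ.target
  contact : ∀ m ∈ φ.source, ∃ c : ℝ, c ≠ 0 ∧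
    (contactForm (φ m)).comp (fderiv ℝ φ m) = c • contactForm m

/-- The field `∂_p`. -/
def fieldDp : J1 → J1 := fun _ => Pi.single 3 1

/-- The field `∂_p + z ∂_q`. -/
def fieldDpzDq : J1 → J1 := fun m => Pi.single 3 1 + m 2 • Pi.single 4 1

/-- In the chart `φ`, the field `X` is, up to a nowhere vanishing smooth factor, the field whose
coordinate expression is `N`. -/
def HasDirectionInChart (φ : OpenPartialHomeomorph J1 J1) (X N : J1 → J1) : Prop :=
  ∃ ρ : J1 → ℝ, ContDiffOn ℝ ∞ ρ φ.source ∧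
    ∀ m ∈ φ.source, ρ m ≠ 0 ∧ fderiv ℝ φ m (X m) = ρ m • N (φ m)

/-- Some contact chart around `m`, with domain inside `M`, gives `X` the direction of `∂_p` or of
`∂_p + z ∂_q`. -/
def HasNormalFormAt (M : Set J1) (X : J1 → J1) (m : J1) : Prop :=
  ∃ φ : OpenPartialHomeomorph J1 J1, IsContactChart φ ∧ m ∈ φ.source ∧ φ.source ⊆ M ∧
    (HasDirectionInChart φ X fieldDp ∨ HasDirectionInChart φ X fieldDpzDq)

/-- The second derived distribution `(X^⊥)''` has constant dimension near `m`. -/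
def IsRegularAt (X : J1 → J1) (m : J1) : Prop :=
  ∃ k : ℕ, ∀ᶠ m' in 𝓝 m, Module.finrank ℝ (derivedDist (derivedDist (orthDist X)) m') = k

end CartanField

end

/-! Since `U(X) = 0`, Cartan's formula gives `X(U) = i_X dU`. Where `X ≠ 0` this form is independent
of `U`, so `X^⊥` has rank 3 and contains `X`, and type 2 means that `X²(U)` and `X³(U)` vanish on
`X^⊥`. With `V = X(U)`, the first condition reads `i_X dV = 0` on `X^⊥`; also `i_X dU = 0` there,
while `dU` has rank 2 on `X^⊥`. Hence a suitable `W = V - c U` satisfies `X^⊥ = {U = W = 0}` and `dW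
= 0` on `X^⊥` (`exists_adapted`), and conversely such a `W` forces type 2
(`typeAt_eq_two_of_adapted`). Then `(X^⊥)' = ker W`, and `(X^⊥)''` has dimension 4 or 5 at a point
according to whether `dW` vanishes on `ker W` there (`IsFlatAt`) or not.

It remains to find contact coordinates in which `X^⊥` is `{U = 0, dx + l dy = 0}` with `l = 0` or `l
= z` and in which `x`, `y` are first integrals of `X`; these give the direction of `X`
(`hasNormalFormAt_of_jetCoords`). In the flat case, Frobenius yields `dx = a W`; with a first
integral `y` of `X` that is not constant on `X^⊥`, the system `U, dx, dy` is integrable and contains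
`dz` with a nonzero `U`-component. In the nowhere flat case put `S = [F₁, F₂]` for the frame `X, F₁,
F₂` of `X^⊥`, and `θ = i_S dW`. On `ker W` the form `dW` is a nonzero multiple of `θ ∧ U`; the
systems `U, W, θ` and then `W, dy` are integrable and give `y` and `x` with `dx = b₀ W + b₁ dy`, and
`z = -b₁` completes the coordinates.

For (2), non-flatness is an open condition, so near any point there is either a non-flat point or
flatness throughout; this gives density. Conversely, type 2 is a closed condition where `X ≠ 0`.

The Frobenius theorem rests on the joint flow of commuting fields, whose smoothness comes from the
implicit function theorem in a Banach space of continuous curves. -/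

section
-- Smooth flows of commuting vector fields
open Filter Set
open scoped unitInterval

/-- A parametrised fixed point equation `T (p, c) = c` whose right-hand side does not depend on `c`
to first order at the base point has a smooth solution `Γ p` near that point. -/
theorem exists_smooth_fixedPoint {P C : Type*} [NormedAddCommGroup P] [NormedSpace ℝ P]
    [CompleteSpace P] [NormedAddCommGroup C] [NormedSpace ℝ C] [CompleteSpace C]
    {T : P × C → C} (hT : ContDiff ℝ ∞ T) {p₀ : P} {c₀ : C} (h₀ : T (p₀, c₀) = c₀)
    (hd : ∀ c, fderiv ℝ T (p₀, c₀) (0, c) = 0) :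
    ∃ Γ : P → C, Γ p₀ = c₀ ∧
      ∀ᶠ p in 𝓝 p₀, ContDiffAt ℝ ∞ Γ p ∧ T (p, Γ p) = Γ p := by
  set f : P × C → C := fun u => u.2 - T u with hf
  have hfs : ContDiff ℝ ∞ f := contDiff_snd.sub hT
  have hfd : ∀ u, fderiv ℝ f u ∘L .inr ℝ P C
      = ContinuousLinearMap.id ℝ C - fderiv ℝ T u ∘L .inr ℝ P C := by
    intro u
    have : fderiv ℝ f u = ContinuousLinearMap.snd ℝ P C - fderiv ℝ T u := by
      have h1 : HasFDerivAt f (ContinuousLinearMap.snd ℝ P C - fderiv ℝ T u) u :=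
        hasFDerivAt_snd.sub ((hT.differentiable (by simp)) u).hasFDerivAt
      exact h1.fderiv
    rw [this]
    ext c
    simp
  have hinv₀ : (fderiv ℝ f (p₀, c₀) ∘L .inr ℝ P C).IsInvertible := by
    rw [hfd]
    have : fderiv ℝ T (p₀, c₀) ∘L .inr ℝ P C = 0 := by
      ext c; simpa using hd c
    rw [this, sub_zero]
    exact ⟨ContinuousLinearEquiv.refl ℝ C, rfl⟩
  have hinv : ∀ᶠ u in 𝓝 (p₀, c₀), (fderiv ℝ f u ∘L .inr ℝ P C).IsInvertible := by
    have hc : Continuous fun u => fderiv ℝ f u ∘L .inr ℝ P C :=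
      (hfs.continuous_fderiv (by simp)).clm_comp continuous_const
    obtain ⟨e, he⟩ := hinv₀
    have : range ((↑) : (C ≃L[ℝ] C) → C →L[ℝ] C) ∈ 𝓝 (fderiv ℝ f (p₀, c₀) ∘L .inr ℝ P C) := by
      rw [← he]; exact ContinuousLinearEquiv.nhds e
    exact hc.continuousAt.eventually this
  set Γ := (hfs.contDiffAt (x := (p₀, c₀))).implicitFunction (by simp) hinv₀ with hΓ
  have hΓ₀ : Γ p₀ = c₀ :=
    (hfs.contDiffAt (x := (p₀, c₀))).implicitFunction_apply_self (by simp) hinv₀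
  have hΓs : ContDiffAt ℝ ∞ Γ p₀ :=
    (hfs.contDiffAt (x := (p₀, c₀))).contDiffAt_implicitFunction (by simp) hinv₀
  have hΓeq : ∀ᶠ p in 𝓝 p₀, f (p, Γ p) = f (p₀, c₀) :=
    (hfs.contDiffAt (x := (p₀, c₀))).eventually_apply_implicitFunction (by simp) hinv₀
  have hf₀ : f (p₀, c₀) = 0 := by simp [hf, h₀]
  rw [hf₀] at hΓeq
  have hcont : ∀ᶠ p in 𝓝 p₀, ContinuousAt Γ p :=
    ((hΓs.of_le (m := 1) (by simp)).eventually (by simp)).mono fun p hp => hp.continuousAt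
  have hgraph : Tendsto (fun p => (p, Γ p)) (𝓝 p₀) (𝓝 (p₀, c₀)) := by
    have := (continuousAt_id (x := p₀)).prodMk hΓs.continuousAt
    rw [ContinuousAt] at this
    simpa [hΓ₀] using this
  refine ⟨Γ, hΓ₀, ?_⟩
  filter_upwards [hΓeq.eventually_nhds, hcont, hgraph.eventually hinv] with p h1 h2 h3
  have h1p := h1.self_of_nhds
  refine ⟨?_, ?_⟩
  · have hu := hfs.contDiffAt (x := (p, Γ p))
    -- Smoothness of infinite order at the base point does not by itself extend to a neighbourhood.
    -- By local uniqueness, `Γ` agrees near `p` with the implicit function based at `(p, Γ p)`,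
    -- which is smooth at `p`.
    have hiff := hu.eventually_apply_eq_iff_implicitFunction (by simp) h3
    have hg2 : Tendsto (fun p' => (p', Γ p')) (𝓝 p) (𝓝 (p, Γ p)) := continuousAt_id.prodMk h2
    refine (hu.contDiffAt_implicitFunction (by simp) h3).congr_of_eventuallyEq ?_
    filter_upwards [hg2.eventually hiff, h1] with p' h4 h5
    exact (h4.1 (by rw [h5, h1p])).symm
  · have : Γ p - T (p, Γ p) = 0 := h1p
    exact (sub_eq_zero.1 this).symm

section Superposition

variable {K : Type} [TopologicalSpace K] [CompactSpace K]

/-- Pointwise application of operator-valued continuous maps. -/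
noncomputable def ContinuousMap.pointwiseApply (K E F : Type) [TopologicalSpace K] [CompactSpace K]
    [NormedAddCommGroup E] [NormedSpace ℝ E] [NormedAddCommGroup F] [NormedSpace ℝ F] :
    C(K, E →L[ℝ] F) →L[ℝ] C(K, E) →L[ℝ] C(K, F) :=
  LinearMap.mkContinuous₂
    (LinearMap.mk₂ ℝ (fun (A : C(K, E →L[ℝ] F)) (h : C(K, E)) =>
      (⟨fun t => A t (h t), by fun_prop⟩ : C(K, F)))
      (by intros; ext; simp) (by intros; ext; simp) (by intros; ext; simp)
      (by intros; ext; simp)) 1 (by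
    intro A h
    rw [one_mul, ContinuousMap.norm_le _ (by positivity)]
    intro t
    exact ((A t).le_opNorm _).trans
      (mul_le_mul (A.norm_coe_le_norm t) (h.norm_coe_le_norm t) (norm_nonneg _) (norm_nonneg A)))

variable {E F : Type} [NormedAddCommGroup E] [NormedSpace ℝ E]
  [NormedAddCommGroup F] [NormedSpace ℝ F]

@[simp] theorem ContinuousMap.pointwiseApply_apply (A : C(K, E →L[ℝ] F)) (h : C(K, E)) (t : K) :
    ContinuousMap.pointwiseApply K E F A h t = A t (h t) := rfl

/-- The mean value inequality is applied on each segment from `γ t` to `γ t + h t`. Postcomposition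
with `g'` is continuous for the sup norm, so `g'` varies by at most `ε` along all these segments at
once. -/
theorem ContinuousMap.hasFDerivAt_comp (g : C(E, F)) (g' : C(E, E →L[ℝ] F))
    (hg : ∀ x, HasFDerivAt g (g' x) x) (γ : C(K, E)) :
    HasFDerivAt (fun γ : C(K, E) => g.comp γ)
      (ContinuousMap.pointwiseApply K E F (g'.comp γ)) γ := by
  rw [hasFDerivAt_iff_isLittleO_nhds_zero, Asymptotics.isLittleO_iff]
  intro ε hε
  have hc : Continuous fun h : C(K, E) => g'.comp h := ContinuousMap.continuous_postcomp g'
  have hev := (Metric.continuousAt_iff (α := C(K, E)) (β := C(K, E →L[ℝ] F))).1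
    (hc.continuousAt (x := γ)) ε hε
  obtain ⟨δ, hδ, hδε⟩ := hev
  filter_upwards [Metric.ball_mem_nhds (0 : C(K, E)) hδ] with h hh
  rw [ContinuousMap.norm_le _ (by positivity)]
  intro t
  simp only [mem_ball_zero_iff] at hh
  have key := Convex.norm_image_sub_le_of_norm_hasFDerivWithin_le' (𝕜 := ℝ) (f := g)
    (f' := fun x => g' x) (φ := g' (γ t)) (C := ε) (s := segment ℝ (γ t) (γ t + h t))
    (x := γ t) (y := γ t + h t) (fun x _ => (hg x).hasFDerivWithinAt) ?_
    (convex_segment _ _) (left_mem_segment _ _ _) (right_mem_segment _ _ _)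
  · simp only [ContinuousMap.sub_apply, ContinuousMap.comp_apply, ContinuousMap.add_apply,
      ContinuousMap.pointwiseApply_apply]
    rw [add_sub_cancel_left] at key
    exact key.trans (mul_le_mul_of_nonneg_left (h.norm_coe_le_norm t) hε.le)
  · intro x hx
    rw [segment_eq_image'] at hx
    obtain ⟨s, hs, rfl⟩ := hx
    have h1 : dist (γ + s • h) γ < δ := by
      rw [dist_eq_norm, add_sub_cancel_left, norm_smul, Real.norm_of_nonneg hs.1]
      exact (mul_le_of_le_one_left (norm_nonneg _) hs.2).trans_lt hh
    have h2 := (hδε h1).le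
    have h3 := (ContinuousMap.dist_apply_le_dist t).trans h2
    rw [dist_eq_norm] at h3
    simpa using h3

/-- Superposition with a smooth function is smooth on spaces of continuous maps. -/
theorem ContinuousMap.contDiff_comp (g : C(E, F)) (hg : ContDiff ℝ ∞ g) :
    ContDiff ℝ ∞ (fun γ : C(K, E) => g.comp γ) := by
  rw [contDiff_infty]
  intro n
  -- The derivative is again given by superposition, now with `fderiv ℝ g`, which takes values in `E
  -- →L[ℝ] F`; hence the target space has to vary in the induction.
  induction n generalizing F with
  | zero =>
    have h : ContDiff ℝ 0 (fun γ : C(K, E) => g.comp γ) :=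
      contDiff_zero.2 (ContinuousMap.continuous_postcomp g)
    simpa using h
  | succ n ih =>
    have hg' : ContDiff ℝ ∞ (fderiv ℝ g) := hg.fderiv_right (by simp)
    let g' : C(E, E →L[ℝ] F) := ⟨fderiv ℝ g, hg'.continuous⟩
    push_cast
    rw [contDiff_succ_iff_hasFDerivAt (𝕜 := ℝ) (E := C(K, E)) (F := C(K, F)) (n := n)
      (f := fun γ : C(K, E) => g.comp γ)]
    refine ⟨fun γ => ContinuousMap.pointwiseApply K E F (g'.comp γ), ?_, fun γ => ?_⟩
    · exact (ContinuousMap.pointwiseApply K E F).contDiff.comp (ih g' hg')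
    · exact ContinuousMap.hasFDerivAt_comp g g'
        (fun x => ((hg.differentiable (by simp)) x).hasFDerivAt) γ

end Superposition

/-- Integration from `0`, as an operator on continuous curves. -/
noncomputable def ContinuousMap.primitive (F : Type) [NormedAddCommGroup F] [NormedSpace ℝ F] :
    C(I, F) →L[ℝ] C(I, F) :=
  LinearMap.mkContinuous
    { toFun := fun γ => ⟨fun t : I => ∫ s in (0 : ℝ)..t, Set.IccExtend zero_le_one γ s, by
        exact (intervalIntegral.continuous_primitive (fun a b =>
          (γ.continuous.Icc_extend').intervalIntegrable a b) 0).comp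
            continuous_subtype_val⟩
      map_add' := by
        intro γ δ
        ext t
        exact intervalIntegral.integral_add
          (γ.continuous.Icc_extend'.intervalIntegrable _ _)
          (δ.continuous.Icc_extend'.intervalIntegrable _ _)
      map_smul' := by
        intro c γ
        ext t
        exact intervalIntegral.integral_smul _ _ } 1 (by
    intro γ
    rw [one_mul, ContinuousMap.norm_le _ (norm_nonneg _)]
    intro t
    have h := intervalIntegral.norm_integral_le_of_norm_le_const (a := (0 : ℝ)) (b := t)
      (f := Set.IccExtend zero_le_one γ) (C := ‖γ‖) (fun s _ => γ.norm_coe_le_norm _)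
    refine h.trans ?_
    rw [sub_zero, abs_of_nonneg t.2.1]
    exact mul_le_of_le_one_right (norm_nonneg _) t.2.2)

theorem ContinuousMap.primitive_apply {F : Type} [NormedAddCommGroup F] [NormedSpace ℝ F]
    (γ : C(I, F)) (t : I) :
    ContinuousMap.primitive F γ t = ∫ s in (0 : ℝ)..t, Set.IccExtend zero_le_one γ s := rfl

/-- A curve of the form `y + ∫ δ` has the derivative `δ`. -/
theorem ContinuousMap.hasDerivWithinAt_primitive {F : Type} [NormedAddCommGroup F]
    [NormedSpace ℝ F] [CompleteSpace F] (δ : C(I, F)) (t : ℝ) (ht : t ∈ Icc (0 : ℝ) 1) :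
    HasDerivWithinAt (Set.IccExtend zero_le_one (ContinuousMap.primitive F δ)) (δ ⟨t, ht⟩)
      (Icc 0 1) t := by
  have hc : Continuous (Set.IccExtend zero_le_one (δ : I → F)) := δ.continuous.Icc_extend'
  have h := intervalIntegral.integral_hasDerivAt_right (hc.intervalIntegrable 0 t)
    hc.stronglyMeasurable.stronglyMeasurableAtFilter hc.continuousAt
  rw [Set.IccExtend_of_mem zero_le_one _ ht] at h
  refine h.hasDerivWithinAt.congr_of_mem ?_ ht
  intro s hs
  rw [Set.IccExtend_of_mem zero_le_one _ hs, ContinuousMap.primitive_apply]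

/-- Constant maps, as a continuous linear map into the space of continuous curves. -/
noncomputable def ContinuousMap.constCLM (F : Type) [NormedAddCommGroup F] [NormedSpace ℝ F] :
    F →L[ℝ] C(I, F) :=
  LinearMap.mkContinuous
    { toFun := fun y => ContinuousMap.const I y
      map_add' := by intros; rfl
      map_smul' := by intros; rfl } 1 (by
    intro y
    rw [one_mul, ContinuousMap.norm_le _ (norm_nonneg _)]
    intro t
    exact le_rfl)

@[simp] theorem ContinuousMap.constCLM_apply {F : Type} [NormedAddCommGroup F] [NormedSpace ℝ F]
    (y : F) (t : I) : ContinuousMap.constCLM F y t = y := rfl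

section CommutingFlow

variable {E N : Type} [NormedAddCommGroup E] [NormedSpace ℝ E]
  [NormedAddCommGroup N] [NormedSpace ℝ N]

/-- The curves `(γ, x)` in `E × N` with constant second component. -/
noncomputable def ContinuousMap.pairCLM (E N : Type) [NormedAddCommGroup E] [NormedSpace ℝ E]
    [NormedAddCommGroup N] [NormedSpace ℝ N] :
    (N × E) × C(I, E) →L[ℝ] C(I, E × N) :=
  (ContinuousLinearMap.compLeftContinuous ℝ I (ContinuousLinearMap.inl ℝ E N)) ∘L
      ContinuousLinearMap.snd ℝ (N × E) C(I, E) +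
    (ContinuousMap.constCLM (E × N)) ∘L (ContinuousLinearMap.inr ℝ E N) ∘L
      (ContinuousLinearMap.fst ℝ N E) ∘L (ContinuousLinearMap.fst ℝ (N × E) C(I, E))

theorem ContinuousMap.pairCLM_apply (u : (N × E) × C(I, E)) (t : I) :
    ContinuousMap.pairCLM E N u t = (u.2 t, u.1.1) := by
  simp [ContinuousMap.pairCLM]

/-- Uniqueness for the variation of a flow: `h` solves the linearised equation, and so does
`t ↦ t f(γ t) ξ`. -/
theorem variation_eq [CompleteSpace E] {f : E → N →L[ℝ] E} (hf : ContDiff ℝ ∞ f) {γ h δγ δh : C(I, E)}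
    {x ξ : N} {y : E}
    (hγ : γ = ContinuousMap.constCLM E y + ContinuousMap.primitive E δγ)
    (hδγ : ∀ t, δγ t = f (γ t) x)
    (hh : h = ContinuousMap.primitive E δh)
    (hδh : ∀ t, δh t = fderiv ℝ f (γ t) (h t) x + f (γ t) ξ)
    (hcomm : ∀ t, fderiv ℝ f (γ t) (f (γ t) x) ξ = fderiv ℝ f (γ t) (f (γ t) ξ) x) :
    h 1 = f (γ 1) ξ := by
  have hfd : ContDiff ℝ ∞ (fderiv ℝ f) := hf.fderiv_right (by simp)
  set g := Set.IccExtend zero_le_one (γ : I → E) with hg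
  set k := Set.IccExtend zero_le_one (h : I → E) with hk
  have hgI : ∀ t (ht : t ∈ Icc (0 : ℝ) 1), g t = γ ⟨t, ht⟩ := fun t ht =>
    Set.IccExtend_of_mem zero_le_one _ ht
  have hkI : ∀ t (ht : t ∈ Icc (0 : ℝ) 1), k t = h ⟨t, ht⟩ := fun t ht =>
    Set.IccExtend_of_mem zero_le_one _ ht
  have hgc : Continuous g := γ.continuous.Icc_extend'
  have hkc : Continuous k := h.continuous.Icc_extend'
  have hgd : ∀ t ∈ Icc (0 : ℝ) 1, HasDerivWithinAt g (f (g t) x) (Icc 0 1) t := by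
    intro t ht
    have h1 := (ContinuousMap.hasDerivWithinAt_primitive δγ t ht).const_add y
    rw [hδγ, ← hgI t ht] at h1
    refine h1.congr_of_mem (fun s hs => ?_) ht
    rw [hgI s hs, Set.IccExtend_of_mem zero_le_one _ hs]
    conv_lhs => rw [hγ]
    simp
  have hkd : ∀ t ∈ Icc (0 : ℝ) 1,
      HasDerivWithinAt k (fderiv ℝ f (g t) (k t) x + f (g t) ξ) (Icc 0 1) t := by
    intro t ht
    have h1 := ContinuousMap.hasDerivWithinAt_primitive δh t ht
    rw [hδh, ← hgI t ht, ← hkI t ht] at h1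
    refine h1.congr_of_mem (fun s hs => ?_) ht
    rw [hkI s hs, Set.IccExtend_of_mem zero_le_one _ hs, ← hh]
  -- Commutation makes `t ↦ t • f (g t) ξ` a solution of the same inhomogeneous equation as `k`, so
  -- the difference solves a homogeneous linear equation with `w 0 = 0` and vanishes by a Grönwall
  -- estimate.
  let w : ℝ → E := fun t => k t - t • f (g t) ξ
  have hwd : ∀ t ∈ Icc (0 : ℝ) 1,
      HasDerivWithinAt w (fderiv ℝ f (g t) (w t) x) (Icc 0 1) t := by
    intro t ht
    have h1 : HasDerivWithinAt (fun s => f (g s)) (fderiv ℝ f (g t) (f (g t) x)) (Icc 0 1) t :=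
      ((hf.differentiable (by simp)) (g t)).hasFDerivAt.comp_hasDerivWithinAt t (hgd t ht)
    have h2 : HasDerivWithinAt (fun s => f (g s) ξ) (fderiv ℝ f (g t) (f (g t) x) ξ)
        (Icc 0 1) t :=
      ((ContinuousLinearMap.apply ℝ E ξ).hasFDerivAt).comp_hasDerivWithinAt t h1
    have h3 := (hkd t ht).sub ((hasDerivWithinAt_id t (Icc (0 : ℝ) 1)).smul h2)
    refine h3.congr_deriv ?_
    have := hcomm ⟨t, ht⟩
    rw [← hgI t ht] at this
    simp only [w, id, map_sub, map_smul, sub_apply,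
      smul_apply, this, one_smul]
    abel
  have hwc : Continuous w := by
    have := hf.continuous
    fun_prop
  obtain ⟨K, hK⟩ := isCompact_Icc.exists_bound_of_continuousOn (s := Icc (0 : ℝ) 1)
    (f := fun t => (ContinuousLinearMap.apply ℝ E x) ∘L fderiv ℝ f (g t)) (by
      have := hfd.continuous
      fun_prop)
  have hw0 : w 0 = 0 := by
    have : k 0 = 0 := by
      rw [hkI 0 (by simp), hh, ContinuousMap.primitive_apply]
      simp
    simp [w, this]
  have hzero := eq_zero_of_abs_deriv_le_mul_abs_self_of_eq_zero_right (f := w)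
    (f' := fun t => fderiv ℝ f (g t) (w t) x) (K := K) (a := 0) (b := 1) hwc.continuousOn
    (fun t ht => (hwd t (Ico_subset_Icc_self ht)).mono_of_mem_nhdsWithin
      (Icc_mem_nhdsGE_of_mem ht)) hw0 (fun t ht => by
      have := ((ContinuousLinearMap.apply ℝ E x) ∘L fderiv ℝ f (g t)).le_of_opNorm_le
        (hK t (Ico_subset_Icc_self ht)) (w t)
      simpa using this) 1 (by simp)
  have h1 : w 1 = h 1 - f (γ 1) ξ := by
    simp only [w, one_smul, hgI 1 (by simp), hkI 1 (by simp)]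
    rfl
  rw [h1] at hzero
  exact sub_eq_zero.1 hzero

/-- Joint flow of a family of commuting vector fields `q ↦ f q x` that depends linearly on `x`. -/
theorem exists_commuting_flow_of_contDiff [CompleteSpace E] [CompleteSpace N]
    {f : E → N →L[ℝ] E} (hf : ContDiff ℝ ∞ f) {e₀ : E}
    (hcomm : ∀ᶠ q in 𝓝 e₀, ∀ x ξ, fderiv ℝ f q (f q x) ξ = fderiv ℝ f q (f q ξ) x) :
    ∃ α : N × E → E, α (0, e₀) = e₀ ∧ (∀ᶠ y in 𝓝 e₀, α (0, y) = y) ∧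
      ∀ᶠ p in 𝓝 ((0 : N), e₀), ContDiffAt ℝ ∞ α p ∧
        ∀ ξ, fderiv ℝ α p (ξ, 0) = f (α p) ξ := by
  let G : C(E × N, E) := ⟨fun u => f u.1 u.2, by
    have := hf.continuous
    fun_prop⟩
  have hG : ContDiff ℝ ∞ G :=
    (hf.comp contDiff_fst).clm_apply contDiff_snd
  let Λ := ContinuousMap.pairCLM E N
  let A : (N × E) × C(I, E) →L[ℝ] C(I, E) := (ContinuousMap.constCLM E) ∘L
    (ContinuousLinearMap.snd ℝ N E) ∘L (ContinuousLinearMap.fst ℝ (N × E) C(I, E))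
  -- Fixed points of `T ((x, y), ·)` are the solutions on `[0, 1]` of `γ' = f(γ) x` with `γ 0 = y`.
  -- Small `x` plays the role of short time, so the interval can stay fixed.
  let T : (N × E) × C(I, E) → C(I, E) := fun u =>
    A u + ContinuousMap.primitive E (G.comp (Λ u))
  have hT : ContDiff ℝ ∞ T :=
    A.contDiff.add ((ContinuousMap.primitive E).contDiff.comp
      ((ContinuousMap.contDiff_comp G hG).comp Λ.contDiff))
  let G' : C(E × N, E × N →L[ℝ] E) := ⟨fderiv ℝ G, (hG.continuous_fderiv (by simp))⟩
  have hG' : ∀ u, HasFDerivAt G (G' u) u := fun u =>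
    ((hG.differentiable (by simp)) u).hasFDerivAt
  have hG'v : ∀ q x v ξ, G' (q, x) (v, ξ) = fderiv ℝ f q v x + f q ξ := by
    intro q x v ξ
    have h1 : HasFDerivAt (fun u : E × N => f u.1 u.2) _ (q, x) :=
      ((((hf.differentiable (by simp)) q).hasFDerivAt (x := q)).comp (q, x)
        (hasFDerivAt_fst (p := (q, x)))).clm_apply (hasFDerivAt_snd (p := (q, x)))
    have h2 := (hG' (q, x)).unique h1
    rw [h2]
    simp [add_comm]
  have hTd : ∀ u v, fderiv ℝ T u v = A v + ContinuousMap.primitive E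
      (ContinuousMap.pointwiseApply I (E × N) E (G'.comp (Λ u)) (Λ v)) := by
    intro u v
    have h1 : HasFDerivAt T _ u := A.hasFDerivAt.add
      ((ContinuousMap.primitive E).hasFDerivAt.comp u
        ((ContinuousMap.hasFDerivAt_comp (K := I) G G' hG' (Λ u)).comp u Λ.hasFDerivAt))
    rw [h1.fderiv]
    rfl
  have hΛ : ∀ (u : (N × E) × C(I, E)) t, Λ u t = (u.2 t, u.1.1) := ContinuousMap.pairCLM_apply
  have hprim0 : ContinuousMap.primitive E 0 = 0 := map_zero _
  -- At `x = 0` the vector field is zero, so the constant curve is a fixed point and `T` does not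
  -- depend on the curve to first order.
  obtain ⟨Γ, hΓ0, hΓ⟩ := exists_smooth_fixedPoint hT (p₀ := ((0 : N), e₀))
    (c₀ := ContinuousMap.constCLM E e₀) (by
      have : G.comp (Λ (((0 : N), e₀), ContinuousMap.constCLM E e₀)) = 0 := by
        ext t
        simp [G, hΛ]
      simp only [T, this, hprim0, add_zero]
      rfl) (by
      intro c
      rw [hTd]
      have : ContinuousMap.pointwiseApply I (E × N) E
          (G'.comp (Λ (((0 : N), e₀), ContinuousMap.constCLM E e₀))) (Λ (0, c)) = 0 := by
        ext t
        simp [hΛ, hG'v]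
      rw [this, hprim0, add_zero]
      simp [A])
  have hΓT : ∀ᶠ p in 𝓝 ((0 : N), e₀), ∀ t : I, Γ p t = p.2 + ContinuousMap.primitive E
      (G.comp (Λ (p, Γ p))) t := by
    filter_upwards [hΓ] with p hp t
    conv_lhs => rw [← hp.2]
    rfl
  refine ⟨fun p => Γ p 1, by simp [hΓ0], ?_, ?_⟩
  · have hc : Tendsto (fun y : E => ((0 : N), y)) (𝓝 e₀) (𝓝 (0, e₀)) :=
      (continuous_const.prodMk continuous_id).tendsto' _ _ rfl
    filter_upwards [hc.eventually hΓT] with y hy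
    rw [hy 1]
    have : G.comp (Λ ((0, y), Γ (0, y))) = 0 := by
      ext t
      simp [G, hΛ]
    rw [this, hprim0]
    simp
  · have hcont : ∀ᶠ p in 𝓝 ((0 : N), e₀), ∀ t : I, ∀ x ξ,
        fderiv ℝ f (Γ p t) (f (Γ p t) x) ξ = fderiv ℝ f (Γ p t) (f (Γ p t) ξ) x := by
      obtain ⟨ε, hε, hb⟩ := Metric.eventually_nhds_iff.1 hcomm
      have h1 : ContinuousAt Γ (0, e₀) := hΓ.self_of_nhds.1.continuousAt
      rw [Metric.continuousAt_iff'] at h1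
      filter_upwards [h1 ε hε] with p hp t
      apply hb
      rw [hΓ0] at hp
      exact (ContinuousMap.dist_apply_le_dist (f := Γ p) (g := ContinuousMap.constCLM E e₀) t).trans_lt hp
    filter_upwards [hΓ.eventually_nhds, hcont] with p hp hc
    have hps := hp.self_of_nhds.1
    have hdΓ : HasFDerivAt Γ (fderiv ℝ Γ p) p := (hps.differentiableAt (by simp)).hasFDerivAt
    have hev : ContDiffAt ℝ ∞ (fun p => Γ p 1) p :=
      (ContinuousMap.evalCLM ℝ (1 : I) : C(I, E) →L[ℝ] E).contDiff.contDiffAt.comp p hps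
    refine ⟨hev, fun ξ => ?_⟩
    have hdα : HasFDerivAt (fun p => Γ p 1)
        ((ContinuousMap.evalCLM ℝ (1 : I) : C(I, E) →L[ℝ] E) ∘L fderiv ℝ Γ p) p :=
      (ContinuousMap.evalCLM ℝ (1 : I) : C(I, E) →L[ℝ] E).hasFDerivAt.comp p hdΓ
    rw [hdα.fderiv]
    have hTcomp : HasFDerivAt (fun p => T (p, Γ p))
        (fderiv ℝ T (p, Γ p) ∘L (ContinuousLinearMap.id ℝ (N × E)).prod (fderiv ℝ Γ p)) p :=
      ((hT.differentiable (by simp)) (p, Γ p)).hasFDerivAt.comp p ((hasFDerivAt_id p).prodMk hdΓ)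
    have heq : (fun p => T (p, Γ p)) =ᶠ[𝓝 p] Γ := hp.mono fun p' h => h.2
    -- Differentiating the fixed point equation in the direction `(ξ, 0)` gives the integral form of
    -- the linearised equation, which is what `variation_eq` requires.
    have huniq := (hTcomp.congr_of_eventuallyEq heq.symm).unique hdΓ
    have hfix := congrArg (fun L => L (ξ, 0)) huniq
    simp only [ContinuousLinearMap.comp_apply, ContinuousLinearMap.prod_apply,
      ContinuousLinearMap.id_apply, hTd] at hfix
    refine variation_eq (x := p.1) (y := p.2) hf (γ := Γ p) (h := fderiv ℝ Γ p (ξ, 0))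
      (δγ := G.comp (Λ (p, Γ p))) (hp.self_of_nhds.2.symm) (fun t => ?_)
      (hfix.symm.trans (?_ : _ = ContinuousMap.primitive E
        (ContinuousMap.pointwiseApply I (E × N) E (G'.comp (Λ (p, Γ p)))
          (Λ ((ξ, 0), fderiv ℝ Γ p (ξ, 0)))))) (fun t => ?_) (fun t => hc t _ _)
    · simp [G, hΛ]
    · simp [A]
    · simp [hΛ, hG'v]

/-- Local version of `exists_commuting_flow_of_contDiff`. -/
theorem exists_commuting_flow [FiniteDimensional ℝ E] [CompleteSpace N]
    {f : E → N →L[ℝ] E} {e₀ : E} (hf : ∀ᶠ q in 𝓝 e₀, ContDiffAt ℝ ∞ f q)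
    (hcomm : ∀ᶠ q in 𝓝 e₀, ∀ x ξ, fderiv ℝ f q (f q x) ξ = fderiv ℝ f q (f q ξ) x) :
    ∃ α : N × E → E, α (0, e₀) = e₀ ∧ (∀ᶠ y in 𝓝 e₀, α (0, y) = y) ∧
      ∀ᶠ p in 𝓝 ((0 : N), e₀), ContDiffAt ℝ ∞ α p ∧
        ∀ ξ, fderiv ℝ α p (ξ, 0) = f (α p) ξ := by
  have : CompleteSpace E := FiniteDimensional.complete ℝ E
  obtain ⟨r, hr, hball⟩ := Metric.nhds_basis_closedBall.eventually_iff.1 hf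
  -- A cutoff makes the family globally smooth. The cut-off fields commute only near `e₀`, where the
  -- cutoff is 1, and that is all that is needed.
  let χ : ContDiffBump e₀ := ⟨r / 2, r, by positivity, by linarith⟩
  let g : E → N →L[ℝ] E := fun q => χ q • f q
  have hg : ContDiff ℝ ∞ g := by
    rw [contDiff_iff_contDiffAt]
    intro q
    by_cases hq : q ∈ Metric.closedBall e₀ r
    · exact χ.contDiffAt.smul (hball hq)
    · have hopen : (Metric.closedBall e₀ r)ᶜ ∈ 𝓝 q :=
        Metric.isClosed_closedBall.isOpen_compl.mem_nhds hq
      refine (contDiffAt_const (c := (0 : N →L[ℝ] E))).congr_of_eventuallyEq ?_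
      filter_upwards [hopen] with q' hq'
      have : χ q' = 0 := χ.zero_of_le_dist (by
        rw [mem_compl_iff, Metric.mem_closedBall, not_le] at hq'
        exact hq'.le)
      simp [g, this]
  have hgf : g =ᶠ[𝓝 e₀] f := by
    filter_upwards [χ.eventuallyEq_one] with q hq
    simp [g, hq]
  obtain ⟨α, h1, h2, h3⟩ := exists_commuting_flow_of_contDiff hg (e₀ := e₀) (by
    filter_upwards [hcomm, hgf.eventuallyEq_nhds] with q hq hq'
    rw [hq'.fderiv_eq, hq'.eq_of_nhds]
    exact hq)
  refine ⟨α, h1, h2, ?_⟩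
  have hα : Tendsto α (𝓝 (0, e₀)) (𝓝 e₀) := by
    have := h3.self_of_nhds.1.continuousAt
    rwa [ContinuousAt, h1] at this
  filter_upwards [h3, hα.eventually hgf] with p hp hp'
  exact ⟨hp.1, fun ξ => by rw [hp.2, hp']⟩

end CommutingFlow

end

section
-- Inverse functions and the Frobenius theorem
open Filter Set

section

/-- Smooth inverse function theorem, with smoothness of the inverse on its whole domain. -/
theorem exists_smooth_localInverse {E E' : Type*} [NormedAddCommGroup E] [NormedSpace ℝ E]
    [CompleteSpace E] [NormedAddCommGroup E'] [NormedSpace ℝ E'] {Θ : E → E'} {a : E}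
    {O : Set E} (hO : O ∈ 𝓝 a) (hΘ : ∀ᶠ v in 𝓝 a, ContDiffAt ℝ ∞ Θ v)
    (hinv : (fderiv ℝ Θ a).IsInvertible) :
    ∃ φ : OpenPartialHomeomorph E E', (φ : E → E') = Θ ∧ a ∈ φ.source ∧ φ.source ⊆ O ∧
      (∀ v ∈ φ.source, ContDiffAt ℝ ∞ Θ v) ∧ (∀ w ∈ φ.target, ContDiffAt ℝ ∞ φ.symm w) := by
  obtain ⟨e, he⟩ := hinv
  have hd : HasFDerivAt Θ (e : E →L[ℝ] E') a := by
    rw [he]; exact (hΘ.self_of_nhds.differentiableAt (by simp)).hasFDerivAt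
  have hcd : ContinuousAt (fderiv ℝ Θ) a :=
    (hΘ.self_of_nhds.fderiv_right (m := 0) (by simp)).continuousAt
  have hev : ∀ᶠ v in 𝓝 a, (fderiv ℝ Θ v).IsInvertible := by
    have : range ((↑) : (E ≃L[ℝ] E') → E →L[ℝ] E') ∈ 𝓝 (fderiv ℝ Θ a) := by
      rw [← he]; exact ContinuousLinearEquiv.nhds e
    exact hcd.eventually this
  have hall : ∀ᶠ v in 𝓝 a, v ∈ O ∧ ContDiffAt ℝ ∞ Θ v ∧ (fderiv ℝ Θ v).IsInvertible := by
    filter_upwards [hO, hΘ, hev] with v h1 h2 h3 using ⟨h1, h2, h3⟩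
  obtain ⟨s, hs, hso, has⟩ := eventually_nhds_iff.1 hall
  let φ₀ := (hΘ.self_of_nhds).toOpenPartialHomeomorph Θ hd (by simp)
  have hφ₀ : (φ₀ : E → E') = Θ := rfl
  -- On `s` the map is smooth with invertible derivative at each point, which makes the inverse
  -- smooth on its whole domain.
  let φ := φ₀.restrOpen s hso
  have hsrc : φ.source = φ₀.source ∩ s := φ₀.restrOpen_source s hso
  have hφ : (φ : E → E') = Θ := rfl
  refine ⟨φ, hφ, ?_, ?_, ?_, ?_⟩
  · rw [hsrc]
    exact ⟨(hΘ.self_of_nhds).mem_toOpenPartialHomeomorph_source hd (by simp), has⟩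
  · rw [hsrc]; exact fun v hv => (hs v hv.2).1
  · rw [hsrc]; exact fun v hv => (hs v hv.2).2.1
  · intro w hw
    have hmem : φ.symm w ∈ s := by
      have := φ.map_target hw
      rw [hsrc] at this
      exact this.2
    obtain ⟨_, h1, e', he'⟩ := hs _ hmem
    refine φ.contDiffAt_symm (f₀' := e') hw ?_ h1
    rw [he']
    exact (h1.differentiableAt (by simp)).hasFDerivAt

section Frobenius

variable {E F : Type} [NormedAddCommGroup E] [NormedSpace ℝ E]
  [NormedAddCommGroup F] [NormedSpace ℝ F] [FiniteDimensional ℝ F]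

/-- A smooth family of linear maps that is surjective at a point has a smooth family of right
inverses near this point, all of them with the same image. -/
theorem exists_smooth_rightInverse {η : E → E →L[ℝ] F} {m : E}
    (hη : ∀ᶠ q in 𝓝 m, ContDiffAt ℝ ∞ η q) (hsurj : Function.Surjective (η m)) :
    ∃ (R : F →L[ℝ] E) (B : E → F →L[ℝ] F), (∀ v, η m (R v) = v) ∧
      ∀ᶠ q in 𝓝 m, ContDiffAt ℝ ∞ B q ∧ (∀ v, η q (R (B q v)) = v) ∧
        ∀ v, B q (η q (R v)) = v := by
  have : CompleteSpace F := FiniteDimensional.complete ℝ F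
  obtain ⟨R₀, hR₀⟩ := (η m).toLinearMap.exists_rightInverse_of_surjective
    (LinearMap.range_eq_top.2 hsurj)
  let R : F →L[ℝ] E := LinearMap.toContinuousLinearMap R₀
  have hR : ∀ v, η m (R v) = v := fun v => LinearMap.congr_fun hR₀ v
  have hc : ContinuousAt (fun q => η q ∘L R) m :=
    hη.self_of_nhds.continuousAt.clm_comp continuousAt_const
  have h1 : η m ∘L R = ContinuousLinearEquiv.refl ℝ F := by
    ext v; simp [hR]
  have hev : ∀ᶠ q in 𝓝 m, (η q ∘L R).IsInvertible := by
    have : range ((↑) : (F ≃L[ℝ] F) → F →L[ℝ] F) ∈ 𝓝 (η m ∘L R) := by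
      rw [h1]; exact ContinuousLinearEquiv.nhds _
    exact hc.eventually this
  refine ⟨R, fun q => (η q ∘L R).inverse, hR, ?_⟩
  filter_upwards [hη, hev] with q hq1 hq2
  refine ⟨?_, fun v => ?_, fun v => ?_⟩
  · exact hq2.contDiffAt_map_inverse.comp q (hq1.clm_comp contDiffAt_const)
  · exact congrArg (fun L => L v) hq2.self_comp_inverse
  · exact congrArg (fun L => L v) hq2.inverse_comp_self

/-- Projections onto the kernels of a smooth family of linear maps. -/
theorem exists_smooth_kernelProjection {η : E → E →L[ℝ] F} {m : E}
    (hη : ∀ᶠ q in 𝓝 m, ContDiffAt ℝ ∞ η q) (hsurj : Function.Surjective (η m)) :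
    ∃ P : E → E →L[ℝ] E, ∀ᶠ q in 𝓝 m, ContDiffAt ℝ ∞ P q ∧ (∀ v, η q (P q v) = 0) ∧
      ∀ v, η q v = 0 → P q v = v := by
  obtain ⟨R, B, -, h⟩ := exists_smooth_rightInverse hη hsurj
  refine ⟨fun q => ContinuousLinearMap.id ℝ E - R ∘L B q ∘L η q, ?_⟩
  filter_upwards [hη, h] with q hq ⟨h1, h2, h3⟩
  refine ⟨contDiffAt_const.sub (contDiffAt_const.clm_comp (h1.clm_comp hq)), fun v => ?_,
    fun v hv => ?_⟩
  · simp [h2]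
  · simp [hv]

variable [FiniteDimensional ℝ E]

/-- Frobenius theorem for a Pfaffian system, given by a form `η` with values in a vector space: if
`dη` vanishes on the kernel of `η`, then `η` is equivalent to an exact form. -/
theorem exists_firstIntegrals {η : E → E →L[ℝ] F} {m : E}
    (hη : ∀ᶠ q in 𝓝 m, ContDiffAt ℝ ∞ η q) (hsurj : Function.Surjective (η m))
    (hinvol : ∀ᶠ q in 𝓝 m, ∀ u v, η q u = 0 → η q v = 0 →
      fderiv ℝ η q u v = fderiv ℝ η q v u) :
    ∃ g : E → F, ∀ᶠ q in 𝓝 m, ContDiffAt ℝ ∞ g q ∧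
      ∃ A : F →L[ℝ] F, Function.Bijective A ∧ fderiv ℝ g q = A ∘L η q := by
  have : CompleteSpace E := FiniteDimensional.complete ℝ E
  obtain ⟨R, B, hR, hB⟩ := exists_smooth_rightInverse hη hsurj
  -- The fields `q ↦ P q x` span `ker (η q)` and differ from the constant fields `x` by vectors in
  -- the fixed space `range R`. This normalisation makes them commute.
  let P : E → E →L[ℝ] E := fun q => ContinuousLinearMap.id ℝ E - R ∘L B q ∘L η q
  have hPv : ∀ q v, P q v = v - R (B q (η q v)) := fun q v => rfl
  have hPs : ∀ᶠ q in 𝓝 m, ContDiffAt ℝ ∞ P q := by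
    filter_upwards [hη, hB] with q hq h
    exact contDiffAt_const.sub (contDiffAt_const.clm_comp (h.1.clm_comp hq))
  have hηP : ∀ᶠ q in 𝓝 m, ∀ v, η q (P q v) = 0 := by
    filter_upwards [hB] with q hq v
    rw [hPv, map_sub, hq.2.1, sub_self]
  have hPR : ∀ᶠ q in 𝓝 m, ∀ v, P q (R v) = 0 := by
    filter_upwards [hB] with q hq v
    rw [hPv, hq.2.2, sub_self]
  have hBm : ∀ v, B m v = v := fun v => by
    have := hB.self_of_nhds.2.2 v
    rwa [hR] at this
  -- The two derivatives to be compared lie in `range R` by `e2`. By `e1`, which differentiates `η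
  -- (P ξ) = 0`, and by involutivity, they have the same image under `η q`. Since `η q` is injective
  -- on `range R`, they agree.
  have hcomm : ∀ᶠ q in 𝓝 m, ∀ x ξ, fderiv ℝ P q (P q x) ξ = fderiv ℝ P q (P q ξ) x := by
    filter_upwards [hη, hB, hPs, hηP.eventually_nhds, hinvol] with q h1 h2 h3 h4 h5 x ξ
    have hηd := (h1.differentiableAt (by simp)).hasFDerivAt
    have hPd := (h3.differentiableAt (by simp)).hasFDerivAt
    have hBd := (h2.1.differentiableAt (by simp)).hasFDerivAt
    have e1 : ∀ u ξ, η q (fderiv ℝ P q u ξ) = - fderiv ℝ η q u (P q ξ) := by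
      intro u ξ
      have hPξ := hPd.clm_apply (hasFDerivAt_const ξ q)
      have h6 := hηd.clm_apply hPξ
      have h7 : HasFDerivAt (fun q => η q (P q ξ)) (0 : E →L[ℝ] F) q := by
        refine (hasFDerivAt_const (0 : F) q).congr_of_eventuallyEq ?_
        filter_upwards [h4] with q' hq' using hq' ξ
      have h8 := congrArg (fun L => L u) (h6.unique h7)
      simp only [ContinuousLinearMap.comp_zero, zero_add, add_apply,
        ContinuousLinearMap.comp_apply, ContinuousLinearMap.flip_apply, zero_apply] at h8
      exact eq_neg_of_add_eq_zero_left h8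
    have e2 : ∀ u ξ, ∃ r, fderiv ℝ P q u ξ = R r := by
      intro u ξ
      have hPξ := hPd.clm_apply (hasFDerivAt_const ξ q)
      have hb := (hBd.clm_apply (hηd.clm_apply (hasFDerivAt_const ξ q)))
      have h6 : HasFDerivAt (fun q => P q ξ) _ q :=
        (hasFDerivAt_const ξ q).sub (R.hasFDerivAt.comp q hb)
      have h7 := congrArg (fun L => L u) (hPξ.unique h6)
      simp only [ContinuousLinearMap.comp_zero, zero_add, ContinuousLinearMap.flip_apply,
        zero_sub] at h7
      exact ⟨_, h7.trans (map_neg R _).symm⟩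
    obtain ⟨r, hr⟩ := e2 (P q x) ξ
    obtain ⟨r', hr'⟩ := e2 (P q ξ) x
    have h6 : η q (R r) = η q (R r') := by
      rw [← hr, ← hr', e1, e1, h5 _ _ (h4.self_of_nhds x) (h4.self_of_nhds ξ)]
    have h7 : r = r' := by rw [← h2.2.2 r, h6, h2.2.2]
    rw [hr, hr', h7]
  obtain ⟨α, hα0, hα1, hα2⟩ := exists_commuting_flow hPs hcomm
  let ι : E →L[ℝ] E × E := (ContinuousLinearMap.id ℝ E).prod (R ∘L η m)
  have hι : ∀ v, ι v = (v, R (η m v)) := fun v => rfl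
  -- Start on the transversal `m + range R` at `m + R (η m v)` and flow with parameter `v`. At `0`
  -- the flow contributes `P m v` and the transversal contributes `R (η m v)`, so the derivative is
  -- the identity. The level sets of `η m` are carried to integral manifolds.
  let Θ : E → E := fun v => α ((0, m) + ι v)
  have hι0 : Tendsto (fun v : E => ((0 : E), m) + ι v) (𝓝 0) (𝓝 (0, m)) := by
    have : Continuous (fun v : E => ((0 : E), m) + ι v) := by fun_prop
    exact this.tendsto' _ _ (by simp)
  have hΘd : ∀ᶠ v in 𝓝 (0 : E), ContDiffAt ℝ ∞ Θ v ∧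
      fderiv ℝ Θ v = fderiv ℝ α ((0, m) + ι v) ∘L ι ∧
      ∀ ξ, fderiv ℝ α ((0, m) + ι v) (ξ, 0) = P (Θ v) ξ := by
    filter_upwards [hι0.eventually hα2] with v hv
    refine ⟨ContDiffAt.comp v hv.1 (contDiffAt_const.add ι.contDiff.contDiffAt), ?_, hv.2⟩
    exact ((hv.1.differentiableAt (by simp)).hasFDerivAt.comp v
      (ι.hasFDerivAt.const_add (0, m))).fderiv
  have hΘ0 : Θ 0 = m := by simp [Θ, hα0]
  have hD0 : fderiv ℝ Θ 0 = ContinuousLinearMap.id ℝ E := by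
    obtain ⟨h1, h2, h3⟩ := hΘd.self_of_nhds
    ext v
    rw [h2]
    rw [hΘ0] at h3
    simp only [map_zero, add_zero] at h3 ⊢
    have hα2' : fderiv ℝ α (0, m) (0, R (η m v)) = R (η m v) := by
      have h4 : HasFDerivAt (fun y : E => α ((0 : E), y))
          (fderiv ℝ α (0, m) ∘L ContinuousLinearMap.inr ℝ E E) m :=
        (hα2.self_of_nhds.1.differentiableAt (by simp)).hasFDerivAt.comp m
          (hasFDerivAt_prodMk_right (0 : E) m)
      have h5 : HasFDerivAt (fun y : E => α ((0 : E), y)) (ContinuousLinearMap.id ℝ E) m :=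
        (hasFDerivAt_id m).congr_of_eventuallyEq hα1
      exact congrArg (fun L => L (R (η m v))) (h4.unique h5)
    have : ι v = (v, 0) + (0, R (η m v)) := by simp [hι]
    rw [ContinuousLinearMap.comp_apply, this, map_add, h3, hα2', hPv, hBm]
    simp
  obtain ⟨φ, hφ, h0φ, -, hφs, hφt⟩ := exists_smooth_localInverse (O := Set.univ) univ_mem
    (hΘd.mono fun v h => h.1) (by rw [hD0]; exact ⟨ContinuousLinearEquiv.refl ℝ E, rfl⟩)
  have hmt : m ∈ φ.target := by
    have := φ.map_source h0φ
    rwa [hφ, hΘ0] at this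
  have hsymm : Tendsto φ.symm (𝓝 m) (𝓝 0) := by
    have h1 := φ.continuousAt_symm hmt
    have h2 : φ.symm m = 0 := by
      have := φ.left_inv h0φ
      rwa [hφ, hΘ0] at this
    rwa [ContinuousAt, h2] at h1
  refine ⟨fun q => η m (φ.symm q), ?_⟩
  filter_upwards [φ.open_target.mem_nhds hmt, hsymm.eventually hΘd, hB, hηP, hPR]
    with q hq ⟨h1, h2, h3⟩ h4 h5 h6
  have hΘq : Θ (φ.symm q) = q := by
    have := φ.right_inv hq
    rwa [hφ] at this
  rw [hΘq] at h3
  have hsd := ((hφt q hq).differentiableAt (by simp)).hasFDerivAt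
  have hgd : fderiv ℝ (fun q => η m (φ.symm q)) q = η m ∘L fderiv ℝ φ.symm q :=
    ((η m).hasFDerivAt.comp q hsd).fderiv
  have hleft : ∀ v, fderiv ℝ φ.symm q (fderiv ℝ Θ (φ.symm q) v) = v := by
    intro v
    have h7 : HasFDerivAt (fun v => φ.symm (Θ v))
        (fderiv ℝ φ.symm q ∘L fderiv ℝ Θ (φ.symm q)) (φ.symm q) := by
      refine HasFDerivAt.comp (φ.symm q) ?_ (h1.differentiableAt (by simp)).hasFDerivAt
      rwa [hΘq]
    have h8 : HasFDerivAt (fun v => φ.symm (Θ v)) (ContinuousLinearMap.id ℝ E) (φ.symm q) := by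
      refine (hasFDerivAt_id _).congr_of_eventuallyEq ?_
      filter_upwards [φ.open_source.mem_nhds (φ.map_target hq)] with v hv
      rw [← hφ]
      exact φ.left_inv hv
    exact congrArg (fun L => L v) (h7.unique h8)
  -- For `u` in `ker (η q)`, the vector `P m u` lies in `ker (η m)`, so it moves only the flow
  -- parameter and is mapped to `P q (P m u)`. As `P q` kills `range R`, this equals `P q u = u`.
  -- Thus `u` is tangent to a level set of the first integrals.
  have hker : ∀ u, η q u = 0 → η m (fderiv ℝ φ.symm q u) = 0 := by
    intro u hu
    have h7 : fderiv ℝ Θ (φ.symm q) (P m u) = u := by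
      have h8 : ι (P m u) = (P m u, 0) := by
        rw [hι, hηP.self_of_nhds, map_zero]
      rw [h2, ContinuousLinearMap.comp_apply, h8, h3, hPv m, map_sub, h6, hPv, hu]
      simp
    rw [← h7, hleft, hηP.self_of_nhds]
  refine ⟨(η m).contDiff.contDiffAt.comp q (hφt q hq),
    η m ∘L fderiv ℝ φ.symm q ∘L R ∘L B q, ?_, ?_⟩
  · have hsur : Function.Surjective (η m ∘L fderiv ℝ φ.symm q ∘L R ∘L B q) := by
      intro y
      obtain ⟨x, rfl⟩ := hsurj y
      refine ⟨η q (fderiv ℝ Θ (φ.symm q) x), ?_⟩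
      have h7 := hker (P q (fderiv ℝ Θ (φ.symm q) x)) (h5 _)
      rw [hPv, map_sub, map_sub, hleft, sub_eq_zero] at h7
      exact h7.symm
    exact ⟨(LinearMap.injective_iff_surjective
      (f := (η m ∘L fderiv ℝ φ.symm q ∘L R ∘L B q).toLinearMap)).2 hsur, hsur⟩
  · rw [hgd]
    ext u
    have h7 := hker (P q u) (h5 _)
    rw [hPv, map_sub, map_sub, sub_eq_zero] at h7
    exact h7

end Frobenius

end

/-! ### Calculus of 1-forms and first integrals of Pfaffian systems -/

section

/-- A family of linear forms is independent only if it is jointly surjective. -/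
theorem LinearIndependent.pi_surjective {ι E : Type*} [Finite ι] [AddCommGroup E] [Module ℝ E]
    {α : ι → E →ₗ[ℝ] ℝ} (h : LinearIndependent ℝ α) : Function.Surjective (LinearMap.pi α) := by
  classical
  have := Fintype.ofFinite ι
  rw [← LinearMap.range_eq_top]
  by_contra hne
  obtain ⟨f, hf, hle⟩ := Submodule.exists_le_ker_of_lt_top _ (lt_top_iff_ne_top.2 hne)
  refine hf ?_
  have hsum : ∑ i, f (Pi.single i 1) • α i = 0 := by
    ext v
    have h1 : f (LinearMap.pi α v) = 0 := hle ⟨v, rfl⟩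
    rw [LinearMap.pi_apply_eq_sum_univ f] at h1
    rw [LinearMap.sum_apply, LinearMap.zero_apply]
    refine Eq.trans ?_ h1
    refine Finset.sum_congr rfl fun i _ => ?_
    have h2 : (Pi.single i 1 : ι → ℝ) = fun j => if i = j then 1 else 0 := by
      funext j
      simp [Pi.single_apply, eq_comm]
    rw [LinearMap.smul_apply, h2, LinearMap.pi_apply, smul_eq_mul, smul_eq_mul, mul_comm]
  have h2 := Fintype.linearIndependent_iff.1 h _ hsum
  ext i
  simpa using h2 i

section Forms

variable {E : Type} [NormedAddCommGroup E] [NormedSpace ℝ E]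

theorem two_le_smooth : minSmoothness ℝ 2 ≤ (∞ : WithTop ℕ∞) := by
  rw [minSmoothness_of_isRCLikeNormedField]
  change ((2 : ℕ∞) : WithTop ℕ∞) ≤ ((⊤ : ℕ∞) : WithTop ℕ∞)
  exact WithTop.coe_le_coe.2 le_top

/-- Exchanging the arguments of a bilinear form. -/
noncomputable def flipForm (E : Type) [NormedAddCommGroup E] [NormedSpace ℝ E] :
    (E →L[ℝ] E →L[ℝ] ℝ) →L[ℝ] (E →L[ℝ] E →L[ℝ] ℝ) :=
  (ContinuousLinearMap.flipₗᵢ ℝ E E ℝ).toContinuousLinearEquiv.toContinuousLinearMap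

theorem contDiff_flipForm : ContDiff ℝ ∞ fun B : E →L[ℝ] E →L[ℝ] ℝ => flipForm E B := by
  fun_prop

theorem hasFDerivAt_flipForm (B : E →L[ℝ] E →L[ℝ] ℝ) :
    HasFDerivAt (fun B : E →L[ℝ] E →L[ℝ] ℝ => flipForm E B) (flipForm E) B := by
  exact ContinuousLinearMap.hasFDerivAt _

/-- The exterior derivative of a 1-form, as a bilinear map. -/
noncomputable def dform (α : E → E →L[ℝ] ℝ) (q : E) : E →L[ℝ] E →L[ℝ] ℝ :=
  fderiv ℝ α q - flipForm E (fderiv ℝ α q)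

variable {α β : E → E →L[ℝ] ℝ} {q : E} {f c : E → ℝ} {X Y Z : E → E}

theorem dform_apply (u v : E) : dform α q u v = fderiv ℝ α q u v - fderiv ℝ α q v u := rfl

theorem dform_swap (u v : E) : dform α q u v = - dform α q v u := by
  rw [dform_apply, dform_apply, neg_sub]

@[simp] theorem dform_self (u : E) : dform α q u u = 0 := by
  rw [dform_apply, sub_self]

theorem ContDiffAt.dform (h : ContDiffAt ℝ ∞ α q) : ContDiffAt ℝ ∞ (dform α) q := by
  have h1 : ContDiffAt ℝ ∞ (fderiv ℝ α) q := h.fderiv_right (by simp)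
  exact h1.sub (contDiff_flipForm.contDiffAt.comp q h1)

theorem Filter.EventuallyEq.dform_eq (h : α =ᶠ[𝓝 q] β) : _root_.dform α q = _root_.dform β q := by
  rw [_root_.dform, _root_.dform, h.fderiv_eq]

theorem dform_add (hα : DifferentiableAt ℝ α q) (hβ : DifferentiableAt ℝ β q) :
    dform (fun q => α q + β q) q = dform α q + dform β q := by
  ext u v
  simp only [dform_apply, fderiv_fun_add hα hβ, add_apply]
  ring

theorem dform_sub (hα : DifferentiableAt ℝ α q) (hβ : DifferentiableAt ℝ β q) :
    dform (fun q => α q - β q) q = dform α q - dform β q := by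
  ext u v
  simp only [dform_apply, fderiv_fun_sub hα hβ, sub_apply]
  ring

theorem dform_smul (hc : DifferentiableAt ℝ c q) (hα : DifferentiableAt ℝ α q) (u v : E) :
    dform (fun q => c q • α q) q u v =
      fderiv ℝ c q u * α q v - fderiv ℝ c q v * α q u + c q * dform α q u v := by
  simp only [dform_apply, fderiv_fun_smul hc hα, add_apply, smul_apply,
    ContinuousLinearMap.smulRight_apply, smul_eq_mul]
  ring

theorem dform_fderiv (hf : ContDiffAt ℝ ∞ f q) : dform (fderiv ℝ f) q = 0 := by
  ext u v
  have := hf.isSymmSndFDerivAt two_le_smooth u v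
  rw [dform_apply, this, sub_self]
  rfl

theorem dform_apply_vectorField (hα : DifferentiableAt ℝ α q) (hY : DifferentiableAt ℝ Y q)
    (hZ : DifferentiableAt ℝ Z q) :
    dform α q (Y q) (Z q) = fderiv ℝ (fun q => α q (Z q)) q (Y q) -
      fderiv ℝ (fun q => α q (Y q)) q (Z q) - α q (VectorField.lieBracket ℝ Y Z q) := by
  rw [fderiv_clm_apply hα hZ, fderiv_clm_apply hα hY, VectorField.lieBracket_eq]
  simp only [dform_apply, add_apply, ContinuousLinearMap.comp_apply,
    ContinuousLinearMap.flip_apply, map_sub]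
  ring

/-- The derivative terms of Cartan's formula drop out. This is the passage between brackets of
sections of a distribution and `dform` of its annihilating forms. -/
theorem apply_lieBracket_eq_neg_dform (hα : DifferentiableAt ℝ α q) (hY : DifferentiableAt ℝ Y q)
    (hZ : DifferentiableAt ℝ Z q) (hαY : ∀ᶠ q in 𝓝 q, α q (Y q) = 0)
    (hαZ : ∀ᶠ q in 𝓝 q, α q (Z q) = 0) :
    α q (VectorField.lieBracket ℝ Y Z q) = - dform α q (Y q) (Z q) := by
  have h0 : ∀ {Y : E → E}, (∀ᶠ q in 𝓝 q, α q (Y q) = 0) →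
      fderiv ℝ (fun q => α q (Y q)) q = 0 := fun h => by
    rw [Filter.EventuallyEq.fderiv_eq (f₁ := fun q => α q (_ : E)) (f := fun _ => (0 : ℝ)) h]
    exact fderiv_const_apply _
  rw [dform_apply_vectorField hα hY hZ, h0 hαY, h0 hαZ]
  simp

/-- The identity `d(dα) = 0`, evaluated on three vector fields. -/
theorem dform_cyclic (hα : ContDiffAt ℝ ∞ α q) (hX : DifferentiableAt ℝ X q)
    (hY : DifferentiableAt ℝ Y q) (hZ : DifferentiableAt ℝ Z q) :
    fderiv ℝ (fun q => dform α q (Y q) (Z q)) q (X q) +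
      fderiv ℝ (fun q => dform α q (Z q) (X q)) q (Y q) +
      fderiv ℝ (fun q => dform α q (X q) (Y q)) q (Z q) =
    dform α q (VectorField.lieBracket ℝ X Y q) (Z q) +
      dform α q (VectorField.lieBracket ℝ Y Z q) (X q) +
      dform α q (VectorField.lieBracket ℝ Z X q) (Y q) := by
  have hd : DifferentiableAt ℝ (dform α) q := hα.dform.differentiableAt (by simp)
  have h1 : ContDiffAt ℝ ∞ (fderiv ℝ α) q := hα.fderiv_right (by simp)
  have h1d := h1.differentiableAt (by simp)
  have key : ∀ u v w, fderiv ℝ (dform α) q u v w =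
      fderiv ℝ (fderiv ℝ α) q u v w - fderiv ℝ (fderiv ℝ α) q u w v := by
    intro u v w
    have h2 : HasFDerivAt (dform α) _ q := h1d.hasFDerivAt.sub
      ((hasFDerivAt_flipForm _).comp q h1d.hasFDerivAt)
    rw [h2.fderiv]
    rfl
  have hsymm : ∀ u v, fderiv ℝ (fderiv ℝ α) q u v = fderiv ℝ (fderiv ℝ α) q v u :=
    fun u v => hα.isSymmSndFDerivAt two_le_smooth u v
  have hexp : ∀ {A B : E → E}, DifferentiableAt ℝ A q → DifferentiableAt ℝ B q → ∀ u,
      fderiv ℝ (fun q => dform α q (A q) (B q)) q u = fderiv ℝ (dform α) q u (A q) (B q) +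
        dform α q (fderiv ℝ A q u) (B q) + dform α q (A q) (fderiv ℝ B q u) := by
    intro A B hA hB u
    rw [fderiv_clm_apply (hd.clm_apply hA) hB, fderiv_clm_apply hd hA]
    simp only [add_apply, ContinuousLinearMap.comp_apply, ContinuousLinearMap.flip_apply]
    ring
  -- In the cyclic sum the second derivatives of `α` cancel by symmetry, and the derivatives of the
  -- fields pair up into brackets.
  rw [hexp hY hZ, hexp hZ hX, hexp hX hY]
  simp only [key, VectorField.lieBracket_eq, map_sub, sub_apply]
  rw [hsymm (Y q) (X q), hsymm (Z q) (X q), hsymm (Z q) (Y q),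
    dform_swap (Y q) (fderiv ℝ Z q (X q)), dform_swap (Z q) (fderiv ℝ X q (Y q)),
    dform_swap (X q) (fderiv ℝ Y q (Z q))]
  ring

/-- Contraction of `dα` with `X` in terms of the Lie derivative. -/
theorem dform_apply_eq_lieDeriv (hα : DifferentiableAt ℝ α q) (hX : DifferentiableAt ℝ X q)
    (hαX : ∀ᶠ q in 𝓝 q, α q (X q) = 0) (v : E) :
    fderiv ℝ α q (X q) v + α q (fderiv ℝ X q v) = dform α q (X q) v := by
  have h0 : fderiv ℝ (fun q => α q (X q)) q = 0 := by
    rw [Filter.EventuallyEq.fderiv_eq (f₁ := fun q => α q (X q)) (f := fun _ => (0 : ℝ)) hαX]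
    exact fderiv_const_apply _
  rw [fderiv_clm_apply hα hX] at h0
  have h1 := congrArg (fun L => L v) h0
  simp only [add_apply, ContinuousLinearMap.comp_apply, ContinuousLinearMap.flip_apply,
    zero_apply] at h1
  rw [dform_apply]
  linarith

variable {k : ℕ} {m : E}

theorem surjective_pi_of_linearIndependent {α : Fin k → E →L[ℝ] ℝ} (h : LinearIndependent ℝ α) :
    Function.Surjective (ContinuousLinearMap.pi α) := by
  have h1 : LinearIndependent ℝ fun i => (α i).toLinearMap :=
    h.map' (ContinuousLinearMap.coeLM ℝ : (E →L[ℝ] ℝ) →ₗ[ℝ] E →ₗ[ℝ] ℝ)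
      (LinearMap.ker_eq_bot.2 ContinuousLinearMap.coe_injective)
  exact h1.pi_surjective

theorem contDiffAt_clm_pi {α : Fin k → E → E →L[ℝ] ℝ} (h : ∀ i, ContDiffAt ℝ ∞ (α i) q) :
    ContDiffAt ℝ ∞ (fun q => ContinuousLinearMap.pi fun i => α i q) q := by
  have : (fun q => ContinuousLinearMap.pi fun i => α i q) = fun q => ∑ i,
      (ContinuousLinearMap.single ℝ (fun _ : Fin k => ℝ) i) ∘L α i q := by
    funext q
    ext v i
    simp [Finset.sum_apply, Pi.single_apply]
  rw [this]
  exact ContDiffAt.sum fun i _ => contDiffAt_const.clm_comp (h i)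

theorem eventually_linearIndependent {α : Fin k → E → E →L[ℝ] ℝ}
    (hα : ∀ i, ∀ᶠ q in 𝓝 m, ContDiffAt ℝ ∞ (α i) q)
    (hli : LinearIndependent ℝ fun i => α i m) :
    ∀ᶠ q in 𝓝 m, LinearIndependent ℝ fun i => α i q := by
  have h : ContinuousAt (fun q i => α i q) m :=
    continuousAt_pi.2 fun i => (hα i).self_of_nhds.continuousAt
  exact h.eventually (isOpen_setOfPred_linearIndependent.mem_nhds hli)

/-- Independent smooth 1-forms have a smooth dual frame. -/
theorem exists_smooth_dualFrame {α : Fin k → E → E →L[ℝ] ℝ}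
    (hα : ∀ i, ∀ᶠ q in 𝓝 m, ContDiffAt ℝ ∞ (α i) q)
    (hli : LinearIndependent ℝ fun i => α i m) :
    ∃ e : Fin k → E → E, ∀ᶠ q in 𝓝 m, (∀ j, ContDiffAt ℝ ∞ (e j) q) ∧
      ∀ i j, α i q (e j q) = if i = j then 1 else 0 := by
  obtain ⟨R, B, -, h⟩ := exists_smooth_rightInverse
    (η := fun q => ContinuousLinearMap.pi fun i => α i q) (m := m)
    ((eventually_all.2 hα).mono fun q hq => contDiffAt_clm_pi hq)
    (surjective_pi_of_linearIndependent hli)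
  refine ⟨fun j q => R (B q (Pi.single j 1)), ?_⟩
  filter_upwards [h] with q hq
  refine ⟨fun j => R.contDiff.contDiffAt.comp q (hq.1.clm_apply contDiffAt_const), fun i j => ?_⟩
  have := congrFun (hq.2.1 (Pi.single j 1)) i
  simpa [Pi.single_apply] using this

/-- A smooth 1-form that vanishes on the common kernel of independent smooth 1-forms is a
combination of them with smooth coefficients. -/
theorem exists_smooth_coeffs {α : Fin k → E → E →L[ℝ] ℝ} {β : E → E →L[ℝ] ℝ}
    (hα : ∀ i, ∀ᶠ q in 𝓝 m, ContDiffAt ℝ ∞ (α i) q)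
    (hli : LinearIndependent ℝ fun i => α i m) (hβ : ∀ᶠ q in 𝓝 m, ContDiffAt ℝ ∞ β q)
    (hker : ∀ᶠ q in 𝓝 m, ∀ v, (∀ i, α i q v = 0) → β q v = 0) :
    ∃ a : Fin k → E → ℝ, ∀ᶠ q in 𝓝 m, (∀ i, ContDiffAt ℝ ∞ (a i) q) ∧
      ∀ v, β q v = ∑ i, a i q * α i q v := by
  obtain ⟨e, he⟩ := exists_smooth_dualFrame hα hli
  refine ⟨fun i q => β q (e i q), ?_⟩
  filter_upwards [he, hβ, hker] with q h1 h2 h3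
  refine ⟨fun i => h2.clm_apply (h1.1 i), fun v => ?_⟩
  have h4 := h3 (v - ∑ i, α i q v • e i q) (fun i => by simp [h1.2])
  rw [map_sub, map_sum, sub_eq_zero] at h4
  rw [h4]
  exact Finset.sum_congr rfl fun i _ => by rw [map_smul, smul_eq_mul, mul_comm]

variable [FiniteDimensional ℝ E]

/-- An integrable Pfaffian system contains a closed form with a nonzero component along a given
member. -/
theorem exists_firstIntegral {α : Fin k → E → E →L[ℝ] ℝ}
    (hα : ∀ i, ∀ᶠ q in 𝓝 m, ContDiffAt ℝ ∞ (α i) q)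
    (hli : LinearIndependent ℝ fun i => α i m)
    (hinvol : ∀ᶠ q in 𝓝 m, ∀ u v, (∀ i, α i q u = 0) → (∀ i, α i q v = 0) →
      ∀ i, dform (α i) q u v = 0) (j : Fin k) :
    ∃ (f : E → ℝ) (a : Fin k → E → ℝ), ∀ᶠ q in 𝓝 m, ContDiffAt ℝ ∞ f q ∧
      (∀ i, ContDiffAt ℝ ∞ (a i) q) ∧ (∀ v, fderiv ℝ f q v = ∑ i, a i q * α i q v) ∧
      a j q ≠ 0 := by
  have hα' := eventually_all.2 hα
  obtain ⟨g, hg⟩ := exists_firstIntegrals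
    (η := fun q => ContinuousLinearMap.pi fun i => α i q) (m := m)
    (hα'.mono fun q hq => contDiffAt_clm_pi hq)
    (surjective_pi_of_linearIndependent hli) (by
      filter_upwards [hα', hinvol] with q h1 h2 u v hu hv
      have h3 : HasFDerivAt (fun q => ContinuousLinearMap.pi fun i => α i q)
          (fderiv ℝ (fun q => ContinuousLinearMap.pi fun i => α i q) q) q :=
        ((contDiffAt_clm_pi h1).differentiableAt (by simp)).hasFDerivAt
      have h4 : ∀ i u v, fderiv ℝ (fun q => ContinuousLinearMap.pi fun i => α i q) q u v i =
          fderiv ℝ (α i) q u v := by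
        intro i u v
        have h5 := (ContinuousLinearMap.proj (R := ℝ) (φ := fun _ : Fin k => ℝ) i).hasFDerivAt.comp q
          (h3.clm_apply (hasFDerivAt_const v q))
        have h6 := ((h1 i).differentiableAt (by simp)).hasFDerivAt.clm_apply
          (hasFDerivAt_const v q)
        have h7 := congrArg (fun L => L u) (h5.unique h6)
        simpa using h7
      funext i
      rw [h4, h4]
      have := h2 u v (fun i => congrFun hu i) (fun i => congrFun hv i) i
      rw [dform_apply, sub_eq_zero] at this
      exact this)
  obtain ⟨-, A, hA, hAm⟩ := hg.self_of_nhds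
  -- The differential of `g` is `A` composed with the tuple of forms, so `A e_j` lists the
  -- coefficients of `α j` in the components of `dg`. Injectivity of `A` provides a component `l`
  -- where it is nonzero.
  have hne : A (Pi.single j 1) ≠ 0 := by
    intro h0
    have := hA.1 (h0.trans (map_zero A).symm)
    simpa using congrFun this j
  obtain ⟨l, hl⟩ := Function.ne_iff.1 hne
  have hproj : ∀ᶠ q in 𝓝 m, ContDiffAt ℝ ∞ (fun q => g q l) q ∧
      ∀ v, fderiv ℝ (fun q => g q l) q v = fderiv ℝ g q v l := by
    filter_upwards [hg] with q hq
    refine ⟨contDiffAt_pi.1 hq.1 l, fun v => ?_⟩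
    have h1 := (hq.1.differentiableAt (by simp)).hasFDerivAt
    have h2 := (hasFDerivAt_pi'.1 h1 l).fderiv
    rw [h2]
    rfl
  obtain ⟨a, ha⟩ := exists_smooth_coeffs (β := fderiv ℝ fun q => g q l) hα hli (by
    filter_upwards [hproj] with q hq using hq.1.fderiv_right (by simp)) (by
    filter_upwards [hproj, hg] with q h1 h2 v hv
    obtain ⟨-, A, -, hA⟩ := h2
    rw [h1.2, hA]
    have : (ContinuousLinearMap.pi fun i => α i q) v = 0 := funext hv
    simp only [ContinuousLinearMap.comp_apply, this, map_zero]
    rfl)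
  have haj : a j m ≠ 0 := by
    obtain ⟨v, hv⟩ := surjective_pi_of_linearIndependent hli (Pi.single j 1)
    have h1 := ha.self_of_nhds.2 v
    have h2 : ∀ i, α i m v = if i = j then 1 else 0 := fun i => by
      have := congrFun hv i
      simpa [Pi.single_apply] using this
    rw [hproj.self_of_nhds.2, hAm, ContinuousLinearMap.comp_apply, hv] at h1
    simp only [h2, mul_ite, mul_one, mul_zero, Finset.sum_ite_eq', Finset.mem_univ, if_true] at h1
    rw [← h1]
    exact hl
  refine ⟨fun q => g q l, a, ?_⟩
  filter_upwards [hproj, ha, (ha.self_of_nhds.1 j).continuousAt.eventually_ne haj] with q h1 h2 h3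
  exact ⟨h1.1, h2.1, h2.2, h3⟩

end Forms

end

/-- A combination of 1-forms with smooth coefficients, differentiated. -/
theorem dform_of_coeffs {E : Type} [NormedAddCommGroup E] [NormedSpace ℝ E] {k : ℕ}
    {α : Fin k → E → E →L[ℝ] ℝ} {β : E → E →L[ℝ] ℝ} {a : Fin k → E → ℝ} {q : E}
    (hα : ∀ i, DifferentiableAt ℝ (α i) q) (ha : ∀ i, DifferentiableAt ℝ (a i) q)
    (h : ∀ᶠ q in 𝓝 q, ∀ v, β q v = ∑ i, a i q * α i q v) (u v : E) :
    dform β q u v = ∑ i, (fderiv ℝ (a i) q u * α i q v - fderiv ℝ (a i) q v * α i q u +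
      a i q * dform (α i) q u v) := by
  have h1 : β =ᶠ[𝓝 q] fun q => ∑ i, a i q • α i q := by
    filter_upwards [h] with q' hq'
    ext v
    rw [hq']
    simp
  have h2 : HasFDerivAt (fun q => ∑ i, a i q • α i q) _ q :=
    HasFDerivAt.fun_sum fun i _ => (ha i).hasFDerivAt.smul (hα i).hasFDerivAt
  rw [h1.dform_eq, dform_apply, h2.fderiv, sum_apply,
    sum_apply, sum_apply, sum_apply,
    ← Finset.sum_sub_distrib]
  refine Finset.sum_congr rfl fun i _ => ?_
  simp only [dform_apply, add_apply, smul_apply, ContinuousLinearMap.smulRight_apply, smul_eq_mul]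
  ring

/-- An alternating bilinear form that vanishes on the pairs from three vectors vanishes on their
combinations. -/
theorem dform_eq_zero_of_span {E : Type} [NormedAddCommGroup E] [NormedSpace ℝ E]
    {α : E → E →L[ℝ] ℝ} {q x y z u v : E} (h1 : dform α q x y = 0) (h2 : dform α q x z = 0)
    (h3 : dform α q y z = 0) (hu : ∃ a b c : ℝ, u = a • x + b • y + c • z)
    (hv : ∃ a b c : ℝ, v = a • x + b • y + c • z) : dform α q u v = 0 := by
  obtain ⟨a, b, c, rfl⟩ := hu
  obtain ⟨a', b', c', rfl⟩ := hv
  have h4 := dform_swap (α := α) (q := q) y x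
  have h5 := dform_swap (α := α) (q := q) z x
  have h6 := dform_swap (α := α) (q := q) z y
  simp [h1, h2, h3, h4, h5, h6]

/-! ### Linear algebra of the contact form and the type condition -/

namespace CartanField

theorem contactForm_apply (q v : J1) : contactForm q v = v 2 - q 3 * v 0 - q 4 * v 1 := by
  simp [contactForm]

theorem contDiff_contactForm : ContDiff ℝ ∞ contactForm := by
  unfold contactForm
  exact (contDiff_const.sub ((contDiff_apply ℝ ℝ (3 : Fin 5)).smul contDiff_const)).sub
    ((contDiff_apply ℝ ℝ (4 : Fin 5)).smul contDiff_const)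

theorem dform_contactForm (q u v : J1) :
    dform contactForm q u v = u 0 * v 3 - u 3 * v 0 + (u 1 * v 4 - u 4 * v 1) := by
  have h : ∀ u v : J1, fderiv ℝ contactForm q u v = - (u 3 * v 0) - u 4 * v 1 := by
    intro u v
    have h1 := ((contDiff_contactForm.differentiable (by simp)) q).hasFDerivAt.clm_apply
      (hasFDerivAt_const v q)
    have h2 : HasFDerivAt (fun q : J1 => contactForm q v)
        (- (v 0 • ContinuousLinearMap.proj (R := ℝ) (φ := fun _ : Fin 5 => ℝ) 3)
          - v 1 • ContinuousLinearMap.proj (R := ℝ) (φ := fun _ : Fin 5 => ℝ) 4) q := by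
      have h3 := (((hasFDerivAt_apply (𝕜 := ℝ) (3 : Fin 5) q).mul_const (v 0)).const_sub (v 2)).sub
        ((hasFDerivAt_apply (𝕜 := ℝ) (4 : Fin 5) q).mul_const (v 1))
      refine h3.congr_of_eventuallyEq (Eventually.of_forall fun q' => ?_)
      exact contactForm_apply q' v
    have h4 := congrArg (fun L => L u) (h1.unique h2)
    simp at h4
    rw [h4]
    ring
  rw [dform_apply, h, h]
  ring

/-- The germ of `X` at `m` is a smooth Cartan field. -/
def IsCartanNear (X : J1 → J1) (m : J1) : Prop :=
  ∀ᶠ q in 𝓝 m, ContDiffAt ℝ ∞ X q ∧ contactForm q (X q) = 0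

theorem IsCartanField.isCartanNear {M : Set J1} {X : J1 → J1} (hM : IsOpen M)
    (hX : IsCartanField M X) {m : J1} (hm : m ∈ M) : IsCartanNear X m := by
  filter_upwards [hM.mem_nhds hm] with q hq
  exact ⟨hX.1.contDiffAt (hM.mem_nhds hq), hX.2 q hq⟩

theorem _root_.ContDiffAt.lieDerivForm {X : J1 → J1} {α : J1 → J1 →L[ℝ] ℝ} {q : J1}
    (hX : ContDiffAt ℝ ∞ X q) (hα : ContDiffAt ℝ ∞ α q) :
    ContDiffAt ℝ ∞ (lieDerivForm X α) q := by
  have h1 : ContDiffAt ℝ ∞ (fderiv ℝ α) q := hα.fderiv_right (by simp)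
  have h2 : ContDiffAt ℝ ∞ (fderiv ℝ X) q := hX.fderiv_right (by simp)
  exact (h1.clm_apply hX).add (hα.clm_comp h2)

theorem lieDerivForm_apply_eq_dform {X : J1 → J1} {α : J1 → J1 →L[ℝ] ℝ} {q : J1}
    (hα : ContDiffAt ℝ ∞ α q) (hX : ContDiffAt ℝ ∞ X q) (hαX : ∀ᶠ q in 𝓝 q, α q (X q) = 0)
    (v : J1) : lieDerivForm X α q v = dform α q (X q) v :=
  dform_apply_eq_lieDeriv (hα.differentiableAt (by simp)) (hX.differentiableAt (by simp)) hαX v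

theorem mem_orthDist {X : J1 → J1} {q v : J1} :
    v ∈ orthDist X q ↔ contactForm q v = 0 ∧ lieDerivForm X contactForm q v = 0 := Iff.rfl

/-- Lift of a vector with coordinates `(x, y, p, q)` to the contact distribution. -/
def contactLift (q : J1) (a b c d : ℝ) : J1 := ![a, b, q 3 * a + q 4 * b, c, d]

/-- Together with `X` and `frameTwo`, a frame of `X^⊥`. -/
def frameOne (X : J1 → J1) (q : J1) : J1 := contactLift q (X q 1) (-X q 0) (-X q 4) (X q 3)

/-- Together with `X` and `frameOne`, a frame of `X^⊥`. -/
def frameTwo (X : J1 → J1) (q : J1) : J1 := contactLift q (X q 4) (-X q 3) (X q 1) (-X q 0)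

/-- A complement of `X^⊥` in the contact distribution. -/
def frameConj (X : J1 → J1) (q : J1) : J1 := contactLift q (-X q 3) (-X q 4) (X q 0) (X q 1)

/-- Square length of the `(x, y, p, q)` components. -/
def normSqAt (X : J1 → J1) (q : J1) : ℝ := X q 0 ^ 2 + X q 1 ^ 2 + X q 3 ^ 2 + X q 4 ^ 2

theorem contactForm_contactLift (q : J1) (a b c d : ℝ) :
    contactForm q (contactLift q a b c d) = 0 := by
  rw [contactForm_apply]
  simp [contactLift]

theorem dform_contactLift (q u : J1) (a b c d : ℝ) :
    dform contactForm q u (contactLift q a b c d) = u 0 * c - u 3 * a + (u 1 * d - u 4 * b) := by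
  rw [dform_contactForm]
  simp [contactLift]

theorem contDiffAt_contactLift {f g h k : J1 → ℝ} {q : J1} (hf : ContDiffAt ℝ ∞ f q)
    (hg : ContDiffAt ℝ ∞ g q) (hh : ContDiffAt ℝ ∞ h q) (hk : ContDiffAt ℝ ∞ k q) :
    ContDiffAt ℝ ∞ (fun q => contactLift q (f q) (g q) (h q) (k q)) q := by
  have h3 : ContDiffAt ℝ ∞ (fun q : J1 => q 3) q := (contDiff_apply ℝ ℝ (3 : Fin 5)).contDiffAt
  have h4 : ContDiffAt ℝ ∞ (fun q : J1 => q 4) q := (contDiff_apply ℝ ℝ (4 : Fin 5)).contDiffAt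
  refine contDiffAt_pi.2 fun i => ?_
  fin_cases i
  · exact hf
  · exact hg
  · exact (h3.mul hf).add (h4.mul hg)
  · exact hh
  · exact hk

theorem contDiffAt_frame {X : J1 → J1} {q : J1} (hX : ContDiffAt ℝ ∞ X q) :
    ContDiffAt ℝ ∞ (frameOne X) q ∧ ContDiffAt ℝ ∞ (frameTwo X) q := by
  have h := contDiffAt_pi.1 hX
  exact ⟨contDiffAt_contactLift (h 1) (h 0).neg (h 4).neg (h 3),
    contDiffAt_contactLift (h 4) (h 3).neg (h 1) (h 0).neg⟩

theorem normSqAt_ne_zero {X : J1 → J1} {q : J1} (hU : contactForm q (X q) = 0) (hX : X q ≠ 0) :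
    normSqAt X q ≠ 0 := by
  intro h0
  apply hX
  unfold normSqAt at h0
  have h0' : X q 0 = 0 := by nlinarith [sq_nonneg (X q 0), sq_nonneg (X q 1), sq_nonneg (X q 3), sq_nonneg (X q 4)]
  have h1 : X q 1 = 0 := by nlinarith [sq_nonneg (X q 0), sq_nonneg (X q 1), sq_nonneg (X q 3), sq_nonneg (X q 4)]
  have h3 : X q 3 = 0 := by nlinarith [sq_nonneg (X q 0), sq_nonneg (X q 1), sq_nonneg (X q 3), sq_nonneg (X q 4)]
  have h4 : X q 4 = 0 := by nlinarith [sq_nonneg (X q 0), sq_nonneg (X q 1), sq_nonneg (X q 3), sq_nonneg (X q 4)]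
  rw [contactForm_apply, h0', h1] at hU
  funext i
  fin_cases i <;> simp_all

/-- On the `(x, y, p, q)` components, the three frames are the images of `X` under three quaternion
units. They are therefore orthogonal to `X` and to each other and have its length, which gives a
smooth frame wherever `X ≠ 0`; `dU` pairs `X` with `frameConj` and `frameOne` with `frameTwo`. -/
theorem dform_frame (X : J1 → J1) (q : J1) :
    dform contactForm q (X q) (frameOne X q) = 0 ∧ dform contactForm q (X q) (frameTwo X q) = 0 ∧
    dform contactForm q (frameOne X q) (frameTwo X q) = normSqAt X q ∧
    dform contactForm q (X q) (frameConj X q) = normSqAt X q := by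
  refine ⟨?_, ?_, ?_, ?_⟩
  · rw [frameOne, dform_contactLift]; ring
  · rw [frameTwo, dform_contactLift]; ring
  · rw [frameTwo, dform_contactLift, normSqAt]
    simp [frameOne, contactLift]; ring
  · rw [frameConj, dform_contactLift, normSqAt]; ring

/-- The coefficients are orthogonal projections in the `(x, y, p, q)` components. The condition
`dU(X, v) = 0` says that `v` is orthogonal to `frameConj`, so no fourth coefficient occurs; the `z`
component is determined by `U = 0`. -/
theorem exists_frame_coeffs {X : J1 → J1} {q v : J1} (hU : contactForm q (X q) = 0)
    (hX : X q ≠ 0) (hv : contactForm q v = 0) (hXv : dform contactForm q (X q) v = 0) :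
    ∃ a b c : ℝ, v = a • X q + b • frameOne X q + c • frameTwo X q := by
  have hn := normSqAt_ne_zero hU hX
  rw [contactForm_apply] at hU hv
  rw [dform_contactForm] at hXv
  have hU' : X q 2 = q 3 * X q 0 + q 4 * X q 1 := by linarith
  have hv' : v 2 = q 3 * v 0 + q 4 * v 1 := by linarith
  refine ⟨(X q 0 * v 0 + X q 1 * v 1 + X q 3 * v 3 + X q 4 * v 4) / normSqAt X q,
    (X q 1 * v 0 - X q 0 * v 1 - X q 4 * v 3 + X q 3 * v 4) / normSqAt X q,
    (X q 4 * v 0 - X q 3 * v 1 + X q 1 * v 3 - X q 0 * v 4) / normSqAt X q, ?_⟩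
  have e0 : normSqAt X q * v 0 = (X q 0 * v 0 + X q 1 * v 1 + X q 3 * v 3 + X q 4 * v 4) * X q 0 +
    (X q 1 * v 0 - X q 0 * v 1 - X q 4 * v 3 + X q 3 * v 4) * X q 1 +
    (X q 4 * v 0 - X q 3 * v 1 + X q 1 * v 3 - X q 0 * v 4) * X q 4 := by
    unfold normSqAt; linear_combination (-X q 3) * hXv
  have e1 : normSqAt X q * v 1 = (X q 0 * v 0 + X q 1 * v 1 + X q 3 * v 3 + X q 4 * v 4) * X q 1 +
    (X q 1 * v 0 - X q 0 * v 1 - X q 4 * v 3 + X q 3 * v 4) * (-X q 0) +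
    (X q 4 * v 0 - X q 3 * v 1 + X q 1 * v 3 - X q 0 * v 4) * (-X q 3) := by
    unfold normSqAt; linear_combination (-X q 4) * hXv
  have e3 : normSqAt X q * v 3 = (X q 0 * v 0 + X q 1 * v 1 + X q 3 * v 3 + X q 4 * v 4) * X q 3 +
    (X q 1 * v 0 - X q 0 * v 1 - X q 4 * v 3 + X q 3 * v 4) * (-X q 4) +
    (X q 4 * v 0 - X q 3 * v 1 + X q 1 * v 3 - X q 0 * v 4) * X q 1 := by
    unfold normSqAt; linear_combination (X q 0) * hXv
  have e4 : normSqAt X q * v 4 = (X q 0 * v 0 + X q 1 * v 1 + X q 3 * v 3 + X q 4 * v 4) * X q 4 +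
    (X q 1 * v 0 - X q 0 * v 1 - X q 4 * v 3 + X q 3 * v 4) * X q 3 +
    (X q 4 * v 0 - X q 3 * v 1 + X q 1 * v 3 - X q 0 * v 4) * (-X q 0) := by
    unfold normSqAt; linear_combination (X q 1) * hXv
  have h0 : v 0 = (X q 0 * v 0 + X q 1 * v 1 + X q 3 * v 3 + X q 4 * v 4) / normSqAt X q * X q 0 +
    (X q 1 * v 0 - X q 0 * v 1 - X q 4 * v 3 + X q 3 * v 4) / normSqAt X q * X q 1 +
    (X q 4 * v 0 - X q 3 * v 1 + X q 1 * v 3 - X q 0 * v 4) / normSqAt X q * X q 4 := by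
    field_simp; linarith
  have h1 : v 1 = (X q 0 * v 0 + X q 1 * v 1 + X q 3 * v 3 + X q 4 * v 4) / normSqAt X q * X q 1 +
    (X q 1 * v 0 - X q 0 * v 1 - X q 4 * v 3 + X q 3 * v 4) / normSqAt X q * (-X q 0) +
    (X q 4 * v 0 - X q 3 * v 1 + X q 1 * v 3 - X q 0 * v 4) / normSqAt X q * (-X q 3) := by
    field_simp; linarith
  funext i
  fin_cases i
  · exact h0
  · exact h1
  · change v 2 = (_ / _) * X q 2 + (_ / _) * (q 3 * X q 1 + q 4 * (-X q 0)) +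
      (_ / _) * (q 3 * X q 4 + q 4 * (-X q 3))
    rw [hU', hv']
    linear_combination q 3 * h0 + q 4 * h1
  · change v 3 = (_ / _) * X q 3 + (_ / _) * (-X q 4) + (_ / _) * X q 1
    field_simp; linarith
  · change v 4 = (_ / _) * X q 4 + (_ / _) * X q 3 + (_ / _) * (-X q 0)
    field_simp; linarith

/-- Nondegeneracy of `dU` on the contact distribution. -/
theorem eq_zero_of_dform_contactForm {q v : J1} (hv : contactForm q v = 0)
    (h : ∀ w, contactForm q w = 0 → dform contactForm q v w = 0) : v = 0 := by
  have h0 := h (contactLift q 0 0 1 0) (contactForm_contactLift _ _ _ _ _)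
  have h1 := h (contactLift q 0 0 0 1) (contactForm_contactLift _ _ _ _ _)
  have h3 := h (contactLift q 1 0 0 0) (contactForm_contactLift _ _ _ _ _)
  have h4 := h (contactLift q 0 1 0 0) (contactForm_contactLift _ _ _ _ _)
  rw [dform_contactLift] at h0 h1 h3 h4
  rw [contactForm_apply] at hv
  simp at h0 h1 h3 h4
  rw [h0, h1] at hv
  funext i
  fin_cases i <;> simp_all

section Near

variable {X : J1 → J1} {m : J1}

theorem IsCartanNear.eventually (h : IsCartanNear X m) : ∀ᶠ q in 𝓝 m, IsCartanNear X q :=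
  h.eventually_nhds

theorem IsCartanNear.contDiffAt (h : IsCartanNear X m) : ContDiffAt ℝ ∞ X m := h.self_of_nhds.1

theorem IsCartanNear.lieDerivForm_contactForm (h : IsCartanNear X m) (v : J1) :
    lieDerivForm X contactForm m v = dform contactForm m (X m) v :=
  lieDerivForm_apply_eq_dform contDiff_contactForm.contDiffAt h.contDiffAt (h.mono fun _ h => h.2) v

theorem IsCartanNear.apply_self (h : IsCartanNear X m) : lieDerivForm X contactForm m (X m) = 0 := by
  rw [h.lieDerivForm_contactForm, dform_self]

theorem IsCartanNear.contDiffAt_lieDerivForm (h : IsCartanNear X m) :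
    ContDiffAt ℝ ∞ (lieDerivForm X contactForm) m :=
  h.contDiffAt.lieDerivForm contDiff_contactForm.contDiffAt

theorem IsCartanNear.frame_mem (h : IsCartanNear X m) :
    X m ∈ orthDist X m ∧ frameOne X m ∈ orthDist X m ∧ frameTwo X m ∈ orthDist X m := by
  simp only [mem_orthDist, h.lieDerivForm_contactForm]
  exact ⟨⟨h.self_of_nhds.2, dform_self _⟩, ⟨contactForm_contactLift _ _ _ _ _, (dform_frame X m).1⟩,
    ⟨contactForm_contactLift _ _ _ _ _, (dform_frame X m).2.1⟩⟩

theorem IsCartanNear.exists_coeffs (h : IsCartanNear X m) (hX : X m ≠ 0) {v : J1}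
    (hv : v ∈ orthDist X m) :
    ∃ a b c : ℝ, v = a • X m + b • frameOne X m + c • frameTwo X m := by
  rw [mem_orthDist, h.lieDerivForm_contactForm] at hv
  exact exists_frame_coeffs h.self_of_nhds.2 hX hv.1 hv.2

/-- Linear independence of two forms from test vectors. -/
theorem linearIndependent_pair_of_apply {α β : J1 →L[ℝ] ℝ} {u v : J1} (h1 : α u ≠ 0)
    (h2 : β u = 0) (h3 : β v ≠ 0) : LinearIndependent ℝ ![α, β] := by
  rw [LinearIndependent.pair_iff]
  intro s t hst
  have hu := congrArg (fun L => L u) hst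
  have hv := congrArg (fun L => L v) hst
  simp only [add_apply, smul_apply, smul_eq_mul, zero_apply, h2, mul_zero, add_zero] at hu hv
  have hs : s = 0 := by simpa [h1] using hu
  subst hs
  exact ⟨rfl, by simpa [h3] using hv⟩

theorem contactForm_single (q : J1) : contactForm q (Pi.single 2 1) = 1 := by
  rw [contactForm_apply]; simp

theorem IsCartanNear.linearIndependent (h : IsCartanNear X m) (hX : X m ≠ 0) :
    LinearIndependent ℝ ![contactForm m, lieDerivForm X contactForm m] := by
  refine linearIndependent_pair_of_apply (u := Pi.single 2 1) (v := frameConj X m) ?_ ?_ ?_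
  · rw [contactForm_single]; exact one_ne_zero
  · rw [h.lieDerivForm_contactForm, dform_contactForm]; simp
  · rw [h.lieDerivForm_contactForm, (dform_frame X m).2.2.2]
    exact normSqAt_ne_zero h.self_of_nhds.2 hX

/-- A form that vanishes on the common kernel of two forms is in their span. -/
theorem mem_span_pair_of_ker {α β γ : J1 →L[ℝ] ℝ} (hli : LinearIndependent ℝ ![α, β])
    (h : ∀ v, α v = 0 → β v = 0 → γ v = 0) : γ ∈ Submodule.span ℝ {α, β} := by
  obtain ⟨u, hu⟩ := surjective_pi_of_linearIndependent hli ![1, 0]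
  obtain ⟨w, hw⟩ := surjective_pi_of_linearIndependent hli ![0, 1]
  have hu0 : α u = 1 := congrFun hu 0
  have hu1 : β u = 0 := congrFun hu 1
  have hw0 : α w = 0 := congrFun hw 0
  have hw1 : β w = 1 := congrFun hw 1
  rw [Submodule.mem_span_pair]
  refine ⟨γ u, γ w, ?_⟩
  ext v
  have := h (v - α v • u - β v • w) (by simp [hu0, hw0]) (by simp [hu1, hw1])
  simp only [map_sub, map_smul, smul_eq_mul] at this
  simp only [add_apply, smul_apply, smul_eq_mul]
  linarith

theorem ker_of_mem_span_pair {α β γ : J1 →L[ℝ] ℝ} (h : γ ∈ Submodule.span ℝ {α, β}) {v : J1}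
    (h1 : α v = 0) (h2 : β v = 0) : γ v = 0 := by
  obtain ⟨a, b, rfl⟩ := Submodule.mem_span_pair.1 h
  simp [h1, h2]

/-- At a zero of `X`, the Lie derivative of a form that vanishes there vanishes there too. Since
`X(U) = i_X dU` vanishes at such a point, so do all further iterates, and the rank is at most 1. -/
theorem IsCartanNear.ne_zero_of_typeAt (h : IsCartanNear X m) (ht : typeAt X m = 2) : X m ≠ 0 := by
  intro h0
  have hz : ∀ β : J1 → J1 →L[ℝ] ℝ, β m = 0 → lieDerivForm X β m = 0 := fun β hβ => by
    simp [lieDerivForm, h0, hβ]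
  have h1 : lieDerivForm X contactForm m = 0 := by
    ext v
    rw [h.lieDerivForm_contactForm, h0, map_zero]
  have hle : Submodule.span ℝ (Set.range fun k : Fin 4 =>
      (lieDerivForm X)^[(k : ℕ)] contactForm m) ≤ Submodule.span ℝ {contactForm m} := by
    rw [Submodule.span_le]
    rintro _ ⟨k, rfl⟩
    fin_cases k
    · exact Submodule.mem_span_singleton_self _
    · simp [h1]
    · have := hz (lieDerivForm X contactForm) h1
      simp [Function.iterate_succ_apply', this]
    · have := hz _ (hz (lieDerivForm X contactForm) h1)
      simp [Function.iterate_succ_apply', this]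
  have h2 := Submodule.finrank_mono hle
  have h3 := finrank_span_le_card (R := ℝ) ({contactForm m} : Set (J1 →L[ℝ] ℝ))
  rw [typeAt] at ht
  simp at h3
  omega

/-- The forms `U` and `X(U)` already have rank 2, so the other two must lie in their span, that is,
vanish on their common kernel. -/
theorem IsCartanNear.typeAt_eq_two_iff (h : IsCartanNear X m) (hX : X m ≠ 0) :
    typeAt X m = 2 ↔ ∀ v ∈ orthDist X m,
      lieDerivForm X (lieDerivForm X contactForm) m v = 0 ∧
      lieDerivForm X (lieDerivForm X (lieDerivForm X contactForm)) m v = 0 := by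
  have hli := h.linearIndependent hX
  have hr : Module.finrank ℝ (Submodule.span ℝ
      {contactForm m, lieDerivForm X contactForm m}) = 2 := by
    have h1 := finrank_span_eq_card hli
    rwa [Fintype.card_fin, Matrix.range_cons, Matrix.range_cons, Matrix.range_empty,
      Set.union_empty, Set.singleton_union] at h1
  have hle : Submodule.span ℝ {contactForm m, lieDerivForm X contactForm m} ≤
      Submodule.span ℝ (Set.range fun k : Fin 4 => (lieDerivForm X)^[(k : ℕ)] contactForm m) := by
    refine Submodule.span_mono ?_
    rintro _ (rfl | rfl)
    · exact ⟨0, rfl⟩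
    · exact ⟨1, rfl⟩
  constructor
  · intro ht v hv
    have heq := Submodule.eq_of_le_of_finrank_eq hle (hr.trans ht.symm)
    have h2 : lieDerivForm X (lieDerivForm X contactForm) m ∈
        Submodule.span ℝ {contactForm m, lieDerivForm X contactForm m} := by
      rw [heq]; exact Submodule.subset_span ⟨2, rfl⟩
    have h3 : lieDerivForm X (lieDerivForm X (lieDerivForm X contactForm)) m ∈
        Submodule.span ℝ {contactForm m, lieDerivForm X contactForm m} := by
      rw [heq]; exact Submodule.subset_span ⟨3, rfl⟩
    exact ⟨ker_of_mem_span_pair h2 hv.1 hv.2, ker_of_mem_span_pair h3 hv.1 hv.2⟩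
  · intro hk
    have heq := le_antisymm hle (by
      rw [Submodule.span_le]
      rintro _ ⟨k, rfl⟩
      fin_cases k
      · exact Submodule.subset_span (Or.inl rfl)
      · exact Submodule.subset_span (Or.inr rfl)
      · exact mem_span_pair_of_ker hli fun v h1 h2 => (hk v ⟨h1, h2⟩).1
      · exact mem_span_pair_of_ker hli fun v h1 h2 => (hk v ⟨h1, h2⟩).2)
    rw [typeAt, ← heq, hr]

end Near

end CartanField

/-! ### Adapted forms and the derived distributions -/

namespace CartanField

/-- `W` is a 1-form whose kernel at `q` will be the derived distribution of `X^⊥`: the latter is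
`{U = 0, W = 0}` and `dW` vanishes on it. -/
structure IsAdaptedAt (X : J1 → J1) (W : J1 → J1 →L[ℝ] ℝ) (q : J1) : Prop where
  smooth : ContDiffAt ℝ ∞ W q
  ne_zero : X q ≠ 0
  independent : LinearIndependent ℝ ![contactForm q, W q]
  mem_iff : ∀ v, v ∈ orthDist X q ↔ contactForm q v = 0 ∧ W q v = 0
  dform_eq : ∀ u ∈ orthDist X q, ∀ v ∈ orthDist X q, dform W q u v = 0

/-- `dW` vanishes on the kernel of `W` at `q`. -/
def IsFlatAt (W : J1 → J1 →L[ℝ] ℝ) (q : J1) : Prop :=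
  ∀ u v, W q u = 0 → W q v = 0 → dform W q u v = 0

variable {X : J1 → J1} {W : J1 → J1 →L[ℝ] ℝ} {m : J1}

/-- On `X^⊥` the form `d(cU)` reduces to `c dU`. Type 2 gives `i_X dV = X²(U) = 0` and `i_X dU = 0`
there, so the only obstruction is the value of `dV` on the two frame fields; `c` is chosen to cancel
it, using that `dU` takes the nonzero value `normSqAt` on them. -/
theorem exists_adapted (h : IsCartanNear X m) (ht : ∀ᶠ q in 𝓝 m, typeAt X q = 2) :
    ∃ W, ∀ᶠ q in 𝓝 m, IsAdaptedAt X W q := by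
  let V := lieDerivForm X contactForm
  let c : J1 → ℝ := fun q => dform V q (frameOne X q) (frameTwo X q) / normSqAt X q
  refine ⟨fun q => V q - c q • contactForm q, ?_⟩
  filter_upwards [h.eventually, ht] with q hq htq
  have hX := hq.ne_zero_of_typeAt htq
  have hXs := hq.contDiffAt
  have hVs : ContDiffAt ℝ ∞ V q := hq.contDiffAt_lieDerivForm
  have hUs : ContDiffAt ℝ ∞ contactForm q := contDiff_contactForm.contDiffAt
  have hn := normSqAt_ne_zero hq.self_of_nhds.2 hX
  have hcs : ContDiffAt ℝ ∞ c q := by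
    obtain ⟨f1, f2⟩ := contDiffAt_frame hXs
    have hX' := contDiffAt_pi.1 hXs
    refine ((hVs.dform.clm_apply f1).clm_apply f2).div ?_ hn
    exact ((((hX' 0).pow 2).add ((hX' 1).pow 2)).add ((hX' 3).pow 2)).add ((hX' 4).pow 2)
  have hmem : ∀ v, v ∈ orthDist X q ↔ contactForm q v = 0 ∧ (V q - c q • contactForm q) v = 0 := by
    intro v
    rw [mem_orthDist]
    refine and_congr_right fun hv => ?_
    simp [hv, V]
  refine ⟨hVs.sub (hcs.smul hUs), hX, ?_, hmem, ?_⟩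
  · have hli := hq.linearIndependent hX
    rw [LinearIndependent.pair_iff] at hli ⊢
    intro s t hst
    have h1 : (s - t * c q) • contactForm q + t • lieDerivForm X contactForm q = 0 := by
      rw [← hst]
      simp only [V]
      module
    obtain ⟨h2, h3⟩ := hli _ _ h1
    subst h3
    exact ⟨by simpa using h2, rfl⟩
  · have hd : ∀ u ∈ orthDist X q, ∀ v ∈ orthDist X q,
        dform (fun q => V q - c q • contactForm q) q u v =
          dform V q u v - c q * dform contactForm q u v := by
      intro u hu v hv
      have h1 := hcs.differentiableAt (by simp)
      have h2 := hUs.differentiableAt (by simp)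
      rw [dform_sub (hVs.differentiableAt (by simp)) (h1.fun_smul h2), sub_apply, sub_apply,
        dform_smul h1 h2, (mem_orthDist.1 hu).1, (mem_orthDist.1 hv).1]
      ring
    obtain ⟨m0, m1, m2⟩ := hq.frame_mem
    have hXv : ∀ v ∈ orthDist X q, dform (fun q => V q - c q • contactForm q) q (X q) v = 0 := by
      intro v hv
      rw [hd _ m0 _ hv, ← lieDerivForm_apply_eq_dform hVs hXs
        (hq.eventually.mono fun _ h => h.apply_self), ← hq.lieDerivForm_contactForm, (mem_orthDist.1 hv).2]
      have := (hq.typeAt_eq_two_iff hX).1 htq v hv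
      simp [V, this.1]
    have h12 : dform (fun q => V q - c q • contactForm q) q (frameOne X q) (frameTwo X q) = 0 := by
      rw [hd _ m1 _ m2, (dform_frame X q).2.2.1]
      simp only [c]
      field_simp
      ring
    intro u hu v hv
    exact dform_eq_zero_of_span (hXv _ m1) (hXv _ m2) h12 (hq.exists_coeffs hX hu)
      (hq.exists_coeffs hX hv)

theorem eventually_smooth_pair (hW : ∀ᶠ q in 𝓝 m, IsAdaptedAt X W q) :
    ∀ i, ∀ᶠ q in 𝓝 m, ContDiffAt ℝ ∞ ((![contactForm, W] : Fin 2 → _) i) q := by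
  refine Fin.forall_fin_two.2 ⟨?_, ?_⟩
  · exact Eventually.of_forall fun _ => contDiff_contactForm.contDiffAt
  · exact hW.mono fun q h => h.smooth

theorem linearIndependent_vec_two {α β : J1 → J1 →L[ℝ] ℝ}
    (h : LinearIndependent ℝ ![α m, β m]) :
    LinearIndependent ℝ fun i => (![α, β] : Fin 2 → _) i m := by
  convert! h using 1
  funext i
  fin_cases i <;> rfl

/-- Writing `V = a₀ U + a₁ W`, on `X^⊥` one has `dV = a₀ dU + a₁ dW`, and contraction with `X` kills
both terms; hence `X²(U) = i_X dV` vanishes there. Then `X²(U) = b₀ U + b₁ V`, and the same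
computation treats `X³(U)`. -/
theorem typeAt_eq_two_of_adapted (h : IsCartanNear X m) (hW : ∀ᶠ q in 𝓝 m, IsAdaptedAt X W q) :
    ∀ᶠ q in 𝓝 m, typeAt X q = 2 := by
  let V := lieDerivForm X contactForm
  have hVs : ∀ᶠ q in 𝓝 m, ContDiffAt ℝ ∞ V q :=
    h.eventually.mono fun q hq => hq.contDiffAt_lieDerivForm
  obtain ⟨a, ha⟩ := exists_smooth_coeffs (β := V) (eventually_smooth_pair hW)
    (linearIndependent_vec_two hW.self_of_nhds.independent) hVs (by
      filter_upwards [hW] with q hq v hv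
      exact ((hq.mem_iff v).2 ⟨hv 0, hv 1⟩).2)
  have h2 : ∀ᶠ q in 𝓝 m, ∀ v ∈ orthDist X q, lieDerivForm X V q v = 0 := by
    filter_upwards [h.eventually, ha.eventually_nhds, hW, hVs] with q hq haq hWq hVq v hv
    obtain ⟨m0, -, -⟩ := hq.frame_mem
    rw [lieDerivForm_apply_eq_dform hVq hq.contDiffAt
      (hq.eventually.mono fun _ h => h.apply_self), dform_of_coeffs (α := ![contactForm, W])
      (Fin.forall_fin_two.2 ⟨contDiff_contactForm.contDiffAt.differentiableAt (by simp),
        hWq.smooth.differentiableAt (by simp)⟩)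
      (fun i => (haq.self_of_nhds.1 i).differentiableAt (by simp)) (haq.mono fun _ h => h.2),
      Fin.sum_univ_two]
    have e1 := (hWq.mem_iff v).1 hv
    have e2 := (hWq.mem_iff _).1 m0
    have e3 : dform contactForm q (X q) v = 0 := by
      rw [← hq.lieDerivForm_contactForm]; exact hv.2
    simp [e1.1, e1.2, e2.1, e2.2, e3, hWq.dform_eq _ m0 _ hv]
  have hV2s : ∀ᶠ q in 𝓝 m, ContDiffAt ℝ ∞ (lieDerivForm X V) q := by
    filter_upwards [h.eventually, hVs] with q hq hVq using hq.contDiffAt.lieDerivForm hVq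
  have hps : ∀ i, ∀ᶠ q in 𝓝 m, ContDiffAt ℝ ∞ ((![contactForm, V] : Fin 2 → _) i) q :=
    Fin.forall_fin_two.2 ⟨Eventually.of_forall fun _ => contDiff_contactForm.contDiffAt, hVs⟩
  obtain ⟨b, hb⟩ := exists_smooth_coeffs (β := lieDerivForm X V) hps
    (linearIndependent_vec_two (h.linearIndependent hW.self_of_nhds.ne_zero)) hV2s (by
      filter_upwards [h2] with q hq v hv
      exact hq v ⟨hv 0, hv 1⟩)
  filter_upwards [h.eventually, hb.eventually_nhds, hW, hVs, h2.eventually_nhds, hV2s]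
    with q hq hbq hWq hVq h2q hV2q
  rw [hq.typeAt_eq_two_iff hWq.ne_zero]
  intro v hv
  have hv2 := h2q.self_of_nhds v hv
  refine ⟨hv2, ?_⟩
  obtain ⟨m0, -, -⟩ := hq.frame_mem
  rw [lieDerivForm_apply_eq_dform hV2q hq.contDiffAt (by
      filter_upwards [h2q, hq.eventually] with q' h' hq'
      exact h' _ hq'.frame_mem.1),
    dform_of_coeffs (α := ![contactForm, V])
      (Fin.forall_fin_two.2 ⟨contDiff_contactForm.contDiffAt.differentiableAt (by simp),
        hVq.differentiableAt (by simp)⟩)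
      (fun i => (hbq.self_of_nhds.1 i).differentiableAt (by simp)) (hbq.mono fun _ h => h.2),
      Fin.sum_univ_two]
  have e3 : dform contactForm q (X q) v = 0 := by
    rw [← hq.lieDerivForm_contactForm]; exact hv.2
  have e4 : dform V q (X q) v = 0 := by
    rw [← lieDerivForm_apply_eq_dform hVq hq.contDiffAt
      (hq.eventually.mono fun _ h => h.apply_self)]
    exact hv2
  have e5 : V q v = 0 := hv.2
  have e6 : V q (X q) = 0 := m0.2
  simp [(mem_orthDist.1 hv).1, (mem_orthDist.1 m0).1, e3, e4, e5, e6]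

section Derived

variable {k : ℕ} {α : Fin k → J1 → J1 →L[ℝ] ℝ} {Q : J1 → Submodule ℝ J1} {q : J1}

/-- Values of the annihilating forms on brackets of sections. -/
theorem apply_bracket_of_isSection (hα : ∀ i, ContDiffAt ℝ ∞ (α i) q)
    (hQ : ∀ᶠ q in 𝓝 q, ∀ v, v ∈ Q q → ∀ i, α i q v = 0) {V : Set J1} {Y Z : J1 → J1}
    (hV : IsOpen V) (hqV : q ∈ V) (hY : IsSection Q V Y) (hZ : IsSection Q V Z) (i : Fin k) :
    α i q (VectorField.lieBracket ℝ Y Z q) = - dform (α i) q (Y q) (Z q) := by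
  have hd : ∀ {Y : J1 → J1}, IsSection Q V Y → DifferentiableAt ℝ Y q := fun h =>
    (h.1.contDiffAt (hV.mem_nhds hqV)).differentiableAt (by simp)
  have hz : ∀ {Y : J1 → J1}, IsSection Q V Y → ∀ᶠ q in 𝓝 q, α i q (Y q) = 0 := fun h => by
    filter_upwards [hV.mem_nhds hqV, hQ] with q' h1 h2 using h2 _ (h.2 q' h1) i
  exact apply_lieBracket_eq_neg_dform ((hα i).differentiableAt (by simp)) (hd hY) (hd hZ) (hz hY)
    (hz hZ)

/-- Arbitrary vectors of `Q q` extend to local sections: apply the smooth projections onto the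
kernels to constant fields. The required vector is the bracket of two such sections. -/
theorem exists_mem_derivedDist (hα : ∀ i, ∀ᶠ q in 𝓝 q, ContDiffAt ℝ ∞ (α i) q)
    (hli : LinearIndependent ℝ fun i => α i q)
    (hQ : ∀ᶠ q in 𝓝 q, ∀ v, v ∈ Q q ↔ ∀ i, α i q v = 0) {a b : J1} (ha : a ∈ Q q)
    (hb : b ∈ Q q) : ∃ v ∈ derivedDist Q q, ∀ i, α i q v = - dform (α i) q a b := by
  obtain ⟨P, hP⟩ := exists_smooth_kernelProjection
    (η := fun q => ContinuousLinearMap.pi fun i => α i q) (m := q)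
    ((eventually_all.2 hα).mono fun q hq => contDiffAt_clm_pi hq)
    (surjective_pi_of_linearIndependent hli)
  obtain ⟨V, hV, hVo, hqV⟩ := eventually_nhds_iff.1 (hP.and hQ)
  have hsec : ∀ a, IsSection Q V fun q => P q a := fun a =>
    ⟨fun q' hq' => ((hV q' hq').1.1.clm_apply contDiffAt_const).contDiffWithinAt, fun q' hq' =>
      ((hV q' hq').2 _).2 fun i => congrFun ((hV q' hq').1.2.1 a) i⟩
  have hval : ∀ {a}, a ∈ Q q → P q a = a := fun {a} ha =>
    (hV q hqV).1.2.2 a (funext ((hQ.self_of_nhds a).1 ha))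
  refine ⟨VectorField.lieBracket ℝ (fun q => P q a) (fun q => P q b) q,
    Submodule.mem_sup_right (Submodule.subset_span ⟨V, _, _, hVo, hqV, hsec a, hsec b, rfl⟩),
    fun i => ?_⟩
  rw [apply_bracket_of_isSection (fun i => (hα i).self_of_nhds)
    (hQ.mono fun q h v => (h v).1) hVo hqV (hsec a) (hsec b), hval ha, hval hb]

/-- Brackets of sections stay in `ker W` because `dW = 0` on `X^⊥`. Conversely, a bracket extending
the two frame vectors has `W = 0` and `U = -normSqAt ≠ 0`, so it fills the one missing dimension. -/
theorem derivedDist_orthDist (h : IsCartanNear X m) (hW : ∀ᶠ q in 𝓝 m, IsAdaptedAt X W q) :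
    derivedDist (orthDist X) m = LinearMap.ker (W m).toLinearMap := by
  have hQ : ∀ᶠ q in 𝓝 m, ∀ v, v ∈ orthDist X q ↔
      ∀ i, (![contactForm, W] : Fin 2 → _) i q v = 0 := by
    filter_upwards [hW] with q hq v
    rw [hq.mem_iff, Fin.forall_fin_two]
    rfl
  have hs := eventually_smooth_pair hW
  have hWm := hW.self_of_nhds
  apply le_antisymm
  · refine sup_le (fun v hv => ((hWm.mem_iff v).1 hv).2) ?_
    rw [Submodule.span_le]
    rintro _ ⟨V, Y, Z, hV, hmV, hY, hZ, rfl⟩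
    have := apply_bracket_of_isSection (fun i => (hs i).self_of_nhds)
      (hQ.mono fun q h v => (h v).1) hV hmV hY hZ 1
    have h1 : W m (VectorField.lieBracket ℝ Y Z m) = - dform W m (Y m) (Z m) := this
    rw [hWm.dform_eq _ (hY.2 m hmV) _ (hZ.2 m hmV), neg_zero] at h1
    exact h1
  · intro u hu
    have hu' : W m u = 0 := hu
    obtain ⟨-, m1, m2⟩ := h.frame_mem
    obtain ⟨v, hv, hvα⟩ := exists_mem_derivedDist hs
      (linearIndependent_vec_two hWm.independent) hQ m1 m2
    have h0 : contactForm m v = - normSqAt X m := by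
      rw [← (dform_frame X m).2.2.1]; exact hvα 0
    have h1 : W m v = 0 := by
      have : W m v = - dform W m (frameOne X m) (frameTwo X m) := hvα 1
      rw [this, hWm.dform_eq _ m1 _ m2, neg_zero]
    have hn := normSqAt_ne_zero h.self_of_nhds.2 hWm.ne_zero
    have h2 : u - (contactForm m u / contactForm m v) • v ∈ orthDist X m := by
      rw [hWm.mem_iff]
      refine ⟨?_, by simp [hu', h1]⟩
      rw [map_sub, map_smul, smul_eq_mul, h0]
      field_simp
      ring
    have h3 := Submodule.add_mem _ (Submodule.mem_sup_left h2)
      (Submodule.smul_mem _ (contactForm m u / contactForm m v) hv)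
    rwa [sub_add_cancel] at h3

/-- If `dW` is nonzero on one pair in the hyperplane `ker W`, the bracket of sections through this
pair leaves the hyperplane; otherwise no bracket does. -/
theorem finrank_derivedDist_ker (hW : ∀ᶠ q in 𝓝 m, ContDiffAt ℝ ∞ W q) (hne : W m ≠ 0)
    (hQ : ∀ᶠ q in 𝓝 m, Q q = LinearMap.ker (W q).toLinearMap) :
    (IsFlatAt W m → Module.finrank ℝ (derivedDist Q m) = 4) ∧
      (¬ IsFlatAt W m → Module.finrank ℝ (derivedDist Q m) = 5) := by
  have hQ' : ∀ᶠ q in 𝓝 m, ∀ v, v ∈ Q q ↔ ∀ i, (fun _ : Fin 1 => W) i q v = 0 := by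
    filter_upwards [hQ] with q hq v
    rw [hq]
    simp
  have hQm : ∀ v, v ∈ Q m ↔ W m v = 0 := fun v => by
    rw [hQ.self_of_nhds]; rfl
  constructor
  · intro hf
    have heq : derivedDist Q m = LinearMap.ker (W m).toLinearMap := by
      apply le_antisymm
      · refine sup_le hQ.self_of_nhds.le ?_
        rw [Submodule.span_le]
        rintro _ ⟨V, Y, Z, hV, hmV, hY, hZ, rfl⟩
        have h1 := apply_bracket_of_isSection (α := fun _ : Fin 1 => W)
          (fun i => hW.self_of_nhds) (hQ'.mono fun q h v => (h v).1) hV hmV hY hZ 0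
        rw [hf _ _ ((hQm _).1 (hY.2 m hmV)) ((hQm _).1 (hZ.2 m hmV)), neg_zero] at h1
        exact h1
      · rw [← hQ.self_of_nhds]
        exact le_sup_left
    have hne' : (W m).toLinearMap ≠ 0 := fun h => hne (by
      ext v; exact LinearMap.congr_fun h v)
    have := Module.Dual.finrank_ker_add_one_of_ne_zero (f := (W m).toLinearMap) hne'
    rw [heq]
    simp at this
    omega
  · intro hf
    simp only [IsFlatAt, not_forall] at hf
    obtain ⟨a, b, ha, hb, hab⟩ := hf
    obtain ⟨v, hv, hvα⟩ := exists_mem_derivedDist (α := fun _ : Fin 1 => W) (fun _ => hW)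
      (LinearIndependent.of_subsingleton 0 hne) hQ' ((hQm a).2 ha) ((hQm b).2 hb)
    have hv' : W m v ≠ 0 := by
      have h1 : W m v = - dform W m a b := hvα 0
      rw [h1]
      simpa using hab
    have htop : derivedDist Q m = ⊤ := by
      rw [eq_top_iff]
      intro u _
      have h2 : u - (W m u / W m v) • v ∈ Q m := by
        rw [hQm]
        simp [hv']
      have h3 := Submodule.add_mem _ (Submodule.mem_sup_left h2)
        (Submodule.smul_mem _ (W m u / W m v) hv)
      rwa [sub_add_cancel] at h3
    rw [htop]
    simp

end Derived

/-- Regularity in terms of an adapted form. -/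
theorem isRegularAt_iff (h : IsCartanNear X m) (hW : ∀ᶠ q in 𝓝 m, IsAdaptedAt X W q) :
    IsRegularAt X m ↔ (∀ᶠ q in 𝓝 m, IsFlatAt W q) ∨ ∀ᶠ q in 𝓝 m, ¬ IsFlatAt W q := by
  have hd : ∀ᶠ q in 𝓝 m, derivedDist (orthDist X) q = LinearMap.ker (W q).toLinearMap := by
    filter_upwards [h.eventually, hW.eventually_nhds] with q h1 h2 using derivedDist_orthDist h1 h2
  have hr : ∀ᶠ q in 𝓝 m,
      (IsFlatAt W q → Module.finrank ℝ (derivedDist (derivedDist (orthDist X)) q) = 4) ∧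
      (¬ IsFlatAt W q → Module.finrank ℝ (derivedDist (derivedDist (orthDist X)) q) = 5) := by
    filter_upwards [hW.eventually_nhds, hd.eventually_nhds] with q h1 h2
    exact finrank_derivedDist_ker (h1.mono fun _ h => h.smooth)
      (h1.self_of_nhds.independent.ne_zero 1) h2
  constructor
  · rintro ⟨k, hk⟩
    by_cases h4 : k = 4
    · left
      filter_upwards [hr, hk] with q h1 h2
      by_contra hf
      have := h1.2 hf
      omega
    · right
      filter_upwards [hr, hk] with q h1 h2 hf
      have := h1.1 hf
      omega
  · rintro (hf | hf)
    · exact ⟨4, by filter_upwards [hr, hf] with q h1 h2 using h1.1 h2⟩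
    · exact ⟨5, by filter_upwards [hr, hf] with q h1 h2 using h1.2 h2⟩

end CartanField

/-! ### Contact charts and normal forms -/

namespace CartanField

/-- Near `m`, the smooth functions `x, y, z, p, q` satisfy `dz = c U + p dx + q dy` with a nowhere
vanishing `c`. -/
structure IsJetCoords (x y z p q c : J1 → ℝ) (s : J1) : Prop where
  smooth_x : ContDiffAt ℝ ∞ x s
  smooth_y : ContDiffAt ℝ ∞ y s
  smooth_z : ContDiffAt ℝ ∞ z s
  smooth_p : ContDiffAt ℝ ∞ p s
  smooth_q : ContDiffAt ℝ ∞ q s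
  smooth_c : ContDiffAt ℝ ∞ c s
  ne_zero : c s ≠ 0
  eq : ∀ v, fderiv ℝ z s v = c s * contactForm s v + p s * fderiv ℝ x s v + q s * fderiv ℝ y s v

variable {x y z p q c : J1 → ℝ} {s m : J1}

theorem _root_.ContDiffAt.fderiv_smooth {f : J1 → ℝ} (h : ContDiffAt ℝ ∞ f s) :
    ContDiffAt ℝ ∞ (fderiv ℝ f) s := h.fderiv_right (by simp)

/-- This is the exterior derivative of `dz = c U + p dx + q dy`, namely `0 = dc ∧ U + c dU + dp ∧ dx
+ dq ∧ dy`. It turns statements about `dU` into statements about the coordinates. -/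
theorem IsJetCoords.dform_eq (h : ∀ᶠ s in 𝓝 s, IsJetCoords x y z p q c s) (u v : J1) :
    0 = fderiv ℝ c s u * contactForm s v - fderiv ℝ c s v * contactForm s u +
        c s * dform contactForm s u v +
      (fderiv ℝ p s u * fderiv ℝ x s v - fderiv ℝ p s v * fderiv ℝ x s u) +
      (fderiv ℝ q s u * fderiv ℝ y s v - fderiv ℝ q s v * fderiv ℝ y s u) := by
  have h0 := h.self_of_nhds
  have h1 := dform_of_coeffs (q := s) (α := ![contactForm, fderiv ℝ x, fderiv ℝ y])
    (β := fderiv ℝ z) (a := ![c, p, q])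
    (by
      intro i
      fin_cases i
      · exact contDiff_contactForm.contDiffAt.differentiableAt (by simp)
      · exact h0.smooth_x.fderiv_smooth.differentiableAt (by simp)
      · exact h0.smooth_y.fderiv_smooth.differentiableAt (by simp))
    (by
      intro i
      fin_cases i
      · exact h0.smooth_c.differentiableAt (by simp)
      · exact h0.smooth_p.differentiableAt (by simp)
      · exact h0.smooth_q.differentiableAt (by simp))
    (by
      filter_upwards [h] with s hs v
      rw [hs.eq, Fin.sum_univ_three]
      rfl) u v
  rw [dform_fderiv h0.smooth_z, Fin.sum_univ_three] at h1
  simp only [zero_apply, Matrix.cons_val_zero, Matrix.cons_val_one, Matrix.cons_val,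
    dform_fderiv h0.smooth_x, dform_fderiv h0.smooth_y] at h1
  linarith

/-- Jet coordinates have independent differentials. -/
theorem IsJetCoords.eq_zero (h : ∀ᶠ s in 𝓝 s, IsJetCoords x y z p q c s) {v : J1}
    (hx : fderiv ℝ x s v = 0) (hy : fderiv ℝ y s v = 0) (hz : fderiv ℝ z s v = 0)
    (hp : fderiv ℝ p s v = 0) (hq : fderiv ℝ q s v = 0) : v = 0 := by
  have h0 := h.self_of_nhds
  have hU : contactForm s v = 0 := by
    have := h0.eq v
    rw [hx, hy, hz] at this
    simpa [h0.ne_zero] using this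
  -- On the contact plane the differentiated relation reduces to `c dU(v, w) = 0`, and `dU` is
  -- nondegenerate there.
  refine eq_zero_of_dform_contactForm hU fun w hw => ?_
  have := IsJetCoords.dform_eq h v w
  rw [hx, hy, hp, hq, hU, hw] at this
  simpa [h0.ne_zero] using this

/-- The map with given components. -/
def jetMap (x y z p q : J1 → ℝ) : J1 → J1 := fun s => ![x s, y s, z s, p s, q s]

theorem IsJetCoords.contDiffAt_jetMap (h : IsJetCoords x y z p q c s) :
    ContDiffAt ℝ ∞ (jetMap x y z p q) s := by
  refine contDiffAt_pi.2 fun i => ?_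
  fin_cases i
  exacts [h.smooth_x, h.smooth_y, h.smooth_z, h.smooth_p, h.smooth_q]

theorem IsJetCoords.fderiv_jetMap (h : IsJetCoords x y z p q c s) (v : J1) :
    fderiv ℝ (jetMap x y z p q) s v =
      ![fderiv ℝ x s v, fderiv ℝ y s v, fderiv ℝ z s v, fderiv ℝ p s v, fderiv ℝ q s v] := by
  have h1 := (h.contDiffAt_jetMap.differentiableAt (by simp)).hasFDerivAt
  have h2 : ∀ i, fderiv ℝ (fun s => jetMap x y z p q s i) s v =
      fderiv ℝ (jetMap x y z p q) s v i := fun i => by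
    rw [(hasFDerivAt_pi'.1 h1 i).fderiv]
    rfl
  funext i
  rw [← h2]
  fin_cases i <;> rfl

/-- Jet coordinates form a contact chart. -/
theorem exists_contactChart (h : ∀ᶠ s in 𝓝 m, IsJetCoords x y z p q c s) {O : Set J1}
    (hO : O ∈ 𝓝 m) : ∃ φ : OpenPartialHomeomorph J1 J1, IsContactChart φ ∧ m ∈ φ.source ∧
      φ.source ⊆ O ∧ (φ : J1 → J1) = jetMap x y z p q := by
  have hinv : (fderiv ℝ (jetMap x y z p q) m).IsInvertible := by
    have hinj : Function.Injective (fderiv ℝ (jetMap x y z p q) m).toLinearMap := by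
      rw [injective_iff_map_eq_zero]
      intro v hv
      have hv' : fderiv ℝ (jetMap x y z p q) m v = 0 := hv
      rw [h.self_of_nhds.fderiv_jetMap] at hv'
      exact IsJetCoords.eq_zero h (congrFun hv' 0) (congrFun hv' 1) (congrFun hv' 2)
        (congrFun hv' 3) (congrFun hv' 4)
    refine ⟨(LinearEquiv.ofInjectiveEndo _ hinj).toContinuousLinearEquiv, ?_⟩
    ext v
    rfl
  obtain ⟨φ, hφ, hm, hsub, hs, ht⟩ := exists_smooth_localInverse (inter_mem hO h)
    (h.mono fun s hs => hs.contDiffAt_jetMap) hinv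
  refine ⟨φ, ⟨?_, ?_, ?_⟩, hm, fun s hs => (hsub hs).1, hφ⟩
  · rw [hφ]; exact fun s hs' => (hs s hs').contDiffWithinAt
  · exact fun w hw => (ht w hw).contDiffWithinAt
  · intro s hs'
    have h0 : IsJetCoords x y z p q c s := (hsub hs').2
    refine ⟨c s, h0.ne_zero, ?_⟩
    ext v
    rw [ContinuousLinearMap.comp_apply, hφ, h0.fderiv_jetMap, contactForm_apply]
    change fderiv ℝ z s v - p s * fderiv ℝ x s v - q s * fderiv ℝ y s v = _
    rw [h0.eq, smul_apply, smul_eq_mul]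
    ring

/-- Jet coordinates adapted to `X` bring it to normal form. -/
theorem hasNormalFormAt_of_jetCoords {M : Set J1} (hM : M ∈ 𝓝 m) {X : J1 → J1} {l : J1 → ℝ}
    (hX : IsCartanNear X m) (hX0 : X m ≠ 0)
    (h : ∀ᶠ s in 𝓝 m, IsJetCoords x y z p q c s) (hl : l = 0 ∨ l = z)
    (hxX : ∀ᶠ s in 𝓝 m, fderiv ℝ x s (X s) = 0) (hyX : ∀ᶠ s in 𝓝 m, fderiv ℝ y s (X s) = 0)
    (hP : ∀ᶠ s in 𝓝 m, ∀ v ∈ orthDist X s, fderiv ℝ x s v = - l s * fderiv ℝ y s v)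
    (hy : ∀ᶠ s in 𝓝 m, ∃ v ∈ orthDist X s, fderiv ℝ y s v ≠ 0) : HasNormalFormAt M X m := by
  have hall : ∀ᶠ s in 𝓝 m, s ∈ M ∧ ContDiffAt ℝ ∞ X s ∧ IsJetCoords x y z p q c s ∧
      fderiv ℝ p s (X s) ≠ 0 ∧ fderiv ℝ x s (X s) = 0 ∧ fderiv ℝ y s (X s) = 0 ∧
      fderiv ℝ z s (X s) = 0 ∧ fderiv ℝ q s (X s) = l s * fderiv ℝ p s (X s) := by
    filter_upwards [hM, hX.eventually, h.eventually_nhds, hxX, hyX, hP, hy,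
      hX.contDiffAt.continuousAt.eventually_ne hX0] with s h1 h2 h3 h4 h5 h6 ⟨v, hv, hyv⟩ h8
    have h30 := h3.self_of_nhds
    have hz : fderiv ℝ z s (X s) = 0 := by
      rw [h30.eq, h4, h5, h2.self_of_nhds.2]
      ring
    -- On `X` and `v ∈ X^⊥` the differentiated relation leaves `dp(X) dx(v) + dq(X) dy(v) = 0`.
    -- Substituting `dx(v) = -l dy(v)` and cancelling `dy(v)` gives the ratio of the last two
    -- components of `X`.
    have hq : fderiv ℝ q s (X s) = l s * fderiv ℝ p s (X s) := by
      have h9 := IsJetCoords.dform_eq h3 (X s) v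
      rw [h2.self_of_nhds.2, (mem_orthDist.1 hv).1, ← h2.lieDerivForm_contactForm,
        (mem_orthDist.1 hv).2, h4, h5, h6 v hv] at h9
      have h10 : (fderiv ℝ q s (X s) - l s * fderiv ℝ p s (X s)) * fderiv ℝ y s v = 0 := by
        linear_combination - h9
      exact sub_eq_zero.1 ((mul_eq_zero.1 h10).resolve_right hyv)
    -- The factor `dp(X)` cannot vanish, for otherwise all five coordinate differentials would
    -- vanish on `X`.
    refine ⟨h1, h2.contDiffAt, h30, fun hp => h8 ?_, h4, h5, hz, hq⟩
    exact IsJetCoords.eq_zero h3 h4 h5 hz hp (by rw [hq, hp, mul_zero])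
  obtain ⟨φ, hφc, hm, hsub, hφ⟩ := exists_contactChart h hall
  have hρ : ContDiffOn ℝ ∞ (fun s => fderiv ℝ p s (X s)) φ.source := fun s hs =>
    ((hsub hs).2.2.1.smooth_p.fderiv_smooth.clm_apply (hsub hs).2.1).contDiffWithinAt
  refine ⟨φ, hφc, hm, fun s hs => (hsub hs).1, ?_⟩
  rcases hl with rfl | rfl
  · refine Or.inl ⟨_, hρ, fun s hs => ?_⟩
    obtain ⟨-, -, h3, h4, h5, h6, h7, h8⟩ := hsub hs
    refine ⟨h4, ?_⟩
    rw [hφ, h3.fderiv_jetMap, h5, h6, h7, h8]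
    funext i
    fin_cases i <;> simp [fieldDp]
  · refine Or.inr ⟨_, hρ, fun s hs => ?_⟩
    obtain ⟨-, -, h3, h4, h5, h6, h7, h8⟩ := hsub hs
    refine ⟨h4, ?_⟩
    rw [hφ, h3.fderiv_jetMap, h5, h6, h7, h8]
    funext i
    fin_cases i <;> simp [fieldDpzDq, jetMap, mul_comm]

/-- Jet coordinates from a contact chart. -/
theorem IsContactChart.isJetCoords {φ : OpenPartialHomeomorph J1 J1} (hφ : IsContactChart φ)
    (hs : s ∈ φ.source) :
    IsJetCoords (fun s => φ s 0) (fun s => φ s 1) (fun s => φ s 2) (fun s => φ s 3)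
      (fun s => φ s 4) (fun s => contactForm (φ s) (fderiv ℝ φ s (Pi.single 2 1))) s ∧
      ∀ v i, fderiv ℝ (fun s => φ s i) s v = fderiv ℝ φ s v i := by
  have h1 : ContDiffAt ℝ ∞ φ s := hφ.smooth.contDiffAt (φ.open_source.mem_nhds hs)
  have h2 := contDiffAt_pi.1 h1
  have h3 : ContDiffAt ℝ ∞ (fderiv ℝ φ) s := h1.fderiv_right (by simp)
  have hcomp : ∀ v i, fderiv ℝ (fun s => φ s i) s v = fderiv ℝ φ s v i := fun v i => by
    rw [(hasFDerivAt_pi'.1 (h1.differentiableAt (by simp)).hasFDerivAt i).fderiv]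
    rfl
  obtain ⟨c, hc, hcU⟩ := hφ.contact s hs
  have hcv : ∀ v, contactForm (φ s) (fderiv ℝ φ s v) = c * contactForm s v := fun v =>
    congrArg (fun L => L v) hcU
  have hc1 : contactForm (φ s) (fderiv ℝ φ s (Pi.single 2 1)) = c := by
    rw [hcv, contactForm_single, mul_one]
  refine ⟨⟨h2 0, h2 1, h2 2, h2 3, h2 4, ?_, ?_, fun v => ?_⟩, hcomp⟩
  · exact (contDiff_contactForm.contDiffAt.comp s h1).clm_apply (h3.clm_apply contDiffAt_const)
  · rw [hc1]; exact hc
  · rw [hcomp, hcomp, hcomp, hc1, ← hcv, contactForm_apply]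
    ring

theorem IsContactChart.fderiv_surjective {φ : OpenPartialHomeomorph J1 J1} (hφ : IsContactChart φ)
    (hs : s ∈ φ.source) (w : J1) : ∃ v, fderiv ℝ φ s v = w := by
  have h1 := ((hφ.smooth.contDiffAt (φ.open_source.mem_nhds hs)).differentiableAt
    (by simp)).hasFDerivAt
  have h2 := ((hφ.smooth_symm.contDiffAt (φ.open_target.mem_nhds (φ.map_source hs))).differentiableAt
    (by simp)).hasFDerivAt
  have h3 : HasFDerivAt (fun w => φ (φ.symm w)) (fderiv ℝ φ s ∘L fderiv ℝ φ.symm (φ s)) (φ s) := by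
    refine HasFDerivAt.comp (φ s) ?_ h2
    rwa [φ.left_inv hs]
  have h4 : HasFDerivAt (fun w => φ (φ.symm w)) (ContinuousLinearMap.id ℝ J1) (φ s) := by
    refine (hasFDerivAt_id _).congr_of_eventuallyEq ?_
    filter_upwards [φ.open_target.mem_nhds (φ.map_source hs)] with w hw using φ.right_inv hw
  exact ⟨_, congrArg (fun L => L w) (h3.unique h4)⟩

theorem dform_fderiv_add_smul {l : J1 → ℝ} (hx : ContDiffAt ℝ ∞ x s) (hy : ContDiffAt ℝ ∞ y s)
    (hl : ContDiffAt ℝ ∞ l s) (u v : J1) :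
    dform (fun s => fderiv ℝ x s + l s • fderiv ℝ y s) s u v =
      fderiv ℝ l s u * fderiv ℝ y s v - fderiv ℝ l s v * fderiv ℝ y s u := by
  have h1 := hx.fderiv_smooth.differentiableAt (by simp)
  have h2 := hy.fderiv_smooth.differentiableAt (by simp)
  have h3 := hl.differentiableAt (by simp)
  rw [dform_add h1 (h3.fun_smul h2), add_apply, add_apply, dform_smul h3 h2, dform_fderiv hx,
    dform_fderiv hy]
  simp

/-- A field with a normal form has an adapted form that is flat or nowhere flat. -/
theorem exists_adapted_of_hasNormalFormAt {M : Set J1} {X : J1 → J1}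
    (hX : IsCartanNear X m) (h : HasNormalFormAt M X m) :
    ∃ W, (∀ᶠ s in 𝓝 m, IsAdaptedAt X W s) ∧
      ((∀ᶠ s in 𝓝 m, IsFlatAt W s) ∨ ∀ᶠ s in 𝓝 m, ¬ IsFlatAt W s) := by
  classical
  obtain ⟨φ, hφ, hm, -, hdir⟩ := h
  -- Both normal forms are treated together as `ρ (∂_p + l ∂_q)`, with `l = 0` or `l = z`.
  obtain ⟨l, hl, ρ, hρ⟩ : ∃ l : J1 → ℝ, (l = 0 ∨ l = fun s => φ s 2) ∧ ∃ ρ : J1 → ℝ,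
      ∀ s ∈ φ.source, ρ s ≠ 0 ∧ fderiv ℝ φ s (X s) = ![0, 0, 0, ρ s, l s * ρ s] := by
    rcases hdir with ⟨ρ, -, hρ⟩ | ⟨ρ, -, hρ⟩
    · refine ⟨0, Or.inl rfl, ρ, fun s hs => ⟨(hρ s hs).1, ?_⟩⟩
      rw [(hρ s hs).2]
      funext i
      fin_cases i <;> simp [fieldDp]
    · refine ⟨_, Or.inr rfl, ρ, fun s hs => ⟨(hρ s hs).1, ?_⟩⟩
      rw [(hρ s hs).2]
      funext i
      fin_cases i <;> simp [fieldDpzDq, mul_comm]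
  have hsrc : ∀ᶠ s in 𝓝 m, s ∈ φ.source := φ.open_source.mem_nhds hm
  have hjet := fun s (hs : s ∈ φ.source) => (hφ.isJetCoords hs).1
  have hcomp := fun s (hs : s ∈ φ.source) => (hφ.isJetCoords hs).2
  have hls : ∀ s ∈ φ.source, ContDiffAt ℝ ∞ l s := by
    intro s hs
    rcases hl with rfl | rfl
    · exact contDiffAt_const
    · exact (hjet s hs).smooth_z
  have hdl : ∀ s ∈ φ.source, ∀ v, fderiv ℝ l s v = if l = 0 then 0 else fderiv ℝ φ s v 2 := by
    intro s hs v
    split_ifs with h0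
    · rw [h0]
      simp
    · rw [← hcomp s hs, hl.resolve_left h0]
  have hdW : ∀ s ∈ φ.source, ∀ u v, dform (fun s => fderiv ℝ (fun s => φ s 0) s +
      l s • fderiv ℝ (fun s => φ s 1) s) s u v =
      fderiv ℝ l s u * fderiv ℝ φ s v 1 - fderiv ℝ l s v * fderiv ℝ φ s u 1 := by
    intro s hs u v
    rw [dform_fderiv_add_smul (hjet s hs).smooth_x (hjet s hs).smooth_y (hls s hs), hcomp s hs,
      hcomp s hs]
  have hWv : ∀ s ∈ φ.source, ∀ v, (fderiv ℝ (fun s => φ s 0) s +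
      l s • fderiv ℝ (fun s => φ s 1) s) v = fderiv ℝ φ s v 0 + l s * fderiv ℝ φ s v 1 := by
    intro s hs v
    rw [add_apply, smul_apply, hcomp s hs, hcomp s hs, smul_eq_mul]
  -- The adapted form is `W = dx + l dy`: modulo `U`, the form `i_X dU` is a nonzero multiple of it,
  -- and `dW = dl ∧ dy`.
  refine ⟨fun s => fderiv ℝ (fun s => φ s 0) s + l s • fderiv ℝ (fun s => φ s 1) s, ?_, ?_⟩
  · filter_upwards [hsrc.eventually_nhds, hX.eventually] with s hs hXs
    have hs0 := hs.self_of_nhds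
    have hj := hjet s hs0
    obtain ⟨hρ0, hρX⟩ := hρ s hs0
    have hmem : ∀ v, v ∈ orthDist X s ↔ contactForm s v = 0 ∧ (fderiv ℝ (fun s => φ s 0) s +
        l s • fderiv ℝ (fun s => φ s 1) s) v = 0 := by
      intro v
      rw [mem_orthDist, hXs.lieDerivForm_contactForm, hWv s hs0]
      refine and_congr_right fun hv => ?_
      have h1 := IsJetCoords.dform_eq (hs.mono hjet) (X s) v
      rw [hv, hXs.self_of_nhds.2] at h1
      simp only [hcomp s hs0, hρX] at h1
      simp only [Matrix.cons_val_zero, Matrix.cons_val_one, Matrix.cons_val] at h1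
      have hc := hj.ne_zero
      set c := contactForm (φ s) (fderiv ℝ φ s (Pi.single 2 1))
      constructor
      · intro h2
        rw [h2] at h1
        have h3 : ρ s * (fderiv ℝ φ s v 0 + l s * fderiv ℝ φ s v 1) = 0 := by
          linear_combination - h1
        exact (mul_eq_zero.1 h3).resolve_left hρ0
      · intro h2
        have h3 : c * dform contactForm s (X s) v = 0 := by
          linear_combination - h1 - ρ s * h2
        exact (mul_eq_zero.1 h3).resolve_left hc
    refine ⟨hj.smooth_x.fderiv_smooth.add ((hls s hs0).smul hj.smooth_y.fderiv_smooth), ?_, ?_,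
      hmem, ?_⟩
    · intro h0
      rw [h0, map_zero] at hρX
      exact hρ0 (congrFun hρX 3).symm
    · obtain ⟨u, hu⟩ := hφ.fderiv_surjective hs0 (Pi.single 2 1)
      obtain ⟨w, hw⟩ := hφ.fderiv_surjective hs0 (Pi.single 0 1)
      refine linearIndependent_pair_of_apply (u := u) (v := w) ?_ ?_ ?_
      · intro h0
        have := hj.eq u
        simp [hcomp s hs0, hu, h0] at this
      · rw [hWv s hs0, hu]
        simp
      · rw [hWv s hs0, hw]
        simp
    · intro u hu v hv
      rw [hdW s hs0, hdl s hs0, hdl s hs0]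
      split_ifs with h0
      · ring
      -- For `l = z`: on `X^⊥` one has `dz = p dx + q dy` and `dx = -z dy`, so `dz ∧ dy = p dx ∧ dy
      -- = 0`.
      · have h1 := (hmem u).1 hu
        have h2 := (hmem v).1 hv
        rw [hWv s hs0] at h1 h2
        have h3 := hj.eq u
        have h4 := hj.eq v
        simp only [hcomp s hs0, h1.1, h2.1] at h3 h4
        rw [h3, h4]
        linear_combination φ s 3 * fderiv ℝ φ s v 1 * h1.2 - φ s 3 * fderiv ℝ φ s u 1 * h2.2
  · by_cases h0 : l = 0
    · left
      filter_upwards [hsrc] with s hs u v _ _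
      rw [hdW s hs, hdl s hs, hdl s hs, if_pos h0, if_pos h0]
      ring
    · right
      filter_upwards [hsrc] with s hs hflat
      -- The vectors `∂_z` and `∂_y - z ∂_x` lie in `ker W`, and `dz ∧ dy` takes the value 1 on
      -- them.
      obtain ⟨u, hu⟩ := hφ.fderiv_surjective hs (Pi.single 2 1)
      obtain ⟨w, hw⟩ := hφ.fderiv_surjective hs (Pi.single 1 1 - l s • Pi.single 0 1)
      have h1 := hflat u w (by rw [hWv s hs, hu]; simp) (by rw [hWv s hs, hw]; simp)
      rw [hdW s hs, hdl s hs, hdl s hs, if_neg h0, if_neg h0, hu, hw] at h1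
      simp at h1

end CartanField

/-! ### The flat case: normal form `∂_p` -/

namespace CartanField

variable {X : J1 → J1} {W : J1 → J1 →L[ℝ] ℝ} {m s : J1}

/-- `dU` on `X^⊥` in terms of frame coefficients. -/
theorem dform_contactForm_combination (a b c : ℝ) :
    dform contactForm s (frameOne X s) (a • X s + b • frameOne X s + c • frameTwo X s) =
      c * normSqAt X s ∧
    dform contactForm s (frameTwo X s) (a • X s + b • frameOne X s + c • frameTwo X s) =
      - (b * normSqAt X s) := by
  obtain ⟨h1, h2, h3, -⟩ := dform_frame X s
  have h4 := dform_swap (α := contactForm) (q := s) (frameOne X s) (X s)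
  have h5 := dform_swap (α := contactForm) (q := s) (frameTwo X s) (X s)
  have h6 := dform_swap (α := contactForm) (q := s) (frameTwo X s) (frameOne X s)
  rw [h1] at h4
  rw [h2] at h5
  rw [h3] at h6
  simp [h3, h4, h5, h6]

/-- Three forms, of which the first two vanish on `X^⊥` and the third does not. -/
theorem linearIndependent_triple {α β γ : J1 →L[ℝ] ℝ} {v : J1} (h : LinearIndependent ℝ ![α, β])
    (h1 : α v = 0) (h2 : β v = 0) (h3 : γ v ≠ 0) : LinearIndependent ℝ ![α, β, γ] := by
  rw [Fintype.linearIndependent_iff]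
  intro g hg
  rw [Fin.sum_univ_three] at hg
  simp only [Matrix.cons_val_zero, Matrix.cons_val_one, Matrix.cons_val] at hg
  have h4 := congrArg (fun L => L v) hg
  simp only [add_apply, smul_apply, smul_eq_mul, h1, h2, mul_zero, zero_add, zero_apply] at h4
  have h5 : g 2 = 0 := by simpa [h3] using h4
  rw [h5, zero_smul, add_zero] at hg
  obtain ⟨h6, h7⟩ := LinearIndependent.pair_iff.1 h _ _ hg
  intro i
  fin_cases i <;> assumption

theorem linearIndependent_vec_three {α β γ : J1 → J1 →L[ℝ] ℝ}
    (h : LinearIndependent ℝ ![α m, β m, γ m]) :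
    LinearIndependent ℝ fun i => (![α, β, γ] : Fin 3 → _) i m := by
  convert! h using 1
  funext i
  fin_cases i <;> rfl

/-- A first integral of `X` that is not constant on `X^⊥`. -/
theorem exists_firstIntegral_transverse (hX : IsCartanNear X m)
    (hW : ∀ᶠ s in 𝓝 m, IsAdaptedAt X W s) :
    ∃ y : J1 → ℝ, ∀ᶠ s in 𝓝 m, ContDiffAt ℝ ∞ y s ∧ fderiv ℝ y s (X s) = 0 ∧
      fderiv ℝ y s (frameTwo X s) ≠ 0 := by
  let θ₁ : J1 → J1 →L[ℝ] ℝ := fun s => dform contactForm s (frameOne X s)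
  let θ₂ : J1 → J1 →L[ℝ] ℝ := fun s => dform contactForm s (frameTwo X s)
  have hn : ∀ᶠ s in 𝓝 m, normSqAt X s ≠ 0 := by
    filter_upwards [hX, hW] with s h1 h2 using normSqAt_ne_zero h1.2 h2.ne_zero
  -- The forms `θ₁`, `θ₂` cut `X^⊥` down to the line spanned by `X`, so the system is integrable for
  -- dimension reasons. A nonzero coefficient along `θ₁` makes `dy` nonzero on `frameTwo`, because
  -- `θ₁` is nonzero there while the three other forms vanish.
  obtain ⟨y, a, hy⟩ := exists_firstIntegral (m := m) (α := ![contactForm, W, θ₁, θ₂]) (by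
      have hd : ∀ s, ContDiffAt ℝ ∞ (dform contactForm) s := fun s =>
        contDiff_contactForm.contDiffAt.dform
      intro i
      fin_cases i
      · exact Eventually.of_forall fun _ => contDiff_contactForm.contDiffAt
      · exact hW.mono fun _ h => h.smooth
      · exact hX.mono fun s h => (hd s).clm_apply (contDiffAt_frame h.1).1
      · exact hX.mono fun s h => (hd s).clm_apply (contDiffAt_frame h.1).2) (by
      obtain ⟨-, m1, m2⟩ := hX.frame_mem
      have hWm := hW.self_of_nhds
      have hnm := hn.self_of_nhds
      have e1 := dform_contactForm_combination (X := X) (s := m) 0 1 0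
      have e2 := dform_contactForm_combination (X := X) (s := m) 0 0 1
      simp only [zero_smul, one_smul, zero_add, add_zero, zero_mul, one_mul] at e1 e2
      have f1 := (hWm.mem_iff _).1 m1
      have f2 := (hWm.mem_iff _).1 m2
      rw [Fintype.linearIndependent_iff]
      intro g hg
      rw [Fin.sum_univ_four] at hg
      change g 0 • contactForm m + g 1 • W m + g 2 • θ₁ m + g 3 • θ₂ m = 0 at hg
      have h1 := congrArg (fun L => L (frameOne X m)) hg
      have h2 := congrArg (fun L => L (frameTwo X m)) hg
      simp only [add_apply, smul_apply, smul_eq_mul, f1.1, f1.2, f2.1, f2.2, θ₁, θ₂, e1.1, e1.2,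
        e2.1, e2.2, mul_zero, zero_add, add_zero, zero_apply, neg_zero] at h1 h2
      have g3 : g 3 = 0 := by simpa [hnm] using h1
      have g2 : g 2 = 0 := by simpa [hnm] using h2
      rw [g2, g3, zero_smul, zero_smul, add_zero, add_zero] at hg
      obtain ⟨g0, g1⟩ := LinearIndependent.pair_iff.1 hWm.independent _ _ hg
      intro i
      fin_cases i <;> assumption) (by
      filter_upwards [hX.eventually, hW, hn] with s h1 h2 h3
      have hker : ∀ v, (∀ i, (![contactForm, W, θ₁, θ₂] : Fin 4 → _) i s v = 0) →
          ∃ t : ℝ, v = t • X s := by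
        intro v hv
        have hvP : v ∈ orthDist X s := (h2.mem_iff v).2 ⟨hv 0, hv 1⟩
        obtain ⟨a, b, c, habc⟩ := h1.exists_coeffs h2.ne_zero hvP
        have h4 : θ₁ s v = 0 := hv 2
        have h5 : θ₂ s v = 0 := hv 3
        obtain ⟨e1, e2⟩ := dform_contactForm_combination (X := X) (s := s) a b c
        rw [← habc] at e1 e2
        have hc : c = 0 := by
          have := e1.symm.trans h4
          simpa [h3] using this
        have hb : b = 0 := by
          have := e2.symm.trans h5
          simpa [h3] using this
        exact ⟨a, by rw [habc, hb, hc]; simp⟩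
      intro u v hu hv i
      obtain ⟨a, rfl⟩ := hker u hu
      obtain ⟨b, rfl⟩ := hker v hv
      simp) 2
  refine ⟨y, ?_⟩
  filter_upwards [hX.eventually, hW, hn, hy] with s h1 h2 h3 ⟨h4, _, h5, h6⟩
  obtain ⟨m0, m1, m2⟩ := h1.frame_mem
  obtain ⟨e1, e2⟩ := dform_contactForm_combination (X := X) (s := s) 0 0 1
  obtain ⟨e3, e4⟩ := dform_contactForm_combination (X := X) (s := s) 1 0 0
  simp only [zero_smul, one_smul, zero_add, add_zero, zero_mul, one_mul, neg_zero] at e1 e2 e3 e4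
  have f0 := (h2.mem_iff _).1 m0
  have f2 := (h2.mem_iff _).1 m2
  refine ⟨h4, ?_, ?_⟩
  · rw [h5, Fin.sum_univ_four]
    change a 0 s * contactForm s _ + a 1 s * W s _ + a 2 s * θ₁ s _ + a 3 s * θ₂ s _ = 0
    simp only [θ₁, θ₂, e3, e4, f0.1, f0.2]
    ring
  · rw [h5, Fin.sum_univ_four]
    change a 0 s * contactForm s _ + a 1 s * W s _ + a 2 s * θ₁ s _ + a 3 s * θ₂ s _ ≠ 0
    simp only [θ₁, θ₂, e1, e2, f2.1, f2.2]
    simpa using ⟨h6, h3⟩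

/-- Normal form when the derived distribution of `X^⊥` is integrable. -/
theorem hasNormalFormAt_of_flat {M : Set J1} (hM : M ∈ 𝓝 m) (hX : IsCartanNear X m)
    (hW : ∀ᶠ s in 𝓝 m, IsAdaptedAt X W s) (hflat : ∀ᶠ s in 𝓝 m, IsFlatAt W s) :
    HasNormalFormAt M X m := by
  obtain ⟨y, hy⟩ := exists_firstIntegral_transverse hX hW
  -- Flatness is integrability of the single equation `W = 0`.
  obtain ⟨x, a, hx⟩ := exists_firstIntegral (m := m) (α := fun _ : Fin 1 => W)
    (fun _ => hW.mono fun _ h => h.smooth)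
    (LinearIndependent.of_subsingleton 0 (hW.self_of_nhds.independent.ne_zero 1)) (by
      filter_upwards [hflat] with s hs u v hu hv i using hs u v (hu 0) (hv 0)) 0
  have hx' : ∀ᶠ s in 𝓝 m, ContDiffAt ℝ ∞ x s ∧ a 0 s ≠ 0 ∧
      ∀ v, fderiv ℝ x s v = a 0 s * W s v := by
    filter_upwards [hx] with s ⟨h1, _, h2, h3⟩
    exact ⟨h1, h3, fun v => by simp [h2]⟩
  have hxP : ∀ᶠ s in 𝓝 m, ∀ v ∈ orthDist X s, fderiv ℝ x s v = 0 := by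
    filter_upwards [hx', hW] with s h1 h2 v hv
    rw [h1.2.2, ((h2.mem_iff v).1 hv).2, mul_zero]
  -- The common kernel of `U, dx, dy` is a plane in `X^⊥` that contains `X`. Since `i_X dU = 0` on
  -- `X^⊥`, `dU` vanishes on this plane, and the system is integrable. The coefficients of `dz`
  -- along `dx` and `dy` serve as `p` and `q`, and the one along `U` is nonzero.
  obtain ⟨z, b, hz⟩ := exists_firstIntegral (m := m)
    (α := ![contactForm, fderiv ℝ x, fderiv ℝ y]) (by
      intro i
      fin_cases i
      · exact Eventually.of_forall fun _ => contDiff_contactForm.contDiffAt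
      · exact hx'.mono fun _ h => h.1.fderiv_smooth
      · exact hy.mono fun _ h => h.1.fderiv_smooth) (by
      refine linearIndependent_vec_three ?_
      have h1 := hW.self_of_nhds
      have h2 := hx'.self_of_nhds
      refine linearIndependent_triple (v := frameTwo X m) ?_ hX.frame_mem.2.2.1
        (hxP.self_of_nhds _ hX.frame_mem.2.2) hy.self_of_nhds.2.2
      have h3 : fderiv ℝ x m = a 0 m • W m := by
        ext v
        rw [h2.2.2, smul_apply, smul_eq_mul]
      have h4 := h1.independent
      rw [h3]
      rw [LinearIndependent.pair_iff] at h4 ⊢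
      intro r t hrt
      rw [smul_smul] at hrt
      obtain ⟨h5, h6⟩ := h4 _ _ hrt
      exact ⟨h5, (mul_eq_zero.1 h6).resolve_right h2.2.1⟩) (by
      filter_upwards [hX.eventually, hW, hx', hy] with s h1 h2 h3 h4
      have hmem : ∀ v, (∀ i, (![contactForm, fderiv ℝ x, fderiv ℝ y] : Fin 3 → _) i s v = 0) →
          v ∈ orthDist X s := by
        intro v hv
        have h5 : fderiv ℝ x s v = 0 := hv 1
        rw [h3.2.2] at h5
        exact (h2.mem_iff v).2 ⟨hv 0, (mul_eq_zero.1 h5).resolve_left h3.2.1⟩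
      intro u v hu hv i
      fin_cases i
      · obtain ⟨a₁, b₁, c₁, e₁⟩ := h1.exists_coeffs h2.ne_zero (hmem u hu)
        obtain ⟨a₂, b₂, c₂, e₂⟩ := h1.exists_coeffs h2.ne_zero (hmem v hv)
        have y1 : fderiv ℝ y s u = 0 := hu 2
        have y2 : fderiv ℝ y s v = 0 := hv 2
        obtain ⟨d1, d2⟩ := dform_contactForm_combination (X := X) (s := s) a₂ b₂ c₂
        have hXv : dform contactForm s (X s) v = 0 := by
          rw [← h1.lieDerivForm_contactForm]
          exact (hmem v hv).2
        rw [← e₂] at d1 d2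
        have hd : dform contactForm s u v = (b₁ * c₂ - c₁ * b₂) * normSqAt X s := by
          conv_lhs => rw [e₁]
          simp only [map_add, map_smul, add_apply, smul_apply, smul_eq_mul, hXv, d1, d2]
          ring
        rw [e₁] at y1
        rw [e₂] at y2
        simp only [map_add, map_smul, smul_eq_mul, h4.2.1, mul_zero, zero_add] at y1 y2
        have h5 : fderiv ℝ y s (frameTwo X s) * (b₁ * c₂ - c₁ * b₂) = 0 := by
          linear_combination b₁ * y2 - b₂ * y1
        have h6 := (mul_eq_zero.1 h5).resolve_left h4.2.2
        change dform contactForm s u v = 0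
        rw [hd, h6, zero_mul]
      · change dform (fderiv ℝ x) s u v = 0
        rw [dform_fderiv h3.1]
        rfl
      · change dform (fderiv ℝ y) s u v = 0
        rw [dform_fderiv h4.1]
        rfl) 0
  refine hasNormalFormAt_of_jetCoords (x := x) (y := y) (z := z) (p := b 1) (q := b 2) (c := b 0)
    (l := 0) hM hX hW.self_of_nhds.ne_zero ?_ (Or.inl rfl) ?_ (hy.mono fun _ h => h.2.1) ?_ ?_
  · filter_upwards [hx', hy, hz] with s h1 h2 ⟨h3, h4, h5, h6⟩
    refine ⟨h1.1, h2.1, h3, h4 1, h4 2, h4 0, h6, fun v => ?_⟩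
    rw [h5, Fin.sum_univ_three]
    rfl
  · filter_upwards [hxP, hX.eventually] with s h1 h2 using h1 _ h2.frame_mem.1
  · filter_upwards [hxP] with s h1 v hv
    rw [h1 v hv]
    simp
  · filter_upwards [hX.eventually, hy] with s h1 h2 using ⟨_, h1.frame_mem.2.2, h2.2.2⟩

end CartanField

/-! ### The nowhere flat case: normal form `∂_p + z ∂_q` -/

namespace CartanField

variable {X : J1 → J1} {W : J1 → J1 →L[ℝ] ℝ} {m s : J1}

/-- The bracket of the two frame fields, which together with `X^⊥` spans the kernel of `W`. -/
noncomputable def frameBracket (X : J1 → J1) (s : J1) : J1 :=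
  VectorField.lieBracket ℝ (frameOne X) (frameTwo X) s

/-- The form `i_S dW` for the bracket `S` of the frame fields. -/
noncomputable def engelForm (X : J1 → J1) (W : J1 → J1 →L[ℝ] ℝ) (s : J1) : J1 →L[ℝ] ℝ :=
  dform W s (frameBracket X s)

/-- The Cauchy characteristic field of the kernel of `W` inside `X^⊥`. -/
noncomputable def engelField (X : J1 → J1) (W : J1 → J1 →L[ℝ] ℝ) (s : J1) : J1 :=
  engelForm X W s (frameTwo X s) • frameOne X s - engelForm X W s (frameOne X s) • frameTwo X s

theorem fderiv_eq_zero_of_eventually {f : J1 → ℝ} (h : ∀ᶠ s in 𝓝 s, f s = 0) :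
    fderiv ℝ f s = 0 := by
  rw [Filter.EventuallyEq.fderiv_eq (f₁ := f) (f := fun _ => (0 : ℝ)) h]
  exact fderiv_const_apply _

theorem contDiffAt_frameBracket (hX : ContDiffAt ℝ ∞ X s) : ContDiffAt ℝ ∞ (frameBracket X) s := by
  obtain ⟨h1, h2⟩ := contDiffAt_frame hX
  exact h1.lieBracket_vectorField h2 (by simp)

/-- The last assertion is `d(dW) = 0` on `X` and the two frame fields. All pairings of these under
`dW` vanish identically, and the brackets of `X` with the frame fields remain in `X^⊥`; only the
term `dW(S, X)` survives. -/
theorem frameBracket_facts (hX : IsCartanNear X s) (hW : ∀ᶠ s in 𝓝 s, IsAdaptedAt X W s) :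
    contactForm s (frameBracket X s) = - normSqAt X s ∧ W s (frameBracket X s) = 0 ∧
      engelForm X W s (X s) = 0 := by
  have hW0 := hW.self_of_nhds
  obtain ⟨f1, f2⟩ := contDiffAt_frame hX.contDiffAt
  have d0 := hX.contDiffAt.differentiableAt (n := ∞) (by simp)
  have d1 := f1.differentiableAt (n := ∞) (by simp)
  have d2 := f2.differentiableAt (n := ∞) (by simp)
  have dU := (contDiff_contactForm.contDiffAt (x := s)).differentiableAt (n := ∞) (by simp)
  have dW := hW0.smooth.differentiableAt (by simp)
  have hmem : ∀ᶠ s in 𝓝 s, X s ∈ orthDist X s ∧ frameOne X s ∈ orthDist X s ∧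
      frameTwo X s ∈ orthDist X s := hX.eventually.mono fun _ h => h.frame_mem
  have hUW : ∀ {Y : J1 → J1}, (∀ᶠ s in 𝓝 s, Y s ∈ orthDist X s) →
      (∀ᶠ s in 𝓝 s, contactForm s (Y s) = 0) ∧ ∀ᶠ s in 𝓝 s, W s (Y s) = 0 := fun h =>
    ⟨h.mono fun _ h => h.1, by filter_upwards [h, hW] with s h1 h2 using ((h2.mem_iff _).1 h1).2⟩
  obtain ⟨u0, w0⟩ := hUW (hmem.mono fun _ h => h.1)
  obtain ⟨u1, w1⟩ := hUW (hmem.mono fun _ h => h.2.1)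
  obtain ⟨u2, w2⟩ := hUW (hmem.mono fun _ h => h.2.2)
  obtain ⟨m0, m1, m2⟩ := hmem.self_of_nhds
  obtain ⟨e1, e2, e3, -⟩ := dform_frame X s
  refine ⟨?_, ?_, ?_⟩
  · rw [frameBracket, apply_lieBracket_eq_neg_dform dU d1 d2 u1 u2, e3]
  · rw [frameBracket, apply_lieBracket_eq_neg_dform dW d1 d2 w1 w2, hW0.dform_eq _ m1 _ m2,
      neg_zero]
  · have hz : ∀ {A B : J1 → J1}, (∀ᶠ s in 𝓝 s, A s ∈ orthDist X s ∧ B s ∈ orthDist X s) →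
        fderiv ℝ (fun s => dform W s (A s) (B s)) s = 0 := fun h =>
      fderiv_eq_zero_of_eventually (by
        filter_upwards [h, hW] with s h1 h2 using h2.dform_eq _ h1.1 _ h1.2)
    have hb1 : VectorField.lieBracket ℝ X (frameOne X) s ∈ orthDist X s := by
      rw [hW0.mem_iff, apply_lieBracket_eq_neg_dform dU d0 d1 u0 u1, e1,
        apply_lieBracket_eq_neg_dform dW d0 d1 w0 w1, hW0.dform_eq _ m0 _ m1]
      simp
    have hb2 : VectorField.lieBracket ℝ (frameTwo X) X s ∈ orthDist X s := by
      rw [hW0.mem_iff, apply_lieBracket_eq_neg_dform dU d2 d0 u2 u0, dform_swap, e2,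
        apply_lieBracket_eq_neg_dform dW d2 d0 w2 w0, hW0.dform_eq _ m2 _ m0]
      simp
    have hc := dform_cyclic hW0.smooth d0 d1 d2
    rw [hz (hmem.mono fun _ h => h.2), hz (hmem.mono fun _ h => ⟨h.2.2, h.1⟩),
      hz (hmem.mono fun _ h => ⟨h.1, h.2.1⟩), hW0.dform_eq _ hb1 _ m2, hW0.dform_eq _ hb2 _ m1] at hc
    have h : dform W s (VectorField.lieBracket ℝ (frameOne X) (frameTwo X) s) (X s) = 0 := by
      simpa using hc.symm
    exact h

theorem engelForm_frameBracket : engelForm X W s (frameBracket X s) = 0 := dform_self _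

/-- `dW` on the kernel of `W`. -/
theorem normSqAt_mul_dform (hX : IsCartanNear X s) (hW : ∀ᶠ s in 𝓝 s, IsAdaptedAt X W s)
    {u v : J1} (hu : W s u = 0) (hv : W s v = 0) :
    normSqAt X s * dform W s u v =
      contactForm s v * engelForm X W s u - contactForm s u * engelForm X W s v := by
  have hW0 := hW.self_of_nhds
  obtain ⟨h1, h2, -⟩ := frameBracket_facts hX hW
  have hn := normSqAt_ne_zero hX.self_of_nhds.2 hW0.ne_zero
  -- Since `U(S) = -normSqAt ≠ 0`, the kernel of `W` is the sum of `X^⊥` and the line of `S`. As `dW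
  -- = 0` on `X^⊥`, it is determined on `ker W` by its contraction with `S`.
  have hdec : ∀ u, W s u = 0 → ∃ p ∈ orthDist X s,
      u = p - (contactForm s u / normSqAt X s) • frameBracket X s := by
    intro u hu
    refine ⟨u + (contactForm s u / normSqAt X s) • frameBracket X s, ?_, by simp⟩
    rw [hW0.mem_iff]
    refine ⟨?_, by simp [hu, h2]⟩
    rw [map_add, map_smul, h1, smul_eq_mul]
    field_simp
    ring
  obtain ⟨p₁, hp₁, e₁⟩ := hdec u hu
  obtain ⟨p₂, hp₂, e₂⟩ := hdec v hv
  have h3 : engelForm X W s u = engelForm X W s p₁ := by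
    rw [e₁, map_sub, map_smul, engelForm_frameBracket]; simp
  have h4 : engelForm X W s v = engelForm X W s p₂ := by
    rw [e₂, map_sub, map_smul, engelForm_frameBracket]; simp
  have h5 : dform W s p₁ (frameBracket X s) = - engelForm X W s p₁ := dform_swap _ _
  have h6 : dform W s (frameBracket X s) p₂ = engelForm X W s p₂ := rfl
  have h7 : dform W s u v = contactForm s v / normSqAt X s * engelForm X W s p₁ -
      contactForm s u / normSqAt X s * engelForm X W s p₂ := by
    conv_lhs => rw [e₁, e₂]
    simp only [map_sub, map_smul, sub_apply, smul_apply, smul_eq_mul, hW0.dform_eq _ hp₁ _ hp₂, h5,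
      h6, dform_self]
    ring
  rw [h7, h3, h4]
  field_simp

/-- The Engel form vanishes on `S`. If it vanished on `X^⊥` as well, it would vanish on `ker W`, and
`normSqAt_mul_dform` would make `W` flat. -/
theorem exists_engelForm_ne_zero (hX : IsCartanNear X s) (hW : ∀ᶠ s in 𝓝 s, IsAdaptedAt X W s)
    (hf : ¬ IsFlatAt W s) : ∃ v ∈ orthDist X s, engelForm X W s v ≠ 0 := by
  by_contra! h
  apply hf
  have hW0 := hW.self_of_nhds
  obtain ⟨h1, h2, -⟩ := frameBracket_facts hX hW
  have hn := normSqAt_ne_zero hX.self_of_nhds.2 hW0.ne_zero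
  have hz : ∀ u, W s u = 0 → engelForm X W s u = 0 := by
    intro u hu
    have h3 := h (u + (contactForm s u / normSqAt X s) • frameBracket X s) (by
      rw [hW0.mem_iff]
      refine ⟨?_, by simp [hu, h2]⟩
      rw [map_add, map_smul, h1, smul_eq_mul]
      field_simp
      ring)
    rw [map_add, map_smul, engelForm_frameBracket] at h3
    simpa using h3
  intro u v hu hv
  have h4 := normSqAt_mul_dform hX hW hu hv
  rw [hz u hu, hz v hv] at h4
  simpa [hn] using h4

theorem engelField_mem (hX : IsCartanNear X s) : engelField X W s ∈ orthDist X s :=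
  Submodule.sub_mem _ (Submodule.smul_mem _ _ hX.frame_mem.2.1)
    (Submodule.smul_mem _ _ hX.frame_mem.2.2)

theorem engelForm_engelField : engelForm X W s (engelField X W s) = 0 := by
  simp only [engelField, map_sub, map_smul, smul_eq_mul]
  ring

theorem contDiffAt_engelForm (hX : ContDiffAt ℝ ∞ X s) (hW : ContDiffAt ℝ ∞ W s) :
    ContDiffAt ℝ ∞ (engelForm X W) s := hW.dform.clm_apply (contDiffAt_frameBracket hX)

/-- `X` and the Engel field span an involutive distribution. -/
theorem dform_engelForm (hX : IsCartanNear X s) (hW : ∀ᶠ s in 𝓝 s, IsAdaptedAt X W s) :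
    dform (engelForm X W) s (X s) (engelField X W s) = 0 := by
  have hW0 := hW.self_of_nhds
  have hn := normSqAt_ne_zero hX.self_of_nhds.2 hW0.ne_zero
  have hXs := hX.contDiffAt
  obtain ⟨f1, f2⟩ := contDiffAt_frame hXs
  have hθs := contDiffAt_engelForm hXs hW0.smooth
  have hYs : ContDiffAt ℝ ∞ (engelField X W) s :=
    ((hθs.clm_apply f2).smul f1).sub ((hθs.clm_apply f1).smul f2)
  have hSs := contDiffAt_frameBracket hXs
  have dX := hXs.differentiableAt (n := ∞) (by simp)
  have dY := hYs.differentiableAt (n := ∞) (by simp)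
  have dS := hSs.differentiableAt (n := ∞) (by simp)
  have dθ := hθs.differentiableAt (n := ∞) (by simp)
  have dW := hW0.smooth.differentiableAt (by simp)
  have hfacts : ∀ᶠ s in 𝓝 s, W s (frameBracket X s) = 0 ∧ engelForm X W s (X s) = 0 := by
    filter_upwards [hX.eventually, hW.eventually_nhds] with s h1 h2
    exact (frameBracket_facts h1 h2).2
  have hθX : ∀ᶠ s in 𝓝 s, engelForm X W s (X s) = 0 := hfacts.mono fun _ h => h.2
  have hθY : ∀ᶠ s in 𝓝 s, engelForm X W s (engelField X W s) = 0 :=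
    Eventually.of_forall fun _ => engelForm_engelField
  have hmX : ∀ᶠ s in 𝓝 s, X s ∈ orthDist X s := hX.eventually.mono fun _ h => h.frame_mem.1
  have hmY : ∀ᶠ s in 𝓝 s, engelField X W s ∈ orthDist X s :=
    hX.eventually.mono fun _ h => engelField_mem h
  have hWS : ∀ᶠ s in 𝓝 s, W s (frameBracket X s) = 0 := hfacts.mono fun _ h => h.1
  have hWX : ∀ᶠ s in 𝓝 s, W s (X s) = 0 := by
    filter_upwards [hW, hmX] with s h1 h2 using ((h1.mem_iff _).1 h2).2
  have hWY : ∀ᶠ s in 𝓝 s, W s (engelField X W s) = 0 := by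
    filter_upwards [hW, hmY] with s h1 h2 using ((h1.mem_iff _).1 h2).2
  have hXY : ∀ᶠ s in 𝓝 s, dform W s (X s) (engelField X W s) = 0 := by
    filter_upwards [hW, hmX, hmY] with s h1 h2 h3 using h1.dform_eq _ h2 _ h3
  have hYS : ∀ᶠ s in 𝓝 s, dform W s (engelField X W s) (frameBracket X s) = 0 :=
    hθY.mono fun s h => by rw [dform_swap]; exact neg_eq_zero.2 h
  -- Apply `d(dW) = 0` to `S`, `X` and the Engel field `Y`. The derivative terms vanish. The
  -- brackets `[S, X]` and `[Y, S]` lie in `ker W`, where `dW` annihilates `X` and `Y` since `U` and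
  -- `θ` do; what remains is `θ([X, Y]) = 0`.
  have hcyc := dform_cyclic hW0.smooth dS dX dY
  rw [fderiv_eq_zero_of_eventually hXY, fderiv_eq_zero_of_eventually hYS,
    fderiv_eq_zero_of_eventually (f := fun s => dform W s (frameBracket X s) (X s)) hθX] at hcyc
  have hb1 : dform W s (VectorField.lieBracket ℝ (frameBracket X) X s) (engelField X W s) = 0 := by
    have h1 : W s (VectorField.lieBracket ℝ (frameBracket X) X s) = 0 := by
      rw [apply_lieBracket_eq_neg_dform dW dS dX hWS hWX]
      exact neg_eq_zero.2 hθX.self_of_nhds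
    have h2 := normSqAt_mul_dform hX hW h1 hWY.self_of_nhds
    rw [hθY.self_of_nhds, (mem_orthDist.1 hmY.self_of_nhds).1] at h2
    simpa [hn] using h2
  have hb2 : dform W s (VectorField.lieBracket ℝ (engelField X W) (frameBracket X) s) (X s) = 0 := by
    have h1 : W s (VectorField.lieBracket ℝ (engelField X W) (frameBracket X) s) = 0 := by
      rw [apply_lieBracket_eq_neg_dform dW dY dS hWY hWS, hYS.self_of_nhds, neg_zero]
    have h2 := normSqAt_mul_dform hX hW h1 hWX.self_of_nhds
    rw [hθX.self_of_nhds, (mem_orthDist.1 hmX.self_of_nhds).1] at h2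
    simpa [hn] using h2
  rw [hb1, hb2] at hcyc
  have hb3 : engelForm X W s (VectorField.lieBracket ℝ X (engelField X W) s) = 0 := by
    change dform W s (frameBracket X s) _ = 0
    rw [dform_swap]
    simpa using hcyc.symm
  have h1 := apply_lieBracket_eq_neg_dform dθ dX dY hθX hθY
  rw [hb3] at h1
  exact neg_eq_zero.1 h1.symm

/-- Vectors of `X^⊥` on which the Engel form vanishes. -/
theorem exists_engel_coeffs (hX : IsCartanNear X s) (hW : ∀ᶠ s in 𝓝 s, IsAdaptedAt X W s)
    (hf : ¬ IsFlatAt W s) {v : J1} (hv : v ∈ orthDist X s) (hθ : engelForm X W s v = 0) :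
    ∃ a b : ℝ, v = a • X s + b • engelField X W s := by
  have hX0 := hW.self_of_nhds.ne_zero
  obtain ⟨w, hw, hθw⟩ := exists_engelForm_ne_zero hX hW hf
  obtain ⟨a, b, c, rfl⟩ := hX.exists_coeffs hX0 hv
  obtain ⟨a', b', c', rfl⟩ := hX.exists_coeffs hX0 hw
  have hθX := (frameBracket_facts hX hW).2.2
  simp only [map_add, map_smul, smul_eq_mul, hθX, mul_zero, zero_add] at hθ hθw
  by_cases h2 : engelForm X W s (frameTwo X s) = 0
  · have h1 : engelForm X W s (frameOne X s) ≠ 0 := by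
      intro h1
      apply hθw
      rw [h1, h2]
      ring
    have hb : b = 0 := by
      rw [h2, mul_zero, add_zero] at hθ
      exact (mul_eq_zero.1 hθ).resolve_right h1
    refine ⟨a, - c / engelForm X W s (frameOne X s), ?_⟩
    rw [engelField, h2, hb, zero_smul, add_zero, zero_sub, smul_neg, smul_smul,
      neg_div, neg_mul, div_mul_cancel₀ _ h1]
    module
  · refine ⟨a, b / engelForm X W s (frameTwo X s), ?_⟩
    have hc : c = - (b / engelForm X W s (frameTwo X s) * engelForm X W s (frameOne X s)) := by
      field_simp
      linarith
    rw [engelField, smul_sub, smul_smul, smul_smul, div_mul_cancel₀ _ h2, hc]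
    module

/-- A function whose differential vanishes on `X` and on the Engel field, but not on `X^⊥`. -/
theorem exists_firstIntegral_engel (hX : IsCartanNear X m)
    (hW : ∀ᶠ s in 𝓝 m, IsAdaptedAt X W s) (hf : ∀ᶠ s in 𝓝 m, ¬ IsFlatAt W s) :
    ∃ (y : J1 → ℝ) (a : Fin 3 → J1 → ℝ), ∀ᶠ s in 𝓝 m, ContDiffAt ℝ ∞ y s ∧ a 2 s ≠ 0 ∧
      ∀ v, fderiv ℝ y s v =
        a 0 s * contactForm s v + a 1 s * W s v + a 2 s * engelForm X W s v := by
  obtain ⟨y, a, hy⟩ := exists_firstIntegral (m := m) (α := ![contactForm, W, engelForm X W]) (by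
      intro i
      fin_cases i
      · exact Eventually.of_forall fun _ => contDiff_contactForm.contDiffAt
      · exact hW.mono fun _ h => h.smooth
      · filter_upwards [hX, hW] with s h1 h2 using contDiffAt_engelForm h1.1 h2.smooth) (by
      obtain ⟨v, hv, hθ⟩ := exists_engelForm_ne_zero hX hW hf.self_of_nhds
      have h1 := (hW.self_of_nhds.mem_iff v).1 hv
      exact linearIndependent_vec_three
        (linearIndependent_triple hW.self_of_nhds.independent h1.1 h1.2 hθ)) (by
      filter_upwards [hX.eventually, hW.eventually_nhds, hf] with s h1 h2 h3 u v hu hv i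
      have h20 := h2.self_of_nhds
      have hu' : u ∈ orthDist X s := (h20.mem_iff u).2 ⟨hu 0, hu 1⟩
      have hv' : v ∈ orthDist X s := (h20.mem_iff v).2 ⟨hv 0, hv 1⟩
      obtain ⟨a, b, e₁⟩ := exists_engel_coeffs h1 h2 h3 hu' (hu 2)
      obtain ⟨a', b', e₂⟩ := exists_engel_coeffs h1 h2 h3 hv' (hv 2)
      -- The kernel of the system is spanned by `X` and the Engel field, so one value of each
      -- exterior derivative decides integrability.
      have hspan : ∀ β : J1 → J1 →L[ℝ] ℝ, dform β s (X s) (engelField X W s) = 0 →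
          dform β s u v = 0 := by
        intro β hβ
        have hβ' := dform_swap (α := β) (q := s) (engelField X W s) (X s)
        rw [hβ] at hβ'
        rw [e₁, e₂]
        simp [hβ, hβ']
      fin_cases i
      · refine hspan contactForm ?_
        rw [← h1.lieDerivForm_contactForm]
        exact (engelField_mem h1).2
      · exact h20.dform_eq u hu' v hv'
      · exact hspan _ (dform_engelForm h1 h2)) 2
  refine ⟨y, a, ?_⟩
  filter_upwards [hy] with s ⟨h1, _, h3, h4⟩
  refine ⟨h1, h4, fun v => ?_⟩
  rw [h3, Fin.sum_univ_three]
  rfl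

/-- Normal form when the second derived distribution of `X^⊥` is the whole tangent space. -/
theorem hasNormalFormAt_of_not_flat {M : Set J1} (hM : M ∈ 𝓝 m) (hX : IsCartanNear X m)
    (hW : ∀ᶠ s in 𝓝 m, IsAdaptedAt X W s) (hf : ∀ᶠ s in 𝓝 m, ¬ IsFlatAt W s) :
    HasNormalFormAt M X m := by
  obtain ⟨y, a, hy⟩ := exists_firstIntegral_engel hX hW hf
  have hyP : ∀ᶠ s in 𝓝 m, fderiv ℝ y s (X s) = 0 ∧ ∃ v ∈ orthDist X s, fderiv ℝ y s v ≠ 0 := by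
    filter_upwards [hX.eventually, hW.eventually_nhds, hf, hy] with s h1 h2 h3 ⟨_, h4, h5⟩
    have hmem := h2.self_of_nhds.mem_iff
    constructor
    · have h6 := (hmem _).1 h1.frame_mem.1
      rw [h5, h6.1, h6.2, (frameBracket_facts h1 h2).2.2]
      ring
    · obtain ⟨v, hv, hθ⟩ := exists_engelForm_ne_zero h1 h2 h3
      have h6 := (hmem v).1 hv
      refine ⟨v, hv, ?_⟩
      rw [h5, h6.1, h6.2]
      simpa using ⟨h4, hθ⟩
  -- On `ker W`, `dW` is a multiple of `θ ∧ U` and `dy = a₀ U + a₂ θ` with `a₂ ≠ 0`, so `dW` is a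
  -- multiple of `dy ∧ U` and vanishes where `dy` does. Hence `W, dy` is integrable.
  obtain ⟨x, b, hx⟩ := exists_firstIntegral (m := m) (α := ![W, fderiv ℝ y]) (by
      exact Fin.forall_fin_two.2 ⟨hW.mono fun _ h => h.smooth, hy.mono fun _ h => h.1.fderiv_smooth⟩)
    (by
      obtain ⟨v, hv, hyv⟩ := hyP.self_of_nhds.2
      have hWm := hW.self_of_nhds
      have hWv := ((hWm.mem_iff v).1 hv).2
      refine linearIndependent_vec_two ?_
      rw [LinearIndependent.pair_iff]
      intro r t hrt
      have h1 := congrArg (fun L => L v) hrt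
      simp only [add_apply, smul_apply, smul_eq_mul, hWv, mul_zero, zero_add, zero_apply] at h1
      have ht : t = 0 := (mul_eq_zero.1 h1).resolve_right hyv
      rw [ht, zero_smul, add_zero] at hrt
      exact ⟨(smul_eq_zero.1 hrt).resolve_right (hWm.independent.ne_zero 1), ht⟩) (by
      filter_upwards [hX.eventually, hW.eventually_nhds, hy] with s h1 h2 ⟨h3, h4, h5⟩ u v hu hv
      have hn := normSqAt_ne_zero h1.self_of_nhds.2 h2.self_of_nhds.ne_zero
      have hu0 : W s u = 0 := hu 0
      have hv0 : W s v = 0 := hv 0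
      have hu1 : fderiv ℝ y s u = 0 := hu 1
      have hv1 : fderiv ℝ y s v = 0 := hv 1
      rw [h5, hu0] at hu1
      rw [h5, hv0] at hv1
      refine Fin.forall_fin_two.2 ⟨?_, ?_⟩
      · have h6 := normSqAt_mul_dform h1 h2 hu0 hv0
        have h7 : a 2 s * normSqAt X s * dform W s u v = 0 := by
          linear_combination a 2 s * h6 + contactForm s v * hu1 - contactForm s u * hv1
        exact (mul_eq_zero.1 h7).resolve_left (mul_ne_zero h4 hn)
      · change dform (fderiv ℝ y) s u v = 0
        rw [dform_fderiv h3]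
        rfl) 0
  have hx' : ∀ᶠ s in 𝓝 m, ContDiffAt ℝ ∞ x s ∧ ContDiffAt ℝ ∞ (b 0) s ∧ ContDiffAt ℝ ∞ (b 1) s ∧
      b 0 s ≠ 0 ∧ ∀ v, fderiv ℝ x s v = b 0 s * W s v + b 1 s * fderiv ℝ y s v := by
    filter_upwards [hx] with s ⟨h1, h2, h3, h4⟩
    refine ⟨h1, h2 0, h2 1, h4, fun v => ?_⟩
    rw [h3, Fin.sum_univ_two]
    rfl
  -- This is the exterior derivative of `dx = b₀ W + b₁ dy`, restricted to `ker W`.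
  have hrel : ∀ᶠ s in 𝓝 m, ∀ u v, W s u = 0 → W s v = 0 → b 0 s * dform W s u v +
      (fderiv ℝ (b 1) s u * fderiv ℝ y s v - fderiv ℝ (b 1) s v * fderiv ℝ y s u) = 0 := by
    filter_upwards [hx'.eventually_nhds, hW, hy] with s h1 h2 h3 u v hu hv
    obtain ⟨h4, h5, h6, -, -⟩ := h1.self_of_nhds
    have h7 := dform_of_coeffs (q := s) (α := ![W, fderiv ℝ y]) (β := fderiv ℝ x) (a := b)
      (Fin.forall_fin_two.2 ⟨h2.smooth.differentiableAt (by simp),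
        h3.1.fderiv_smooth.differentiableAt (by simp)⟩)
      (Fin.forall_fin_two.2 ⟨h5.differentiableAt (by simp), h6.differentiableAt (by simp)⟩)
      (by
        filter_upwards [h1] with s hs v
        rw [hs.2.2.2.2, Fin.sum_univ_two]
        rfl) u v
    rw [dform_fderiv h4, Fin.sum_univ_two] at h7
    simp only [zero_apply, Matrix.cons_val_zero, Matrix.cons_val_one, hu, hv, dform_fderiv h3.1] at h7
    linarith
  -- With this sign `b₀ W = dx + z dy`, so `X^⊥` is given by `U = 0` and `dx = -z dy`.
  let z : J1 → ℝ := fun s => - b 1 s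
  have hz : ∀ᶠ s in 𝓝 m, ContDiffAt ℝ ∞ z s ∧ ∀ v, fderiv ℝ z s v = - fderiv ℝ (b 1) s v := by
    filter_upwards [hx'] with s h1
    refine ⟨h1.2.2.1.neg, fun v => ?_⟩
    simp only [z, fderiv_fun_neg, neg_apply]
  obtain ⟨c, hc⟩ := exists_smooth_coeffs (m := m) (α := ![contactForm, fderiv ℝ x, fderiv ℝ y])
    (β := fderiv ℝ z) (by
      intro i
      fin_cases i
      · exact Eventually.of_forall fun _ => contDiff_contactForm.contDiffAt
      · exact hx'.mono fun _ h => h.1.fderiv_smooth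
      · exact hy.mono fun _ h => h.1.fderiv_smooth) (by
      refine linearIndependent_vec_three ?_
      obtain ⟨v, hv, hyv⟩ := hyP.self_of_nhds.2
      have hWm := hW.self_of_nhds
      have hv' := (hWm.mem_iff v).1 hv
      obtain ⟨-, -, -, hb0, hxv⟩ := hx'.self_of_nhds
      have h3 : fderiv ℝ x m = b 0 m • W m + b 1 m • fderiv ℝ y m := by
        ext v
        simp [hxv]
      have h4 := linearIndependent_triple hWm.independent hv'.1 hv'.2 hyv
      rw [h3]
      rw [Fintype.linearIndependent_iff] at h4 ⊢
      intro g hg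
      have h5 := h4 ![g 0, g 1 * b 0 m, g 1 * b 1 m + g 2] (by
        rw [Fin.sum_univ_three] at hg ⊢
        simp only [Matrix.cons_val_zero, Matrix.cons_val_one, Matrix.cons_val] at hg ⊢
        rw [← hg]
        module)
      have h50 : g 0 = 0 := h5 0
      have h51 : g 1 * b 0 m = 0 := h5 1
      have h52 : g 1 * b 1 m + g 2 = 0 := h5 2
      have h6 : g 1 = 0 := (mul_eq_zero.1 h51).resolve_right hb0
      rw [h6, zero_mul, zero_add] at h52
      intro i
      fin_cases i <;> assumption) (hz.mono fun _ h => h.1.fderiv_smooth) (by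
      -- To express `dz` by `U, dx, dy`, take `u` killed by these three. Then `W(u) = θ(u) = 0`,
      -- hence `dW(u, ·) = 0` on `ker W`. Testing `hrel` against a vector of `X^⊥` with `dy ≠ 0`
      -- yields `db₁(u) = 0`.
      filter_upwards [hX.eventually, hW.eventually_nhds, hx', hy, hyP, hrel, hz]
        with s h1 h2 h3 h4 h5 h6 h7 u hu
      have hn := normSqAt_ne_zero h1.self_of_nhds.2 h2.self_of_nhds.ne_zero
      have hu0 : contactForm s u = 0 := hu 0
      have hu1 : fderiv ℝ x s u = 0 := hu 1
      have hu2 : fderiv ℝ y s u = 0 := hu 2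
      have huW : W s u = 0 := by
        rw [h3.2.2.2.2, hu2, mul_zero, add_zero] at hu1
        exact (mul_eq_zero.1 hu1).resolve_left h3.2.2.2.1
      have huθ : engelForm X W s u = 0 := by
        have h8 := h4.2.2 u
        rw [hu2, hu0, huW] at h8
        simpa [h4.2.1] using h8
      obtain ⟨v, hv, hyv⟩ := h5.2
      have hvW := ((h2.self_of_nhds.mem_iff v).1 hv).2
      have h8 := normSqAt_mul_dform h1 h2 huW hvW
      rw [hu0, huθ] at h8
      have h9 : dform W s u v = 0 := by simpa [hn] using h8
      have h10 := h6 u v huW hvW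
      rw [h9, hu2] at h10
      have h11 : fderiv ℝ (b 1) s u = 0 := by simpa [hyv] using h10
      rw [h7.2, h11, neg_zero])
  refine hasNormalFormAt_of_jetCoords (x := x) (y := y) (z := z) (p := c 1) (q := c 2) (c := c 0)
    (l := z) hM hX hW.self_of_nhds.ne_zero ?_ (Or.inr rfl) ?_ (hyP.mono fun _ h => h.1) ?_
    (hyP.mono fun _ h => h.2)
  · filter_upwards [hx', hy, hz, hc, hrel, hf] with s h1 h2 h3 ⟨h4, h5⟩ h6 h7
    have h5' : ∀ v, fderiv ℝ z s v =
        c 0 s * contactForm s v + c 1 s * fderiv ℝ x s v + c 2 s * fderiv ℝ y s v := fun v => by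
      rw [h5, Fin.sum_univ_three]
      rfl
    -- If the coefficient of `U` were zero, `db₁` would be a multiple of `dy` on `ker W`, and `hrel`
    -- would force `dW = 0` there, against non-flatness.
    refine ⟨h1.1, h2.1, h3.1, h4 1, h4 2, h4 0, fun h0 => h7 ?_, h5'⟩
    intro u v hu hv
    have h8 := h6 u v hu hv
    have hb : ∀ v, W s v = 0 →
        fderiv ℝ (b 1) s v = - ((c 1 s * b 1 s + c 2 s) * fderiv ℝ y s v) := by
      intro v hv
      have h9 := h5' v
      rw [h3.2, h0, h1.2.2.2.2, hv] at h9
      linarith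
    rw [hb u hu, hb v hv] at h8
    have h9 : b 0 s * dform W s u v = 0 := by linear_combination h8
    exact (mul_eq_zero.1 h9).resolve_left h1.2.2.2.1
  · filter_upwards [hx', hX.eventually, hW, hyP] with s h1 h2 h3 h4
    rw [h1.2.2.2.2, h4.1, ((h3.mem_iff _).1 h2.frame_mem.1).2]
    ring
  · filter_upwards [hx', hW] with s h1 h2 v hv
    rw [h1.2.2.2.2, ((h2.mem_iff _).1 hv).2]
    simp [z]

end CartanField

/-! ### Openness, closedness and the two equivalences -/

namespace CartanField

variable {X : J1 → J1} {W : J1 → J1 →L[ℝ] ℝ} {m : J1}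

/-- Non-flatness means that the Engel form is nonzero on `X^⊥`. It vanishes on `X`, so it is nonzero
on one of the two smooth frame fields, and this persists nearby. -/
theorem eventually_not_isFlatAt (hX : IsCartanNear X m) (hW : ∀ᶠ s in 𝓝 m, IsAdaptedAt X W s)
    (hf : ¬ IsFlatAt W m) : ∀ᶠ s in 𝓝 m, ¬ IsFlatAt W s := by
  have key : ∀ F : J1 → J1, ContDiffAt ℝ ∞ F m → (∀ᶠ s in 𝓝 m, F s ∈ orthDist X s) →
      engelForm X W m (F m) ≠ 0 → ∀ᶠ s in 𝓝 m, ¬ IsFlatAt W s := by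
    intro F hF hFm hne
    have hc : ContinuousAt (fun s => engelForm X W s (F s)) m :=
      ((contDiffAt_engelForm hX.contDiffAt hW.self_of_nhds.smooth).clm_apply hF).continuousAt
    filter_upwards [hc.eventually_ne hne, hX.eventually, hW.eventually_nhds, hFm]
      with s h1 h2 h3 h4 hflat
    exact h1 (hflat _ _ (frameBracket_facts h2 h3).2.1 ((h3.self_of_nhds.mem_iff _).1 h4).2)
  obtain ⟨v, hv, hθ⟩ := exists_engelForm_ne_zero hX hW hf
  obtain ⟨a, b, c, rfl⟩ := hX.exists_coeffs hW.self_of_nhds.ne_zero hv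
  obtain ⟨f1, f2⟩ := contDiffAt_frame hX.contDiffAt
  by_cases h1 : engelForm X W m (frameOne X m) = 0
  · refine key _ f2 (hX.eventually.mono fun _ h => h.frame_mem.2.2) fun h2 => hθ ?_
    simp [h1, h2, (frameBracket_facts hX hW).2.2]
  · exact key _ f1 (hX.eventually.mono fun _ h => h.frame_mem.2.1) h1

/-- The distribution `X^⊥` varies with the point, so the vanishing is read as a linear dependence of
`α` on `U` and `X(U)`. Were the three forms independent at `m`, they would be independent at all
nearby points. -/
theorem apply_eq_zero_of_frequently {α : J1 → J1 →L[ℝ] ℝ} (hX : IsCartanNear X m) (hXm : X m ≠ 0)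
    (hα : ∀ᶠ s in 𝓝 m, ContDiffAt ℝ ∞ α s)
    (hf : ∃ᶠ s in 𝓝 m, ∀ v ∈ orthDist X s, α s v = 0) : ∀ v ∈ orthDist X m, α m v = 0 := by
  intro v hv
  by_contra hne
  obtain ⟨h1, h2⟩ := mem_orthDist.1 hv
  have hli := eventually_linearIndependent (m := m)
    (α := ![contactForm, lieDerivForm X contactForm, α]) (by
      intro i
      fin_cases i
      · exact Eventually.of_forall fun _ => contDiff_contactForm.contDiffAt
      · exact hX.eventually.mono fun _ h => h.contDiffAt_lieDerivForm
      · exact hα)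
    (linearIndependent_vec_three (linearIndependent_triple (hX.linearIndependent hXm) h1 h2 hne))
  obtain ⟨s, hs, hs'⟩ := (hf.and_eventually hli).exists
  obtain ⟨w, hw⟩ := surjective_pi_of_linearIndependent hs' ![0, 0, 1]
  have hw2 : α s w = 1 := congrFun hw 2
  rw [hs w (mem_orthDist.2 ⟨congrFun hw 0, congrFun hw 1⟩)] at hw2
  exact zero_ne_one hw2

/-- Rank 2 passes to limits: the rank cannot drop because `U` and `X(U)` are independent wherever `X
≠ 0`, and it cannot jump up by `apply_eq_zero_of_frequently`. -/
theorem typeAt_eq_two_of_frequently (hX : IsCartanNear X m) (hXm : X m ≠ 0)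
    (hf : ∃ᶠ s in 𝓝 m, typeAt X s = 2) : typeAt X m = 2 := by
  have hs2 : ∀ᶠ s in 𝓝 m, ContDiffAt ℝ ∞ (lieDerivForm X (lieDerivForm X contactForm)) s :=
    hX.eventually.mono fun _ h => h.contDiffAt.lieDerivForm h.contDiffAt_lieDerivForm
  have hs3 : ∀ᶠ s in 𝓝 m,
      ContDiffAt ℝ ∞ (lieDerivForm X (lieDerivForm X (lieDerivForm X contactForm))) s := by
    filter_upwards [hX.eventually, hs2] with s h1 h2 using h1.contDiffAt.lieDerivForm h2
  have hev := hf.and_eventually (hX.eventually.and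
    (hX.contDiffAt.continuousAt.eventually_ne hXm))
  have hiff := fun s (h : typeAt X s = 2 ∧ IsCartanNear X s ∧ X s ≠ 0) =>
    (h.2.1.typeAt_eq_two_iff h.2.2).1 h.1
  rw [hX.typeAt_eq_two_iff hXm]
  exact fun v hv => ⟨apply_eq_zero_of_frequently hX hXm hs2
      (hev.mono fun s h w hw => (hiff s h w hw).1) v hv,
    apply_eq_zero_of_frequently hX hXm hs3 (hev.mono fun s h w hw => (hiff s h w hw).2) v hv⟩

theorem hasNormalFormAt_iff {M : Set J1} (hM : M ∈ 𝓝 m) (hX : IsCartanNear X m) :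
    HasNormalFormAt M X m ↔ (∀ᶠ s in 𝓝 m, typeAt X s = 2) ∧ IsRegularAt X m := by
  constructor
  · intro h
    obtain ⟨W, hW, hr⟩ := exists_adapted_of_hasNormalFormAt hX h
    exact ⟨typeAt_eq_two_of_adapted hX hW, (isRegularAt_iff hX hW).2 hr⟩
  · rintro ⟨ht, hr⟩
    obtain ⟨W, hW⟩ := exists_adapted hX ht
    rcases (isRegularAt_iff hX hW).1 hr with hf | hf
    · exact hasNormalFormAt_of_flat hM hX hW hf
    · exact hasNormalFormAt_of_not_flat hM hX hW hf

theorem isOpen_setOf_hasNormalFormAt (M : Set J1) (X : J1 → J1) :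
    IsOpen {m | HasNormalFormAt M X m} := by
  rw [isOpen_iff_mem_nhds]
  rintro m ⟨φ, h1, h2, h3⟩
  filter_upwards [φ.open_source.mem_nhds h2] with s hs using ⟨φ, h1, hs, h3⟩

/-- If no point near `m` had a normal form, no point near `m` could be non-flat, since the non-flat
case applies around such a point. Then `W` would be flat near `m`, and `m` itself would have a
normal form. -/
theorem frequently_hasNormalFormAt {M : Set J1} (hM : M ∈ 𝓝 m) (hX : IsCartanNear X m)
    (ht : ∀ᶠ s in 𝓝 m, typeAt X s = 2) : ∃ᶠ s in 𝓝 m, HasNormalFormAt M X s := by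
  intro hno
  obtain ⟨W, hW⟩ := exists_adapted hX ht
  refine hno.self_of_nhds (hasNormalFormAt_of_flat hM hX hW ?_)
  filter_upwards [hno, hX.eventually, hW.eventually_nhds, eventually_mem_nhds_iff.2 hM]
    with s h1 h2 h3 h4
  by_contra hf
  exact h1 (hasNormalFormAt_of_not_flat h4 h2 h3 (eventually_not_isFlatAt h2 h3 hf))

end CartanField

end

theorem mainTheorem7 (M : Set CartanField.J1) (hM : IsOpen M)
    (X : CartanField.J1 → CartanField.J1) (hX : CartanField.IsCartanField M X) :
    (∀ m ∈ M, CartanField.HasNormalFormAt M X m ↔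
      (∀ᶠ m' in 𝓝 m, CartanField.typeAt X m' = 2) ∧ CartanField.IsRegularAt X m) ∧
    ((∀ m ∈ M, X m ≠ 0) →
      ((∀ m ∈ M, CartanField.typeAt X m = 2) ↔
        ∃ W : Set CartanField.J1, IsOpen W ∧ W ⊆ M ∧ M ⊆ closure W ∧
          ∀ m ∈ W, CartanField.HasNormalFormAt M X m)) := by
  have hnear : ∀ m ∈ M, CartanField.IsCartanNear X m := fun m hm => hX.isCartanNear hM hm
  have hiff := fun m hm => CartanField.hasNormalFormAt_iff (hM.mem_nhds hm) (hnear m hm)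
  refine ⟨hiff, fun hne => ⟨fun ht => ?_, ?_⟩⟩
  · refine ⟨{m | CartanField.HasNormalFormAt M X m},
      CartanField.isOpen_setOf_hasNormalFormAt M X, ?_, ?_, fun _ h => h⟩
    · rintro m ⟨φ, -, h2, h3, -⟩
      exact h3 h2
    · intro m hm
      exact mem_closure_iff_frequently.2 (CartanField.frequently_hasNormalFormAt (hM.mem_nhds hm)
        (hnear m hm) (Filter.eventually_of_mem (hM.mem_nhds hm) ht))
  · rintro ⟨W, -, hWM, hdense, hW⟩ m hm
    exact CartanField.typeAt_eq_two_of_frequently (hnear m hm) (hne m hm)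
      ((mem_closure_iff_frequently.1 (hdense hm)).mono fun s hs =>
        ((hiff s (hWM hs)).1 (hW s hs)).1.self_of_nhds)
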